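/- Let $n\ge 1$, let $\mathbb B_n$ and $\mathbb S_n$ be the open unit ball and the unit sphere of $\mathbb C^n$, and let $v$ and $\sigma$ be the normalized volume measure on $\mathbb B_n$ and the normalized surface measure on $\mathbb S_n$. Let $\rho$ be a positive continuous integrable function on $[0,1)$ with $\int_0^1 x^{2n-1}\rho(x)\,dx=1$, and let $r_k\in[0,1)$, $k\ge 0$, be the points with $\int_{r_k}^1\rho(x)\,dx=2^{-k}$. Assume that $\rho$ belongs to Seip's class $S$, that is, $\inf_{k}\frac{1-r_k}{1-r_{k+1}}>1$. Let $A^2_\rho$ be the space of holomorphic functions $f$ on $\mathbb B_n$ with $\|f\|_{A^2_\rho}^2=\int_{\mathbb B_n}|f(z)|^2\rho(|z|)\,dv(z)<\infty$, and let $H^2$ be the Hardy space of holomorphic functions $f$ on $\mathbb B_n$ with $\|f\|_{H^2}^2=\sup_{0<r<1}\int_{\mathbb S_n}|f(r\xi)|^2\,d\sigma(\xi)<\infty$. For $X=A^2_\rho$ or $X=H^2$, a finite positive Borel measure $\nu$ on $\mathbb B_n$ is called a Carleson measure for $X$ if there is a constant $C>0$ such that $\int_{\mathbb B_n}|f|^2\,d\nu\le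 C\|f\|_X^2$ for all $f\in X$; the Carleson constant $\mathcal C_\nu(X)$ is the least $C\ge 0$ for which this inequality holds, i.e. the square of the norm of the identity operator $X\to L^2(\nu)$ (and $\infty$ if $\nu$ is not a Carleson measure for $X$). A Carleson measure $\nu$ for $X$ is called vanishing if the identity operator $X\to L^2(\nu)$ is compact. Let $\mu$ be a finite positive Borel measure on $\mathbb B_n$, let $\Omega_k=\{z\in\mathbb B_n: r_k\le|z|<r_{k+1}\}$, and let $\mu_k=\chi_{\Omega_k}\mu$ for $k\ge 0$. Then: (i) $\mu$ is a Carleson measure for $A^2_\rho$ if and only if every $\mu_k$, $k\ge 0$, is a Carleson measure for $H^2$ and there is a constant $C>0$, independent of $k$, such that $\mathcal C_{\mu_k}(H^2)\le C\,2^{-k}$ for all $k\ge 0$. (ii) $\mu$ is a vanishing Carleson measure for $A^2_\rho$ if and only if $\lim_{k\to\infty}2^k\,\mathcal C_{\mu_k}(H^2)=0$. -/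

import Mathlib

open MeasureTheory Set Filter Topology
open scoped ENNReal

noncomputable section

namespace SmallBergman

/-- Complex Euclidean space `ℂⁿ` with its Euclidean norm. -/
abbrev Cn (n : ℕ) : Type := EuclideanSpace ℂ (Fin n)

/-- The open unit ball of `ℂⁿ`. -/
abbrev unitBall (n : ℕ) : Set (Cn n) := Metric.ball (0 : Cn n) 1

/-- The normalized volume measure `v` on the unit ball (as a measure on `ℂⁿ`). -/
def ballVolume (n : ℕ) : Measure (Cn n) :=
  (volume (unitBall n))⁻¹ • (volume : Measure (Cn n)).restrict (unitBall n)

/-- The normalized surface measure `σ` on the unit sphere of `ℂⁿ`. -/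
def sphereMeasure (n : ℕ) : Measure (Metric.sphere (0 : Cn n) 1) :=
  ((volume : Measure (Cn n)).toSphere univ)⁻¹ • (volume : Measure (Cn n)).toSphere

/-- The squared norm `∫ |f(z)|² ρ(|z|) dv(z)` of the weighted Bergman space. -/
def bergmanNormSq (n : ℕ) (ρ : ℝ → ℝ) (f : Cn n → ℂ) : ℝ≥0∞ :=
  ∫⁻ z, ‖f z‖ₑ ^ 2 * ENNReal.ofReal (ρ ‖z‖) ∂(ballVolume n)

/-- The squared norm `sup_{0 < r < 1} ∫ |f(rξ)|² dσ(ξ)` of the Hardy space. -/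
def hardyNormSq (n : ℕ) (f : Cn n → ℂ) : ℝ≥0∞ :=
  ⨆ r ∈ Ioo (0 : ℝ) 1, ∫⁻ ξ, ‖f (r • (ξ : Cn n))‖ₑ ^ 2 ∂(sphereMeasure n)

/-- The space of all functions holomorphic in the unit ball whose squared norm `N` is finite.
With `N = bergmanNormSq n ρ` this is `A²_ρ`, with `N = hardyNormSq n` it is `H²`. -/
def holSpace {n : ℕ} (N : (Cn n → ℂ) → ℝ≥0∞) : Set (Cn n → ℂ) :=
  {f | DifferentiableOn ℂ f (unitBall n) ∧ N f < ∞}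

/-- `μ` is a Carleson measure for the space with squared norm `N`. -/
def IsCarleson {n : ℕ} (N : (Cn n → ℂ) → ℝ≥0∞) (μ : Measure (unitBall n)) : Prop :=
  ∃ C : ℝ, 0 < C ∧ ∀ f ∈ holSpace N, ∫⁻ z, ‖f (z : Cn n)‖ₑ ^ 2 ∂μ ≤ ENNReal.ofReal C * N f

/-- The Carleson constant: the least `C` with `∫ |f|² dμ ≤ C ‖f‖²` on the whole space
(`∞` if there is none). -/
def carlesonConst {n : ℕ} (N : (Cn n → ℂ) → ℝ≥0∞) (μ : Measure (unitBall n)) : ℝ≥0∞ :=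
  sInf {C : ℝ≥0∞ | ∀ f ∈ holSpace N, ∫⁻ z, ‖f (z : Cn n)‖ₑ ^ 2 ∂μ ≤ C * N f}

/-- `μ` is a vanishing Carleson measure: it is a Carleson measure and the identity operator into
`L²(μ)` is compact, i.e. it maps the closed unit ball to a relatively compact set. -/
def IsVanishingCarleson {n : ℕ} (N : (Cn n → ℂ) → ℝ≥0∞) (μ : Measure (unitBall n)) : Prop :=
  IsCarleson N μ ∧
    IsCompact (closure {g : Lp ℂ 2 μ | ∃ f ∈ holSpace N, N f ≤ 1 ∧
      ∀ᵐ z ∂μ, g z = f (z : Cn n)})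

/-- Normalized (radial) weights: positive, continuous and integrable on `[0, 1)`, with
`∫₀¹ x^(2n-1) ρ(x) dx = 1`. -/
structure IsWeight (n : ℕ) (ρ : ℝ → ℝ) : Prop where
  pos : ∀ x ∈ Ico (0 : ℝ) 1, 0 < ρ x
  continuousOn : ContinuousOn ρ (Ico 0 1)
  integrableOn : IntegrableOn ρ (Ico 0 1)
  normalized : ∫ x in Ico (0 : ℝ) 1, x ^ (2 * n - 1) * ρ x = 1

/-- `r k` are the points of `[0, 1)` with `∫_{r k}^1 ρ(x) dx = 2^{-k}`; for a normalized weight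
there is exactly one such sequence. -/
def IsDyadicSeq (ρ : ℝ → ℝ) (r : ℕ → ℝ) : Prop :=
  ∀ k, r k ∈ Ico (0 : ℝ) 1 ∧ ∫ x in Ico (r k) 1, ρ x = (2 : ℝ)⁻¹ ^ k

/-- Seip's class `S`. -/
def ClassS (n : ℕ) (ρ : ℝ → ℝ) : Prop :=
  IsWeight n ρ ∧ ∃ r : ℕ → ℝ, IsDyadicSeq ρ r ∧ 1 < ⨅ k, (1 - r k) / (1 - r (k + 1))

/-- The annulus `Ω_k = {z : r_k ≤ |z| < r_{k+1}}` in the unit ball. -/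
def annulus (n : ℕ) (r : ℕ → ℝ) (k : ℕ) : Set (unitBall n) :=
  {z | r k ≤ ‖(z : Cn n)‖ ∧ ‖(z : Cn n)‖ < r (k + 1)}

end SmallBergman

end

noncomputable section

namespace SmallBergman

/-! ### Circle averages, unitary rotations and polar coordinates. -/

section

/-! ### Circle averages -/

/-! The measure `μ_k` lives in the ball of radius `r_{k+1} < 1`, so it is always a Carleson measure
for `H²`; the content is the size of its constant.

Hardy to Bergman. A function in `A²_ρ` need not be in `H²`, so the estimate for `μ_k` has to be
moved from the unit sphere to the spheres of radius `x ≥ r_{k+2}`. By duality, a Carleson estimate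
for `H²` bounds the quadratic form of the Szegő kernel `K(z,w) = (1 - ⟨z,w⟩)^{-n}` on `L²(μ_k)`.
With `u = ⟨z,w⟩` and `s = x⁻²`, the kernel of the ball of radius `x` is `K` times the `n`-th power
of `(1-u)/(1-su) = s⁻¹ + (1-s⁻¹) ∑ (su)^j`. This multiplier is positive definite, so by a Schur
product argument it enlarges the bound at most by its largest diagonal value
(`integral_norm_sq_le_of_carleson`). Class `S` says that `1 - x` is smaller than `1 - r_{k+1}` by a
fixed factor, which bounds that value independently of `k` (`ratio_le`). Averaging over `r_{k+2} ≤ x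
< r_{k+3}` against the weight, whose mass there is comparable to `2^{-k}`, cancels the constant `C
2^{-k}`. The shells are disjoint, so the estimates add up to the Bergman norm
(`ClassS.exists_outer_estimate`).

Bergman to Hardy. For `f ∈ H²`, the Bergman estimate is applied to the products of `f` with all
words of length `N ≈ 1/(1-r_k)` in the coordinates. Their squares sum to `|z|^{2N} |f|²`, which is
comparable to `|f|²` on the annulus, while their Bergman norms sum to at most a moment of `ρ` times
the Hardy norm. Class `S` makes that moment `O(2^{-k})` (`ClassS.exists_moment_bound`,
`ClassS.exists_annulus_estimate`).

Part (ii) uses the same estimates with small constants. Compactness of the embedding amounts to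
uniform smallness of the integrals near the boundary, since on a smaller ball functions bounded in
`A²_ρ` are uniformly bounded and the Schwarz lemma makes them equicontinuous.

The Szegő reproducing formula behind the duality is obtained from the Gaussian reproducing formula,
degree by degree, in polar coordinates. -/

theorem circleAverage_inv_pow_mul {h : ℂ → ℂ} (hh : DifferentiableOn ℂ h (Metric.closedBall 0 1))
    (m : ℕ) :
    Real.circleAverage (fun l => (l ^ m)⁻¹ * h l) 0 1 = (m.factorial : ℂ)⁻¹ * iteratedDeriv m h 0 := by
  have h1 := hh.circleIntegral_one_div_sub_center_pow_smul one_pos m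
  rw [Real.circleAverage_eq_circleIntegral one_ne_zero]
  have h2 : (∮ z in C(0, 1), (z - 0)⁻¹ • ((z ^ m)⁻¹ * h z)) =
      ∮ z in C(0, 1), (1 / (z - 0) ^ (m + 1)) • h z := by
    congr 1
    ext z
    simp only [smul_eq_mul, sub_zero, pow_succ, one_div, mul_inv]
    ring
  rw [h2, h1]
  have : (2 * Real.pi * Complex.I : ℂ) ≠ 0 := Complex.two_pi_I_ne_zero
  simp only [smul_eq_mul]
  field_simp

theorem iteratedDeriv_comp_mul_left (c : ℂ) (h : ℂ → ℂ) (m : ℕ) :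
    iteratedDeriv m (fun l => h (c * l)) = fun l => c ^ m * iteratedDeriv m h (c * l) := by
  induction m with
  | zero => simp
  | succ m ih =>
    rw [iteratedDeriv_succ, ih]
    ext l
    rw [deriv_const_mul_field, deriv_comp_mul_left c (iteratedDeriv m h), iteratedDeriv_succ,
      smul_eq_mul, pow_succ, mul_assoc]

/-! ### Rotations -/

variable {n : ℕ}

theorem measurePreserving_rotation {l : ℂ} (hl : ‖l‖ = 1) :
    MeasurePreserving (fun w : Cn n => l • w) volume volume := by
  have hl0 : l ≠ 0 := by
    rintro rfl
    simp at hl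
  let e : Cn n ≃ₗᵢ[ℝ] Cn n :=
    { LinearEquiv.restrictScalars ℝ (LinearEquiv.smulOfNeZero ℂ (Cn n) l hl0) with
      norm_map' := fun x => by
        change ‖l • x‖ = ‖x‖
        rw [norm_smul, hl, one_mul] }
  exact e.measurePreserving

/-- The normalized surface measure of the unit sphere, as a measure on `ℂⁿ`. -/
def surfaceMeasure (n : ℕ) : Measure (Cn n) := (sphereMeasure n).map (↑)

theorem measurableEmbedding_sphere :
    MeasurableEmbedding ((↑) : Metric.sphere (0 : Cn n) 1 → Cn n) :=
  MeasurableEmbedding.subtype_coe Metric.isClosed_sphere.measurableSet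

theorem lintegral_sphereMeasure (Φ : Cn n → ℝ≥0∞) :
    ∫⁻ ξ, Φ (ξ : Cn n) ∂(sphereMeasure n) = ∫⁻ ξ, Φ ξ ∂(surfaceMeasure n) :=
  (measurableEmbedding_sphere.lintegral_map _).symm

theorem ae_norm_surfaceMeasure : ∀ᵐ ξ ∂(surfaceMeasure n), ‖ξ‖ = 1 := by
  rw [surfaceMeasure, measurableEmbedding_sphere.ae_map_iff]
  exact ae_of_all _ fun ξ => by simp

theorem nontrivial_Cn (hn : 1 ≤ n) : Nontrivial (Cn n) := by
  have : Nonempty (Fin n) := ⟨⟨0, hn⟩⟩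
  infer_instance

/-- The total mass of the unnormalized surface measure. -/
def sphereMass (n : ℕ) : ℝ≥0∞ := (volume : Measure (Cn n)).toSphere univ

theorem sphereMass_ne_zero (hn : 1 ≤ n) : sphereMass n ≠ 0 := by
  have := nontrivial_Cn hn
  rw [sphereMass, Ne, Measure.measure_univ_eq_zero]
  exact Measure.toSphere_ne_zero _

theorem sphereMass_ne_top : sphereMass n ≠ ∞ := measure_ne_top _ _

theorem toSphere_eq_smul (hn : 1 ≤ n) :
    (volume : Measure (Cn n)).toSphere = sphereMass n • sphereMeasure n := by
  have h1 := ENNReal.mul_inv_cancel (sphereMass_ne_zero hn) sphereMass_ne_top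
  rw [sphereMeasure, smul_smul]
  unfold sphereMass at h1 ⊢
  rw [h1, one_smul]

theorem isProbabilityMeasure_surfaceMeasure (hn : 1 ≤ n) :
    IsProbabilityMeasure (surfaceMeasure n) := by
  constructor
  rw [surfaceMeasure, Measure.map_apply measurable_subtype_coe MeasurableSet.univ, preimage_univ,
    sphereMeasure, Measure.smul_apply, smul_eq_mul]
  exact ENNReal.inv_mul_cancel (sphereMass_ne_zero hn) sphereMass_ne_top

/-- Expressing `σ` through the volume of cones lets rotation invariance of volume pass to `σ`. -/
theorem surfaceMeasure_apply {s : Set (Cn n)} (hs : MeasurableSet s) :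
    surfaceMeasure n s = (sphereMass n)⁻¹ * ((Module.finrank ℝ (Cn n) : ℝ≥0∞) *
      volume {y : Cn n | ∃ x ∈ Ioo (0 : ℝ) 1, ∃ ξ ∈ s, ‖ξ‖ = 1 ∧ x • ξ = y}) := by
  rw [surfaceMeasure, Measure.map_apply measurable_subtype_coe hs, sphereMeasure,
    Measure.smul_apply, Measure.toSphere_apply' _ (measurable_subtype_coe hs), smul_eq_mul,
    sphereMass]
  congr 3
  ext y
  simp only [Set.mem_smul, mem_image, mem_preimage, Subtype.exists, mem_sphere_iff_norm, sub_zero,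
    mem_ofPred_eq]
  constructor
  · rintro ⟨x, hx, _, ⟨ξ, h1, h2, rfl⟩, rfl⟩
    exact ⟨x, hx, ξ, h2, h1, rfl⟩
  · rintro ⟨x, hx, ξ, h2, h1, rfl⟩
    exact ⟨x, hx, ξ, ⟨ξ, h1, h2, rfl⟩, rfl⟩

theorem measurePreserving_rotation_surfaceMeasure {l : ℂ} (hl : ‖l‖ = 1) :
    MeasurePreserving (fun w : Cn n => l • w) (surfaceMeasure n) (surfaceMeasure n) := by
  have hm : Measurable (fun w : Cn n => l • w) := measurable_const_smul l
  have hl0 : l ≠ 0 := by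
    rintro rfl
    simp at hl
  refine ⟨hm, ?_⟩
  ext s hs
  rw [Measure.map_apply hm hs, surfaceMeasure_apply hs, surfaceMeasure_apply (hm hs),
    ← (measurePreserving_rotation hl).measure_preimage_emb
      ((Homeomorph.smulOfNeZero l hl0).measurableEmbedding) {y | ∃ x ∈ _, ∃ ξ ∈ s, _}]
  congr 3
  ext y
  simp only [mem_ofPred_eq, mem_preimage]
  constructor
  · rintro ⟨x, hx, ξ, hξ, h1, rfl⟩
    exact ⟨x, hx, l • ξ, hξ, by rw [norm_smul, hl, h1, one_mul], smul_comm _ _ _⟩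
  · rintro ⟨x, hx, ξ, hξ, h1, h2⟩
    refine ⟨x, hx, l⁻¹ • ξ, by simpa [smul_smul, hl0] using hξ, ?_, ?_⟩
    · rw [norm_smul, norm_inv, hl, h1, inv_one, one_mul]
    · rw [smul_comm, h2, smul_smul, inv_mul_cancel₀ hl0, one_smul]

/-- Averaging over the circle action does not change an integral with respect to an invariant
measure. -/
theorem integral_circleAverage_smul {μ : Measure (Cn n)} [SFinite μ]
    (hμ : ∀ l : ℂ, ‖l‖ = 1 → MeasurePreserving (fun w : Cn n => l • w) μ μ)
    {Φ : Cn n → ℂ} (hΦ : Measurable Φ) (hi : Integrable Φ μ) :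
    ∫ w, Real.circleAverage (fun l => Φ (l • w)) 0 1 ∂μ = ∫ w, Φ w ∂μ := by
  have hmeas : Measurable (Function.uncurry fun (θ : ℝ) (w : Cn n) => Φ (circleMap 0 1 θ • w)) := by
    refine hΦ.comp ?_
    exact Measurable.smul ((continuous_circleMap 0 1).measurable.comp measurable_fst) measurable_snd
  have hnorm : ∀ θ : ℝ, ‖circleMap 0 1 θ‖ = 1 := fun θ => by simp
  have hne : ∀ θ : ℝ, circleMap 0 1 θ ≠ 0 := fun θ => circleMap_ne_center one_ne_zero
  have hrot : ∀ θ : ℝ, Integrable (fun w => Φ (circleMap 0 1 θ • w)) μ := fun θ =>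
    (hμ _ (hnorm θ)).integrable_comp_of_integrable hi
  have hint : ∀ (θ : ℝ) , ∫ w, Φ (circleMap 0 1 θ • w) ∂μ = ∫ w, Φ w ∂μ := fun θ =>
    (hμ _ (hnorm θ)).integral_comp
      (Homeomorph.smulOfNeZero (circleMap 0 1 θ) (hne θ)).measurableEmbedding Φ
  have hint' : ∀ (θ : ℝ) , ∫ w, ‖Φ (circleMap 0 1 θ • w)‖ ∂μ = ∫ w, ‖Φ w‖ ∂μ := fun θ =>
    (hμ _ (hnorm θ)).integral_comp
      (Homeomorph.smulOfNeZero (circleMap 0 1 θ) (hne θ)).measurableEmbedding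
      (fun w => ‖Φ w‖)
  have hprod : Integrable (Function.uncurry fun (θ : ℝ) (w : Cn n) => Φ (circleMap 0 1 θ • w))
      ((volume.restrict (uIoc 0 (2 * Real.pi))).prod μ) := by
    rw [integrable_prod_iff hmeas.aestronglyMeasurable]
    refine ⟨ae_of_all _ hrot, ?_⟩
    simp only [Function.uncurry, hint']
    rw [uIoc_of_le (by positivity)]
    exact integrable_const _
  simp only [Real.circleAverage_def]
  rw [integral_smul, ← intervalIntegral_integral_swap hprod]
  simp only [hint]
  rw [intervalIntegral.integral_const, sub_zero, smul_smul, inv_mul_cancel₀ (by positivity),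
    one_smul]

/-! ### Polar coordinates -/

theorem two_mul_pos_finrank : Module.finrank ℝ (Cn n) = 2 * n := by
  simp [finrank_real_of_complex]

theorem lintegral_polar (hn : 1 ≤ n) {Φ : Cn n → ℝ≥0∞} (hΦ : Measurable Φ) :
    ∫⁻ w, Φ w = sphereMass n * ∫⁻ x in Ioi (0 : ℝ), ENNReal.ofReal (x ^ (2 * n - 1)) *
      ∫⁻ ξ, Φ (x • ξ) ∂(surfaceMeasure n) := by
  have := nontrivial_Cn hn
  have hmp := (volume : Measure (Cn n)).measurePreserving_homeomorphUnitSphereProd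
  have hsph := toSphere_eq_smul hn
  have h1 : ∫⁻ w, Φ w = ∫⁻ w : ({0}ᶜ : Set (Cn n)), Φ w ∂(volume.comap Subtype.val) := by
    rw [lintegral_subtype_comap (measurableSet_singleton _).compl, restrict_compl_singleton]
  have h2 := hmp.lintegral_comp_emb (Homeomorph.measurableEmbedding _)
    (fun p => Φ (p.2.1 • (p.1 : Cn n)))
  have h3 : ∀ w : ({0}ᶜ : Set (Cn n)), ((homeomorphUnitSphereProd (Cn n) w).2.1 •
      ((homeomorphUnitSphereProd (Cn n) w).1 : Cn n)) = w := fun w => by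
    have h0 : ‖(w : Cn n)‖ ≠ 0 := norm_ne_zero_iff.2 w.2
    simp [smul_smul, h0]
  simp only [h3] at h2
  have hm : Measurable fun p : Metric.sphere (0 : Cn n) 1 × Ioi (0 : ℝ) =>
      Φ (p.2.1 • (p.1 : Cn n)) := by
    refine hΦ.comp ?_
    fun_prop
  rw [h1, h2, lintegral_prod_symm _ hm.aemeasurable, Measure.volumeIoiPow,
    lintegral_withDensity_eq_lintegral_mul _ (by fun_prop) (hm.lintegral_prod_left'),
    hsph]
  simp only [Pi.mul_apply, lintegral_smul_measure, two_mul_pos_finrank]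
  rw [← lintegral_const_mul' _ _ sphereMass_ne_top,
    ← lintegral_subtype_comap measurableSet_Ioi (fun x : ℝ => sphereMass n *
      (ENNReal.ofReal (x ^ (2 * n - 1)) * ∫⁻ ξ, Φ (x • ξ) ∂(surfaceMeasure n)))]
  refine lintegral_congr fun x => ?_
  rw [smul_eq_mul, lintegral_sphereMeasure (fun ξ => Φ (x.1 • ξ))]
  ring

/-- For a product of a radial and a spherical factor, the Bochner integral over the product space
factors unconditionally, so no integrability has to be supplied. -/
theorem integral_polar_of_eq_mul (hn : 1 ≤ n) {Φ H : Cn n → ℂ} {a : ℝ → ℂ}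
    (hΦ : ∀ x : ℝ, 0 < x → ∀ ξ : Cn n, ‖ξ‖ = 1 → Φ (x • ξ) = a x * H ξ) :
    ∫ w, Φ w = (sphereMass n).toReal * (∫ x in Ioi (0 : ℝ), (x : ℂ) ^ (2 * n - 1) * a x) *
      ∫ ξ, H ξ ∂(surfaceMeasure n) := by
  have := nontrivial_Cn hn
  have hmp := (volume : Measure (Cn n)).measurePreserving_homeomorphUnitSphereProd
  have hsph := toSphere_eq_smul hn
  have h1 : ∫ w, Φ w = ∫ w : ({0}ᶜ : Set (Cn n)), Φ w ∂(volume.comap Subtype.val) := by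
    rw [integral_subtype_comap (measurableSet_singleton _).compl, restrict_compl_singleton]
  have h2 := hmp.integral_comp (Homeomorph.measurableEmbedding _)
    (fun p => H (p.1 : Cn n) * a p.2.1)
  have h3 : ∀ w : ({0}ᶜ : Set (Cn n)), H ((homeomorphUnitSphereProd (Cn n) w).1 : Cn n) *
      a (homeomorphUnitSphereProd (Cn n) w).2.1 = Φ w := fun w => by
    have h0 : ‖(w : Cn n)‖ ≠ 0 := norm_ne_zero_iff.2 w.2
    rw [mul_comm, ← hΦ _ (homeomorphUnitSphereProd (Cn n) w).2.2 _ (mem_sphere_zero_iff_norm.1 (Subtype.prop _))]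
    simp [smul_smul, h0]
  simp only [h3] at h2
  rw [h1, h2, integral_prod_mul (fun ξ : Metric.sphere (0 : Cn n) 1 => H (ξ : Cn n))
    (fun x : Ioi (0 : ℝ) => a x), hsph, integral_smul_measure, surfaceMeasure,
    measurableEmbedding_sphere.integral_map, Measure.volumeIoiPow]
  simp only [ENNReal.ofReal]
  rw [integral_withDensity_eq_integral_smul (by fun_prop), two_mul_pos_finrank,
    integral_subtype_comap measurableSet_Ioi fun x : ℝ => Real.toNNReal (x ^ (2 * n - 1)) • a x,
    setIntegral_congr_fun measurableSet_Ioi (g := fun x : ℝ => (x : ℂ) ^ (2 * n - 1) * a x)]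
  · rw [Complex.real_smul]
    ring
  · intro x hx
    simp only [NNReal.smul_def, Real.coe_toNNReal _ (pow_nonneg (le_of_lt (mem_Ioi.1 hx)) _)]
    rw [Complex.real_smul]
    push_cast
    rfl

end

/-! ### Homogeneous expansion and the reproducing formula on the sphere. -/

section

variable {n : ℕ}

/-! ### Homogeneous components of a holomorphic function -/

/-- The homogeneous component of degree `m` of a function holomorphic near the origin. -/
def homPart (g : Cn n → ℂ) (m : ℕ) (w : Cn n) : ℂ :=
  (m.factorial : ℂ)⁻¹ * iteratedDeriv m (fun l : ℂ => g (l • w)) 0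

theorem homPart_smul (g : Cn n → ℂ) (m : ℕ) (c : ℂ) (w : Cn n) :
    homPart g m (c • w) = c ^ m * homPart g m w := by
  unfold homPart
  have : (fun l : ℂ => g (l • c • w)) = fun l => (fun l : ℂ => g (l • w)) (c * l) := by
    ext l
    simp only [smul_smul, mul_comm]
  rw [this, iteratedDeriv_comp_mul_left c (fun l : ℂ => g (l • w))]
  simp only [mul_zero]
  ring

theorem differentiableOn_slice {g : Cn n → ℂ} {ρ : ℝ} (hg : DifferentiableOn ℂ g (Metric.ball 0 ρ))
    {z u : Cn n} {s : Set ℂ} (hs : ∀ l ∈ s, ‖z + l • u‖ < ρ) :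
    DifferentiableOn ℂ (fun l : ℂ => g (z + l • u)) s := by
  refine hg.comp (f := fun l : ℂ => z + l • u) ?_ fun l hl => ?_
  · fun_prop
  · simpa using hs l hl

theorem differentiableOn_slice_zero {g : Cn n → ℂ} {ρ : ℝ}
    (hg : DifferentiableOn ℂ g (Metric.ball 0 ρ)) {w : Cn n} {s : Set ℂ}
    (hs : ∀ l ∈ s, ‖l‖ * ‖w‖ < ρ) : DifferentiableOn ℂ (fun l : ℂ => g (l • w)) s := by
  simpa using differentiableOn_slice hg (z := 0) (u := w) (s := s)
    (by simpa [norm_smul] using hs)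

theorem homPart_eq_circleAverage {g : Cn n → ℂ} {ρ : ℝ}
    (hg : DifferentiableOn ℂ g (Metric.ball 0 ρ)) (m : ℕ) {w : Cn n} (hw : ‖w‖ < ρ) :
    homPart g m w = Real.circleAverage (fun l => (l ^ m)⁻¹ * g (l • w)) 0 1 := by
  rw [homPart, ← circleAverage_inv_pow_mul]
  refine differentiableOn_slice_zero hg fun l hl => ?_
  have : ‖l‖ ≤ 1 := by simpa using hl
  nlinarith [norm_nonneg w]

theorem continuousOn_homPart {g : Cn n → ℂ} {ρ : ℝ}
    (hg : DifferentiableOn ℂ g (Metric.ball 0 ρ)) (m : ℕ) :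
    ContinuousOn (homPart g m) (Metric.ball 0 ρ) := by
  have h1 : ContinuousOn (fun w => Real.circleAverage (fun l => (l ^ m)⁻¹ * g (l • w)) 0 1)
      (Metric.ball 0 ρ) := by
    rw [continuousOn_iff_continuous_domRestrict]
    apply (intervalIntegral.continuous_parametric_intervalIntegral_of_continuous' _ _ _).const_smul
    refine Continuous.mul ?_ ?_
    · refine Continuous.inv₀ (by fun_prop) fun x => ?_
      exact pow_ne_zero _ (circleMap_ne_center one_ne_zero)
    · refine hg.continuousOn.comp_continuous (by fun_prop) fun x => ?_
      have := x.1.2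
      simp only [Metric.mem_ball, dist_zero_right] at this ⊢
      simpa [norm_smul] using this
  exact h1.congr fun w hw => homPart_eq_circleAverage hg m (by simpa using hw)

/-- Homogeneity extends continuity from the ball to the whole space: near `w₀`, everything is scaled
into the ball by `ρ / (‖w₀‖ + 1)`. -/
theorem continuous_homPart {g : Cn n → ℂ} {ρ : ℝ} (hρ : 0 < ρ)
    (hg : DifferentiableOn ℂ g (Metric.ball 0 ρ)) (m : ℕ) : Continuous (homPart g m) := by
  rw [continuous_iff_continuousAt]
  intro w₀
  set t : ℂ := ((ρ / (‖w₀‖ + 1) : ℝ) : ℂ) with ht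
  have htpos : 0 < ρ / (‖w₀‖ + 1) := by positivity
  have ht0 : t ≠ 0 := by
    rw [ht]
    exact_mod_cast htpos.ne'
  have h1 : homPart g m = fun w => (t ^ m)⁻¹ * homPart g m (t • w) := by
    ext w
    rw [homPart_smul, inv_mul_cancel_left₀ (pow_ne_zero _ ht0)]
  rw [h1]
  refine continuousAt_const.mul ?_
  refine ContinuousAt.comp (f := fun w : Cn n => t • w) (g := homPart g m) ?_ (by fun_prop)
  refine (continuousOn_homPart hg m).continuousAt (Metric.isOpen_ball.mem_nhds ?_)
  rw [mem_ball_zero_iff, norm_smul, ht, Complex.norm_real, Real.norm_of_nonneg htpos.le,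
    div_mul_eq_mul_div, div_lt_iff₀ (by positivity)]
  nlinarith

theorem circleAverage_comm {F : ℂ → ℂ → ℂ}
    (hF : Continuous fun p : ℝ × ℝ => F (circleMap 0 1 p.1) (circleMap 0 1 p.2)) :
    Real.circleAverage (fun a => Real.circleAverage (fun b => F a b) 0 1) 0 1 =
      Real.circleAverage (fun b => Real.circleAverage (fun a => F a b) 0 1) 0 1 := by
  simp only [Real.circleAverage_def, intervalIntegral.integral_smul]
  congr 2
  refine intervalIntegral_intervalIntegral_swap ?_
  exact (hF.continuousOn.integrableOn_compact (isCompact_uIcc.prod isCompact_uIcc)).mono_set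
    (prod_mono uIoc_subset_uIcc uIoc_subset_uIcc)

/-- This is the only form in which holomorphy of the homogeneous part is needed. After scaling `z`
and `u` into the ball, the homogeneous part is a circle average of `g`; the two averages commute,
and the mean value property is applied to `g` times the exponential. -/
theorem circleAverage_homPart_mul_exp {g : Cn n → ℂ} {ρ : ℝ} (hρ : 0 < ρ)
    (hg : DifferentiableOn ℂ g (Metric.ball 0 ρ)) (m : ℕ) (z u : Cn n) (c : ℂ) :
    Real.circleAverage (fun l => homPart g m (z + l • u) * Complex.exp (c * l)) 0 1 =
      homPart g m z := by
  set r : ℝ := ρ / (‖z‖ + ‖u‖ + 1) with hr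
  have hr0 : 0 < r := by positivity
  have hrlt : r * (‖z‖ + ‖u‖) < ρ := by
    rw [hr, div_mul_eq_mul_div, div_lt_iff₀ (by positivity)]
    nlinarith
  set t : ℂ := (r : ℂ) with ht
  have ht0 : t ≠ 0 := by
    rw [ht]
    exact_mod_cast hr0.ne'
  have htn : ‖t‖ = r := by rw [ht, Complex.norm_real, Real.norm_of_nonneg hr0.le]
  have hle : ∀ l : ℂ, ‖l‖ ≤ 1 → ∀ p : ℂ, ‖p‖ = 1 → ‖(p * t) • z + l • (p * t) • u‖ < ρ := by
    intro l hl p hp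
    calc ‖(p * t) • z + l • (p * t) • u‖ ≤ ‖(p * t) • z‖ + ‖l • (p * t) • u‖ := norm_add_le _ _
      _ = r * ‖z‖ + ‖l‖ * (r * ‖u‖) := by simp only [norm_smul, norm_mul, hp, htn, one_mul]
      _ ≤ r * (‖z‖ + ‖u‖) := by nlinarith [mul_nonneg hr0.le (norm_nonneg u)]
      _ < ρ := hrlt
  have key : ∀ v : Cn n, homPart g m v = (t ^ m)⁻¹ * homPart g m (t • v) := fun v => by
    rw [homPart_smul, inv_mul_cancel_left₀ (pow_ne_zero _ ht0)]
  have hsph : ∀ p : ℂ, p ∈ Metric.sphere (0 : ℂ) |1| → ‖p‖ = 1 := fun p hp => by simpa using hp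
  calc Real.circleAverage (fun l => homPart g m (z + l • u) * Complex.exp (c * l)) 0 1
      = Real.circleAverage (fun l => (t ^ m)⁻¹ • Real.circleAverage (fun p => (p ^ m)⁻¹ *
          (g ((p * t) • z + l • (p * t) • u) * Complex.exp (c * l))) 0 1) 0 1 := by
        refine Real.circleAverage_congr_sphere fun l hl => ?_
        have hl1 := hsph l hl
        have hlt : ‖t • (z + l • u)‖ < ρ := by
          have := hle l hl1.le 1 (by simp)
          rwa [one_mul, smul_comm, ← smul_add] at this
        rw [key, homPart_eq_circleAverage hg m hlt, smul_eq_mul, mul_assoc]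
        congr 1
        rw [mul_comm, ← smul_eq_mul, ← Real.circleAverage_fun_smul]
        congr 1
        ext p
        rw [smul_eq_mul, smul_smul, smul_add, smul_comm l, mul_left_comm, mul_comm (Complex.exp _)]
    _ = (t ^ m)⁻¹ • Real.circleAverage (fun l => Real.circleAverage (fun p => (p ^ m)⁻¹ *
          (g ((p * t) • z + l • (p * t) • u) * Complex.exp (c * l))) 0 1) 0 1 :=
        Real.circleAverage_fun_smul
    _ = (t ^ m)⁻¹ • Real.circleAverage (fun p => Real.circleAverage (fun l => (p ^ m)⁻¹ *
          (g ((p * t) • z + l • (p * t) • u) * Complex.exp (c * l))) 0 1) 0 1 := by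
        congr 1
        refine circleAverage_comm ?_
        refine Continuous.mul ?_ (Continuous.mul ?_ (by fun_prop))
        · refine Continuous.inv₀ (by fun_prop) fun x => ?_
          exact pow_ne_zero _ (circleMap_ne_center one_ne_zero)
        · refine hg.continuousOn.comp_continuous (by fun_prop) fun x => ?_
          rw [mem_ball_zero_iff]
          exact hle _ (by simp) _ (by simp)
    _ = (t ^ m)⁻¹ • Real.circleAverage (fun p => (p ^ m)⁻¹ * g (p • t • z)) 0 1 := by
        congr 1
        refine Real.circleAverage_congr_sphere fun p hp => ?_
        have hp1 := hsph p hp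
        have hd : DifferentiableOn ℂ (fun l => (p ^ m)⁻¹ *
            (g ((p * t) • z + l • (p * t) • u) * Complex.exp (c * l))) (Metric.closedBall 0 1) := by
          refine DifferentiableOn.const_mul (DifferentiableOn.mul ?_ (by fun_prop)) _
          exact differentiableOn_slice hg fun l hl => hle l (by simpa using hl) p hp1
        have := (hd.mono (Metric.closure_ball_subset_closedBall)).diffContOnCl
        rw [← abs_one (α := ℝ)] at this
        have := this.circleAverage
        rw [this]
        simp [smul_smul]
    _ = homPart g m z := by
        rw [key z, smul_eq_mul, homPart_eq_circleAverage hg m]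
        have := hle 0 (by simp) 1 (by simp)
        simpa using this

theorem hasSum_homPart {g : Cn n → ℂ} {ρ : ℝ} (hρ : 1 < ρ)
    (hg : DifferentiableOn ℂ g (Metric.ball 0 ρ)) {z : Cn n} (hz : ‖z‖ ≤ 1) :
    HasSum (fun m => homPart g m z) (g z) := by
  have hd : DifferentiableOn ℂ (fun l : ℂ => g (l • z)) (Metric.ball 0 ρ) := by
    refine differentiableOn_slice_zero hg fun l hl => ?_
    have : ‖l‖ < ρ := by simpa using hl
    nlinarith [norm_nonneg l, norm_nonneg z]
  have := Complex.hasSum_taylorSeries_on_ball hd (z := 1) (by simpa using hρ)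
  simpa [homPart] using this

end

section

variable {n : ℕ}

/-! ### The Cauchy–Szegő formula -/

theorem integrable_exp_neg_half_norm_sq :
    Integrable (fun w : Cn n => Real.exp (-(‖w‖ ^ 2 / 2))) := by
  have h := GaussianFourier.integrable_cexp_neg_mul_sq_norm_add (V := Cn n) (b := 1 / 2)
    (by norm_num) 0 0
  refine h.norm.congr (ae_of_all _ fun w => ?_)
  simp only [Complex.norm_exp]
  congr 1
  have : (-(1 / 2 : ℂ) * (‖w‖ : ℂ) ^ 2 + 0 * ((inner ℝ (0 : Cn n) w : ℝ) : ℂ)) =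
    ((-(‖w‖ ^ 2 / 2) : ℝ) : ℂ) := by push_cast; ring
  rw [this, Complex.ofReal_re]

/-- A function of polynomial growth is integrable against `exp (⟨z, w⟩ - ‖w‖²)`. -/
theorem integrable_mul_cexp_inner_sub {F : Cn n → ℂ} (hF : Continuous F) {B : ℝ} {m : ℕ}
    (hB : ∀ w, ‖F w‖ ≤ B * ‖w‖ ^ m) {E : Cn n → ℂ} (hE : Continuous E) {a : ℝ}
    (hEa : ∀ w, ‖E w‖ ≤ Real.exp (a * ‖w‖ - ‖w‖ ^ 2)) :
    Integrable (fun w => F w * E w) := by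
  refine Integrable.mono' (g := fun w => (|B| * (m.factorial * Real.exp ((1 + a) ^ 2 / 2))) *
    Real.exp (-(‖w‖ ^ 2 / 2))) (integrable_exp_neg_half_norm_sq.const_mul _)
    (hF.mul hE).aestronglyMeasurable (ae_of_all _ fun w => ?_)
  have h1 : ‖w‖ ^ m ≤ m.factorial * Real.exp ‖w‖ := by
    have := Real.pow_div_factorial_le_exp ‖w‖ (norm_nonneg _) m
    rwa [div_le_iff₀ (by positivity), mul_comm] at this
  have h2 : ‖F w‖ ≤ |B| * (m.factorial * Real.exp ‖w‖) :=
    (hB w).trans (mul_le_mul (le_abs_self B) h1 (by positivity) (abs_nonneg B))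
  have h3 : Real.exp ‖w‖ * Real.exp (a * ‖w‖ - ‖w‖ ^ 2) ≤
      Real.exp ((1 + a) ^ 2 / 2) * Real.exp (-(‖w‖ ^ 2 / 2)) := by
    rw [← Real.exp_add, ← Real.exp_add, Real.exp_le_exp]
    nlinarith [sq_nonneg (1 + a - ‖w‖)]
  calc ‖F w * E w‖ = ‖F w‖ * ‖E w‖ := norm_mul _ _
    _ ≤ |B| * (m.factorial * Real.exp ‖w‖) * Real.exp (a * ‖w‖ - ‖w‖ ^ 2) :=
        mul_le_mul h2 (hEa w) (norm_nonneg _) (by positivity)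
    _ = |B| * m.factorial * (Real.exp ‖w‖ * Real.exp (a * ‖w‖ - ‖w‖ ^ 2)) := by ring
    _ ≤ |B| * m.factorial * (Real.exp ((1 + a) ^ 2 / 2) * Real.exp (-(‖w‖ ^ 2 / 2))) := by gcongr
    _ = _ := by ring

theorem norm_cexp_inner_sub_le (z w : Cn n) :
    ‖Complex.exp (inner ℂ w z - (‖w‖ : ℂ) ^ 2)‖ ≤ Real.exp (‖z‖ * ‖w‖ - ‖w‖ ^ 2) := by
  rw [Complex.norm_exp, Real.exp_le_exp, Complex.sub_re]
  have h1 : (inner ℂ w z).re ≤ ‖w‖ * ‖z‖ := (Complex.re_le_norm _).trans (norm_inner_le_norm _ _)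
  have h2 : ((‖w‖ : ℂ) ^ 2).re = ‖w‖ ^ 2 := by
    rw [← Complex.ofReal_pow, Complex.ofReal_re]
  rw [h2]
  linarith

theorem exists_norm_le_of_homogeneous {F : Cn n → ℂ} (hF : Continuous F) {m : ℕ}
    (hhom : ∀ (c : ℂ) w, F (c • w) = c ^ m * F w) : ∃ B : ℝ, ∀ w, ‖F w‖ ≤ B * ‖w‖ ^ m := by
  obtain ⟨B, hB⟩ := (isCompact_closedBall (0 : Cn n) 1).exists_bound_of_continuousOn hF.continuousOn
  refine ⟨B, fun w => ?_⟩
  by_cases hw : w = 0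
  · have h0 := hhom 0 w
    rcases Nat.eq_zero_or_pos m with rfl | hm
    · simpa using hB w (by simp [hw])
    · rw [zero_smul, zero_pow hm.ne', zero_mul] at h0
      simp [hw, h0, hm.ne']
  · have hw' : (‖w‖ : ℂ) ≠ 0 := by simpa using hw
    have h1 : F w = (‖w‖ : ℂ) ^ m * F ((‖w‖ : ℂ)⁻¹ • w) := by
      rw [← hhom, smul_smul, mul_inv_cancel₀ hw', one_smul]
    have h2 := hB ((‖w‖ : ℂ)⁻¹ • w) (by
      rw [mem_closedBall_zero_iff, norm_smul, norm_inv, Complex.norm_real, norm_norm,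
        inv_mul_cancel₀ (by simpa using hw)])
    rw [h1, norm_mul, norm_pow, Complex.norm_real, norm_norm, mul_comm]
    gcongr

/-- The reproducing property of `exp ⟨z, w⟩` with respect to the Gaussian measure. -/
theorem integral_mul_cexp_inner {F : Cn n → ℂ} (hF : Continuous F) {m : ℕ}
    (hhom : ∀ (c : ℂ) w, F (c • w) = c ^ m * F w)
    (hmean : ∀ (z u : Cn n) (c : ℂ),
      Real.circleAverage (fun l => F (z + l • u) * Complex.exp (c * l)) 0 1 = F z) (z : Cn n) :
    ∫ w, F w * Complex.exp (inner ℂ w z - (‖w‖ : ℂ) ^ 2) =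
      F z * ∫ w : Cn n, Complex.exp (-(‖w‖ : ℂ) ^ 2) := by
  obtain ⟨B, hB⟩ := exists_norm_le_of_homogeneous hF hhom
  have hint : Integrable (fun w => F w * Complex.exp (inner ℂ w z - (‖w‖ : ℂ) ^ 2)) :=
    integrable_mul_cexp_inner_sub hF hB (by fun_prop) (norm_cexp_inner_sub_le z)
  have hexp : ∀ u : Cn n, Complex.exp (inner ℂ (z + u) z - (‖z + u‖ : ℂ) ^ 2) =
      Complex.exp (-inner ℂ z u) * Complex.exp (-(‖u‖ : ℂ) ^ 2) := fun u => by
    rw [← Complex.exp_add]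
    congr 1
    have h1 := inner_self_eq_norm_sq_to_K (𝕜 := ℂ) (z + u)
    have h2 := inner_self_eq_norm_sq_to_K (𝕜 := ℂ) u
    simp only [Complex.coe_algebraMap] at h1 h2
    rw [← h1, ← h2, inner_add_left, inner_add_right, inner_add_left, inner_add_left]
    ring
  have hint2 : Integrable (fun u => F (z + u) * (Complex.exp (-inner ℂ z u) *
      Complex.exp (-(‖u‖ : ℂ) ^ 2))) := by
    refine (hint.comp_add_left z).congr (ae_of_all _ fun u => ?_)
    simp only [hexp]
  -- Completing the square with `w = z + u`: the kernel becomes `exp(-⟨u,z⟩*)` with `inner ℂ z u`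
  -- holomorphic in `u`, times the rotation-invariant Gaussian of `u`. Averaging over `u ↦ l u` then
  -- leaves `F z` by the mean value property.
  rw [← integral_add_left_eq_self _ z]
  simp only [hexp]
  rw [← integral_circleAverage_smul (fun l hl => measurePreserving_rotation hl)
    (by fun_prop) hint2, ← integral_const_mul]
  refine integral_congr_ae (ae_of_all _ fun u => ?_)
  simp only
  rw [← hmean z u (-inner ℂ z u), mul_comm, ← smul_eq_mul, ← Real.circleAverage_fun_smul]
  refine Real.circleAverage_congr_sphere fun l hl => ?_
  have hl1 : ‖l‖ = 1 := by simpa using hl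
  simp only [inner_smul_right, norm_smul, hl1, one_mul, smul_eq_mul]
  rw [mul_comm l, ← neg_mul]
  ring

theorem conj_eq_inv_of_norm_one {l : ℂ} (hl : ‖l‖ = 1) : (starRingEnd ℂ) l = l⁻¹ := by
  rw [Complex.inv_def, Complex.normSq_eq_norm_sq, hl]
  simp

/-- Rotating `w` by `l` multiplies `F w` by `l^m` and `inner ℂ w z` by `l⁻¹`. Averaging over `l`
therefore keeps only the degree `m` term `inner ℂ w z ^ m / m!` of the exponential. -/
theorem integral_mul_inner_pow {F : Cn n → ℂ} (hF : Continuous F) {m : ℕ}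
    (hhom : ∀ (c : ℂ) w, F (c • w) = c ^ m * F w)
    (hmean : ∀ (z u : Cn n) (c : ℂ),
      Real.circleAverage (fun l => F (z + l • u) * Complex.exp (c * l)) 0 1 = F z) (z : Cn n) :
    ∫ w, F w * inner ℂ w z ^ m * Complex.exp (-(‖w‖ : ℂ) ^ 2) =
      m.factorial * F z * ∫ w : Cn n, Complex.exp (-(‖w‖ : ℂ) ^ 2) := by
  obtain ⟨B, hB⟩ := exists_norm_le_of_homogeneous hF hhom
  have hint : Integrable (fun w => F w * Complex.exp (inner ℂ w z - (‖w‖ : ℂ) ^ 2)) :=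
    integrable_mul_cexp_inner_sub hF hB (by fun_prop) (norm_cexp_inner_sub_le z)
  have hfac : (m.factorial : ℂ) ≠ 0 := by exact_mod_cast m.factorial_ne_zero
  rw [mul_assoc, ← integral_mul_cexp_inner hF hhom hmean z,
    ← integral_circleAverage_smul (fun l hl => measurePreserving_rotation hl) (by fun_prop) hint,
    ← integral_const_mul]
  refine integral_congr_ae (ae_of_all _ fun w => ?_)
  simp only
  have h1 : Real.circleAverage (fun l : ℂ => F (l • w) *
      Complex.exp (inner ℂ (l • w) z - (‖l • w‖ : ℂ) ^ 2)) 0 1 =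
      (F w * Complex.exp (-(‖w‖ : ℂ) ^ 2)) * Real.circleAverage (fun l : ℂ => (l ^ m)⁻¹ *
        Complex.exp (inner ℂ w z * l)) 0 1 := by
    rw [← smul_eq_mul, ← Real.circleAverage_fun_smul,
      ← Real.circleAverage_zero_one_congr_inv (f := fun l : ℂ => (F w *
        Complex.exp (-(‖w‖ : ℂ) ^ 2)) • ((l ^ m)⁻¹ * Complex.exp (inner ℂ w z * l)))]
    refine Real.circleAverage_congr_sphere fun l hl => ?_
    have hl1 : ‖l‖ = 1 := by simpa using hl
    simp only [inner_smul_left, norm_smul, hl1, one_mul, smul_eq_mul, hhom,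
      conj_eq_inv_of_norm_one hl1]
    rw [sub_eq_add_neg, Complex.exp_add, inv_pow, inv_inv, mul_comm l⁻¹]
    ring
  rw [h1, circleAverage_inv_pow_mul (by fun_prop), iteratedDeriv_cexp_const_mul]
  simp only [mul_zero, Complex.exp_zero, mul_one]
  field_simp

theorem integral_Ioi_pow_mul_exp_neg_sq (k : ℕ) :
    ∫ x in Ioi (0 : ℝ), x ^ (2 * k + 1) * Real.exp (-x ^ 2) = k.factorial / 2 := by
  have h := integral_rpow_mul_exp_neg_rpow (p := 2) (q := 2 * k + 1) (by norm_num)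
    (by linarith [Nat.cast_nonneg (α := ℝ) k])
  have h2 : ((2 * k + 1 + 1 : ℝ) / 2) = k + 1 := by ring
  rw [h2, Real.Gamma_nat_eq_factorial] at h
  rw [div_eq_inv_mul, ← one_div, ← h]
  refine setIntegral_congr_fun measurableSet_Ioi fun x hx => ?_
  have : ((2 * k + 1 : ℝ)) = ((2 * k + 1 : ℕ) : ℝ) := by push_cast; ring
  simp only [Real.rpow_two]
  rw [this, Real.rpow_natCast]

theorem integral_Ioi_pow_mul_cexp (hn : 1 ≤ n) (m : ℕ) :
    ∫ x in Ioi (0 : ℝ), (x : ℂ) ^ (2 * n - 1) * ((x : ℂ) ^ (2 * m) * Complex.exp (-(x : ℂ) ^ 2)) =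
      ((n - 1 + m).factorial : ℂ) / 2 := by
  have h := integral_Ioi_pow_mul_exp_neg_sq (n - 1 + m)
  have h2 : ((∫ x in Ioi (0 : ℝ), x ^ (2 * (n - 1 + m) + 1) * Real.exp (-x ^ 2) : ℝ) : ℂ) = _ :=
    congrArg (fun x : ℝ => (x : ℂ)) h
  rw [← integral_complex_ofReal] at h2
  push_cast at h2
  rw [← h2]
  refine setIntegral_congr_fun measurableSet_Ioi fun x _ => ?_
  have : 2 * (n - 1 + m) + 1 = 2 * n - 1 + 2 * m := by omega
  rw [this, pow_add]
  ring

/-- The reproducing formula on the sphere for a homogeneous holomorphic polynomial. -/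
theorem choose_mul_integral_surface_mul_inner_pow (hn : 1 ≤ n) {F : Cn n → ℂ} (hF : Continuous F)
    {m : ℕ} (hhom : ∀ (c : ℂ) w, F (c • w) = c ^ m * F w)
    (hmean : ∀ (z u : Cn n) (c : ℂ),
      Real.circleAverage (fun l => F (z + l • u) * Complex.exp (c * l)) 0 1 = F z) (z : Cn n) :
    ((m + (n - 1)).choose (n - 1) : ℂ) *
      ∫ ξ, F ξ * inner ℂ ξ z ^ m ∂(surfaceMeasure n) = F z := by
  have := isProbabilityMeasure_surfaceMeasure hn
  have h0 := integral_mul_inner_pow hF hhom hmean z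
  have h1 := integral_polar_of_eq_mul hn
    (Φ := fun w => F w * inner ℂ w z ^ m * Complex.exp (-(‖w‖ : ℂ) ^ 2))
    (H := fun ξ => F ξ * inner ℂ ξ z ^ m)
    (a := fun x => (x : ℂ) ^ (2 * m) * Complex.exp (-(x : ℂ) ^ 2)) (fun x hx ξ hξ => by
      have : x • ξ = (x : ℂ) • ξ := rfl
      rw [this, hhom, inner_smul_left, norm_smul, hξ, mul_one, Complex.norm_real,
        Real.norm_of_nonneg hx.le, Complex.conj_ofReal]
      ring)
  have h2 := integral_polar_of_eq_mul hn
    (Φ := fun w => Complex.exp (-(‖w‖ : ℂ) ^ 2)) (H := fun _ => 1)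
    (a := fun x => (x : ℂ) ^ (2 * 0) * Complex.exp (-(x : ℂ) ^ 2)) (fun x hx ξ hξ => by
      rw [norm_smul, hξ, mul_one, Real.norm_of_nonneg hx.le]
      simp)
  -- Both radial integrals are halves of factorials. Their ratio `(n-1+m)! / (n-1)!`, divided by the
  -- `m!` in `h0`, is the binomial coefficient.
  rw [integral_Ioi_pow_mul_cexp hn] at h1 h2
  rw [h1, h2] at h0
  have hs : ((sphereMass n).toReal : ℂ) ≠ 0 := by
    exact_mod_cast ENNReal.toReal_ne_zero.2 ⟨sphereMass_ne_zero hn, sphereMass_ne_top⟩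
  have hf : ((n - 1).factorial : ℂ) ≠ 0 := by exact_mod_cast Nat.factorial_ne_zero _
  have hf2 : (m.factorial : ℂ) ≠ 0 := by exact_mod_cast Nat.factorial_ne_zero _
  have hc := Nat.add_choose_mul_factorial_mul_factorial m (n - 1)
  have hc2 : ((m + (n - 1)).choose (n - 1) : ℂ) * m.factorial * (n - 1).factorial =
      (n - 1 + m).factorial := by
    rw [add_comm (n - 1) m, ← hc]
    push_cast
    ring
  rw [← hc2] at h0
  simp only [integral_const, probReal_univ, one_smul, mul_one, add_zero] at h0
  refine mul_left_cancel₀ (mul_ne_zero (mul_ne_zero hs hf) hf2) ?_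
  linear_combination 2 * h0

theorem choose_mul_integral_homPart (hn : 1 ≤ n) {g : Cn n → ℂ} {ρ : ℝ} (hρ : 0 < ρ)
    (hg : DifferentiableOn ℂ g (Metric.ball 0 ρ)) (m : ℕ) (z : Cn n) :
    ((m + (n - 1)).choose (n - 1) : ℂ) *
      ∫ ξ, homPart g m ξ * inner ℂ ξ z ^ m ∂(surfaceMeasure n) = homPart g m z :=
  choose_mul_integral_surface_mul_inner_pow hn (continuous_homPart hρ hg m) (homPart_smul g m)
    (circleAverage_homPart_mul_exp hρ hg m) z

/-- Rotation averaging against a factor that scales by `l^{-m}` is exactly Cauchy's formula for the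
degree `m` component of `g`. -/
theorem integral_surface_mul_inner_pow (hn : 1 ≤ n) {g : Cn n → ℂ} {ρ : ℝ} (hρ : 1 < ρ)
    (hg : DifferentiableOn ℂ g (Metric.ball 0 ρ)) (hgm : Measurable g)
    (hgi : Integrable g (surfaceMeasure n)) (m : ℕ) (z : Cn n) :
    ∫ ξ, g ξ * inner ℂ ξ z ^ m ∂(surfaceMeasure n) =
      ∫ ξ, homPart g m ξ * inner ℂ ξ z ^ m ∂(surfaceMeasure n) := by
  have := isProbabilityMeasure_surfaceMeasure hn
  have hint : Integrable (fun ξ => g ξ * inner ℂ ξ z ^ m) (surfaceMeasure n) := by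
    refine hgi.mul_bdd (c := ‖z‖ ^ m) (by fun_prop) ?_
    filter_upwards [ae_norm_surfaceMeasure] with ξ hξ
    rw [norm_pow]
    gcongr
    simpa [hξ] using norm_inner_le_norm (𝕜 := ℂ) ξ z
  rw [← integral_circleAverage_smul (fun l hl => measurePreserving_rotation_surfaceMeasure hl)
    (by fun_prop) hint]
  refine integral_congr_ae ?_
  filter_upwards [ae_norm_surfaceMeasure] with ξ hξ
  rw [homPart_eq_circleAverage hg m (by rw [hξ]; exact hρ), mul_comm, ← smul_eq_mul,
    ← Real.circleAverage_fun_smul]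
  refine Real.circleAverage_congr_sphere fun l hl => ?_
  have hl1 : ‖l‖ = 1 := by simpa using hl
  simp only [inner_smul_left, conj_eq_inv_of_norm_one hl1, smul_eq_mul]
  ring

/-- The Szegő kernel of the unit ball. -/
def szego (z w : Cn n) : ℂ := ((1 - inner ℂ w z) ^ n)⁻¹

theorem hasSum_szego (hn : 1 ≤ n) {z w : Cn n} (h : ‖z‖ * ‖w‖ < 1) :
    HasSum (fun m : ℕ => ((m + (n - 1)).choose (n - 1) : ℂ) * inner ℂ w z ^ m) (szego z w) := by
  have h1 : ‖inner ℂ w z‖ < 1 := (norm_inner_le_norm _ _).trans_lt (by rwa [mul_comm])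
  have := hasSum_choose_mul_geometric_of_norm_lt_one (n - 1) h1
  rwa [Nat.sub_add_cancel hn, one_div] at this

theorem measurable_szego : Measurable fun p : Cn n × Cn n => szego p.1 p.2 := by
  unfold szego
  fun_prop

/-- Every holomorphic function on a neighbourhood of the closed ball agrees on the sphere and in
the ball with a measurable one. -/
theorem measurable_indicator_of_differentiableOn {g : Cn n → ℂ} {ρ : ℝ}
    (hg : DifferentiableOn ℂ g (Metric.ball 0 ρ)) :
    Measurable ((Metric.ball 0 ρ).indicator g) := by
  classical
  rw [← piecewise_eq_indicator]
  exact hg.continuousOn.measurable_piecewise continuousOn_const Metric.isOpen_ball.measurableSet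

theorem exists_bound_of_differentiableOn {g : Cn n → ℂ} {ρ : ℝ} (hρ : 1 < ρ)
    (hg : DifferentiableOn ℂ g (Metric.ball 0 ρ)) : ∃ B : ℝ, ∀ w : Cn n, ‖w‖ ≤ 1 → ‖g w‖ ≤ B := by
  obtain ⟨B, hB⟩ := (isCompact_closedBall (0 : Cn n) 1).exists_bound_of_continuousOn
    (hg.continuousOn.mono (Metric.closedBall_subset_ball hρ))
  exact ⟨B, fun w hw => hB w (by simpa using hw)⟩

theorem aemeasurable_surface_of_differentiableOn {g : Cn n → ℂ} {ρ : ℝ} (hρ : 1 < ρ)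
    (hg : DifferentiableOn ℂ g (Metric.ball 0 ρ)) : AEMeasurable g (surfaceMeasure n) := by
  refine ⟨_, measurable_indicator_of_differentiableOn hg, ?_⟩
  filter_upwards [ae_norm_surfaceMeasure] with ξ hξ
  rw [indicator_of_mem]
  simpa [hξ] using hρ

/-- The Cauchy–Szegő formula. -/
theorem integral_surface_mul_szego (hn : 1 ≤ n) {g : Cn n → ℂ} {ρ : ℝ} (hρ : 1 < ρ)
    (hg : DifferentiableOn ℂ g (Metric.ball 0 ρ)) {z : Cn n} (hz : ‖z‖ < 1) :
    ∫ ξ, g ξ * szego z ξ ∂(surfaceMeasure n) = g z := by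
  -- The values of `g` off the ball of radius `ρ` are arbitrary; truncating there changes nothing on
  -- the closed unit ball.
  wlog hgm : Measurable g generalizing g
  · have hball : ∀ w : Cn n, ‖w‖ ≤ 1 → (Metric.ball 0 ρ).indicator g w = g w := fun w hw =>
      indicator_of_mem (by simpa using hw.trans_lt hρ) _
    have := this (g := (Metric.ball 0 ρ).indicator g)
      (hg.congr fun w hw => indicator_of_mem hw _) (measurable_indicator_of_differentiableOn hg)
    rw [← hball z hz.le, ← this]
    refine integral_congr_ae ?_
    filter_upwards [ae_norm_surfaceMeasure] with ξ hξ
    rw [hball ξ hξ.le]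
  have := isProbabilityMeasure_surfaceMeasure hn
  obtain ⟨B, hB⟩ := exists_bound_of_differentiableOn hρ hg
  have hgi : Integrable g (surfaceMeasure n) := by
    refine Integrable.of_bound hgm.aestronglyMeasurable B ?_
    filter_upwards [ae_norm_surfaceMeasure] with ξ hξ using hB ξ hξ.le
  set c : ℕ → ℂ := fun m => ((m + (n - 1)).choose (n - 1) : ℂ) with hc
  have hterm : ∀ m, ∀ᵐ ξ ∂(surfaceMeasure n), ‖g ξ * (c m * inner ℂ ξ z ^ m)‖ ≤
      B * ‖c m * (‖z‖ : ℂ) ^ m‖ := fun m => by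
    filter_upwards [ae_norm_surfaceMeasure] with ξ hξ
    rw [norm_mul, norm_mul, norm_mul, norm_pow, norm_pow, Complex.norm_real, norm_norm]
    have h1 : ‖inner ℂ ξ z‖ ≤ ‖z‖ := by simpa [hξ] using norm_inner_le_norm (𝕜 := ℂ) ξ z
    have h2 := hB ξ hξ.le
    gcongr
    exact (norm_nonneg _).trans h2
  have hsum : Summable fun m => ‖c m * (‖z‖ : ℂ) ^ m‖ := by
    have h1 : ‖(‖z‖ : ℂ)‖ < 1 := by simpa using hz
    exact (hasSum_choose_mul_geometric_of_norm_lt_one (n - 1) h1).summable.norm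
  have hint : ∀ m, Integrable (fun ξ => g ξ * (c m * inner ℂ ξ z ^ m)) (surfaceMeasure n) :=
    fun m => Integrable.of_bound (by fun_prop) _ (hterm m)
  have h1 := hasSum_integral_of_summable_integral_norm hint (by
    refine Summable.of_nonneg_of_le (fun m => integral_nonneg fun ξ => norm_nonneg _)
      (fun m => ?_) (hsum.mul_left B)
    refine (integral_mono_ae (hint m).norm (integrable_const _) (hterm m)).trans ?_
    simp)
  have h2 : ∀ m, ∫ ξ, g ξ * (c m * inner ℂ ξ z ^ m) ∂(surfaceMeasure n) = homPart g m z := by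
    intro m
    rw [← choose_mul_integral_homPart hn (zero_lt_one.trans hρ) hg m z,
      ← integral_surface_mul_inner_pow hn hρ hg hgm hgi, ← integral_const_mul]
    refine integral_congr_ae (ae_of_all _ fun ξ => ?_)
    simp only [hc]
    ring
  simp only [h2] at h1
  rw [(hasSum_homPart hρ hg hz.le).unique h1]
  refine integral_congr_ae ?_
  filter_upwards [ae_norm_surfaceMeasure] with ξ hξ
  rw [((hasSum_szego hn (z := z) (w := ξ) (by simpa [hξ] using hz)).mul_left (g ξ)).tsum_eq]

end

/-! ### Duality for the Szegő kernel and Carleson estimates under dilation. -/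

section

variable {n : ℕ}

/-! ### Szegő transforms -/

open ComplexConjugate in
theorem norm_integral_mul_conj_le {X : Type*} [MeasurableSpace X] {μ : Measure X} {f g : X → ℂ}
    (hf : MemLp f 2 μ) (hg : MemLp g 2 μ) :
    ‖∫ x, f x * conj (g x) ∂μ‖ ≤ √(∫ x, ‖f x‖ ^ 2 ∂μ) * √(∫ x, ‖g x‖ ^ 2 ∂μ) := by
  have h := integral_mul_le_Lp_mul_Lq_of_nonneg (μ := μ) Real.HolderConjugate.two_two
    (f := fun x => ‖f x‖) (g := fun x => ‖g x‖) (ae_of_all _ fun x => norm_nonneg _)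
    (ae_of_all _ fun x => norm_nonneg _) (by simpa using hf.norm) (by simpa using hg.norm)
  refine (norm_integral_le_integral_norm _).trans ?_
  simp only [norm_mul, RCLike.norm_conj]
  refine h.trans_eq ?_
  simp only [Real.rpow_two, ← Real.sqrt_eq_rpow]

theorem integral_mul_conj_self {X : Type*} [MeasurableSpace X] {μ : Measure X} (f : X → ℂ) :
    ∫ x, f x * (starRingEnd ℂ) (f x) ∂μ = ((∫ x, ‖f x‖ ^ 2 ∂μ : ℝ) : ℂ) := by
  rw [← integral_complex_ofReal]
  refine integral_congr_ae (ae_of_all _ fun x => ?_)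
  simp only [Complex.mul_conj, Complex.normSq_eq_norm_sq]

theorem ofReal_integral_norm_sq {X : Type*} [MeasurableSpace X] {μ : Measure X} {f : X → ℂ}
    (hf : MemLp f 2 μ) : ENNReal.ofReal (∫ x, ‖f x‖ ^ 2 ∂μ) = ∫⁻ x, ‖f x‖ₑ ^ 2 ∂μ := by
  rw [ofReal_integral_eq_lintegral_ofReal (hf.integrable_norm_pow two_ne_zero) (ae_of_all _ fun x => by positivity)]
  refine lintegral_congr fun x => ?_
  rw [ENNReal.ofReal_pow (norm_nonneg _), ofReal_norm]

variable {Ω : Type*} [MeasurableSpace Ω] {ν : Measure Ω} {Z : Ω → Cn n} {ψ : Ω → ℂ}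

theorem szego_conj (z w : Cn n) : (starRingEnd ℂ) (szego z w) = szego w z := by
  simp [szego]

theorem measurable_szego_comp {f g : Ω → Cn n} (hf : Measurable f) (hg : Measurable g) :
    Measurable fun ω => szego (f ω) (g ω) := by
  unfold szego
  exact ((measurable_const.sub (hg.inner hf)).pow_const n).inv

theorem szego_real_smul_left (t : ℝ) (z w : Cn n) : szego (t • z) w = szego z (t • w) := by
  have h1 : t • z = (t : ℂ) • z := rfl
  have h2 : t • w = (t : ℂ) • w := rfl
  rw [szego, szego, h1, h2, inner_smul_left, inner_smul_right, Complex.conj_ofReal]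

theorem one_sub_le_norm_one_sub_inner {z w : Cn n} {κ : ℝ} (h : ‖w‖ * ‖z‖ ≤ κ) :
    1 - κ ≤ ‖1 - inner ℂ w z‖ := by
  have h1 : ‖inner ℂ w z‖ ≤ κ := (norm_inner_le_norm _ _).trans h
  have h2 := norm_sub_norm_le (1 : ℂ) (inner ℂ w z)
  rw [norm_one] at h2
  linarith

theorem norm_szego_le {z w : Cn n} {κ : ℝ} (hκ : κ < 1) (h : ‖w‖ * ‖z‖ ≤ κ) :
    ‖szego z w‖ ≤ ((1 - κ) ^ n)⁻¹ := by
  rw [szego, norm_inv, norm_pow]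
  have h1 := one_sub_le_norm_one_sub_inner h
  have h2 : 0 < 1 - κ := by linarith
  gcongr

/-- The holomorphic function `x ↦ ∫ K(x, Z ω) ψ ω dν(ω)`. -/
def szegoTransform (ν : Measure Ω) (Z : Ω → Cn n) (ψ : Ω → ℂ) (x : Cn n) : ℂ :=
  ∫ ω, szego x (Z ω) * ψ ω ∂ν

theorem szegoTransform_real_smul (t : ℝ) (x : Cn n) :
    szegoTransform ν Z ψ (t • x) = szegoTransform ν (fun ω => t • Z ω) ψ x := by
  simp only [szegoTransform, szego_real_smul_left]

theorem hasFDerivAt_szego {x w : Cn n} (h : inner ℂ w x ≠ (1 : ℂ)) :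
    HasFDerivAt (fun x : Cn n => szego x w)
      ((n * (1 - inner ℂ w x) ^ (n - 1) * ((1 - inner ℂ w x) ^ n)⁻¹ ^ 2 : ℂ) • innerSL ℂ w) x := by
  have h0 : (1 - inner ℂ w x : ℂ) ≠ 0 := sub_ne_zero.2 h.symm
  have h1 : HasFDerivAt (fun x : Cn n => 1 - inner ℂ w x) (-innerSL ℂ w) x :=
    ((innerSL ℂ w).hasFDerivAt).const_sub 1
  have h2 : HasDerivAt (fun l : ℂ => (l ^ n)⁻¹) (-(n * (1 - inner ℂ w x) ^ (n - 1)) /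
      ((1 - inner ℂ w x) ^ n) ^ 2) (1 - inner ℂ w x) :=
    (hasDerivAt_pow n _).inv (pow_ne_zero _ h0)
  refine (h2.comp_hasFDerivAt x h1).congr_fderiv ?_
  rw [smul_neg, ← neg_smul]
  congr 1
  rw [neg_div, neg_neg, div_eq_mul_inv, inv_pow]

/-- The bound `r * ρ < 1` keeps `1 - ⟨x, Z ω⟩` away from zero, so differentiation under the integral
is allowed. When `r < 1` one may take `ρ > 1`: the transform is holomorphic past the closed ball,
and its boundary values are plain values. -/
theorem differentiableOn_szegoTransform [IsFiniteMeasure ν] (hZ : Measurable Z) {r : ℝ}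
    (hr : ∀ ω, ‖Z ω‖ ≤ r) (hψ : Measurable ψ) {B : ℝ} (hB : ∀ ω, ‖ψ ω‖ ≤ B) {ρ : ℝ}
    (hρ : r * ρ < 1) : DifferentiableOn ℂ (szegoTransform ν Z ψ) (Metric.ball 0 ρ) := by
  intro x₀ hx₀
  have hx₀' : ‖x₀‖ < ρ := by simpa using hx₀
  have hle : ∀ ω, ∀ x ∈ Metric.ball (0 : Cn n) ρ, ‖Z ω‖ * ‖x‖ ≤ r * ρ := fun ω x hx => by
    have hx' : ‖x‖ < ρ := by simpa using hx
    have := hr ω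
    gcongr
    exact (norm_nonneg _).trans (hr ω)
  set κ := r * ρ
  have hκ : 0 < 1 - κ := by linarith
  have hmeas : ∀ x, Measurable fun ω => szego x (Z ω) * ψ ω := fun x =>
    (measurable_szego.comp (measurable_const.prodMk hZ)).mul hψ
  have hB0 : ∀ ω : Ω, 0 ≤ B := fun ω => (norm_nonneg _).trans (hB ω)
  refine (hasFDerivAt_integral_of_dominated_of_fderiv_le (𝕜 := ℂ) (s := Metric.ball 0 ρ)
    (F := fun x ω => szego x (Z ω) * ψ ω)
    (F' := fun x ω => ψ ω • (n * (1 - inner ℂ (Z ω) x) ^ (n - 1) *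
      ((1 - inner ℂ (Z ω) x) ^ n)⁻¹ ^ 2 : ℂ) • innerSL ℂ (Z ω))
    (bound := fun _ => B * ((n * (1 + κ) ^ (n - 1) * ((1 - κ) ^ n)⁻¹ ^ 2) * r))
    (Metric.isOpen_ball.mem_nhds hx₀) (Eventually.of_forall fun x => (hmeas x).aestronglyMeasurable)
    ?_ ?_ ?_ (integrable_const _) ?_).differentiableAt.differentiableWithinAt
  · refine Integrable.of_bound (hmeas x₀).aestronglyMeasurable (((1 - κ) ^ n)⁻¹ * B)
      (ae_of_all _ fun ω => ?_)
    rw [norm_mul]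
    have h1 := norm_szego_le (by linarith) (hle ω x₀ hx₀)
    have h2 := hB ω
    gcongr
  · refine AEStronglyMeasurable.fun_smul hψ.aestronglyMeasurable
      (AEStronglyMeasurable.fun_smul ?_ ?_)
    · exact Measurable.aestronglyMeasurable (by fun_prop)
    · exact (innerSL ℂ (E := Cn n)).continuous.comp_aestronglyMeasurable hZ.aestronglyMeasurable
  · refine ae_of_all _ fun ω x hx => ?_
    have h1 : ‖inner ℂ (Z ω) x‖ ≤ κ := (norm_inner_le_norm _ _).trans (hle ω x hx)
    have h2 : ‖1 - inner ℂ (Z ω) x‖ ≤ 1 + κ := (norm_sub_le _ _).trans (by simpa using h1)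
    have h3 : ‖((1 - inner ℂ (Z ω) x) ^ n)⁻¹‖ ≤ ((1 - κ) ^ n)⁻¹ :=
      norm_szego_le (by linarith) (hle ω x hx)
    have h4 := hB ω
    have h5 := hr ω
    have h6 := hB0 ω
    have h7 : 0 ≤ 1 + κ := (norm_nonneg _).trans h2
    rw [norm_smul, norm_smul, norm_mul, norm_mul, norm_pow, norm_pow, Complex.norm_natCast,
      innerSL_apply_norm]
    gcongr
  · refine ae_of_all _ fun ω x hx => ?_
    have h1 : inner ℂ (Z ω) x ≠ (1 : ℂ) := fun h => by
      have h2 : ‖inner ℂ (Z ω) x‖ ≤ κ := (norm_inner_le_norm _ _).trans (hle ω x hx)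
      rw [h, norm_one] at h2
      linarith
    exact (hasFDerivAt_szego h1).mul_const (ψ ω)

theorem memLp_surface_of_differentiableOn (hn : 1 ≤ n) {g : Cn n → ℂ} {ρ : ℝ} (hρ : 1 < ρ)
    (hg : DifferentiableOn ℂ g (Metric.ball 0 ρ)) : MemLp g 2 (surfaceMeasure n) := by
  have := isProbabilityMeasure_surfaceMeasure hn
  obtain ⟨B, hB⟩ := exists_bound_of_differentiableOn hρ hg
  refine MemLp.of_bound (aemeasurable_surface_of_differentiableOn hρ hg).aestronglyMeasurable B ?_
  filter_upwards [ae_norm_surfaceMeasure] with ξ hξ using hB ξ hξ.le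

/-- Duality between evaluation along `Z` and the Szegő transform. -/
theorem integral_mul_conj_szegoTransform (hn : 1 ≤ n) [IsFiniteMeasure ν] (hZ : Measurable Z)
    {r : ℝ} (hr1 : r < 1) (hr : ∀ ω, ‖Z ω‖ ≤ r) (hψ : Measurable ψ) {B : ℝ}
    (hB : ∀ ω, ‖ψ ω‖ ≤ B) {g : Cn n → ℂ} {ρ : ℝ} (hρ : 1 < ρ)
    (hg : DifferentiableOn ℂ g (Metric.ball 0 ρ)) :
    ∫ ξ, g ξ * (starRingEnd ℂ) (szegoTransform ν Z ψ ξ) ∂(surfaceMeasure n) =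
      ∫ ω, g (Z ω) * (starRingEnd ℂ) (ψ ω) ∂ν := by
  have := isProbabilityMeasure_surfaceMeasure hn
  obtain ⟨D, hD⟩ := exists_bound_of_differentiableOn hρ hg
  have h1 : ∀ ξ, g ξ * (starRingEnd ℂ) (szegoTransform ν Z ψ ξ) =
      ∫ ω, g ξ * szego (Z ω) ξ * (starRingEnd ℂ) (ψ ω) ∂ν := fun ξ => by
    rw [szegoTransform, ← integral_conj, ← integral_const_mul]
    simp only [map_mul, szego_conj, mul_assoc]
  simp only [h1]
  rw [integral_integral_swap]
  · refine integral_congr_ae (ae_of_all _ fun ω => ?_)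
    simp only
    rw [integral_mul_const, integral_surface_mul_szego hn hρ hg ((hr ω).trans_lt hr1)]
  · refine Integrable.of_bound (C := D * ((1 - r) ^ n)⁻¹ * B) ?_ ?_
    · refine AEStronglyMeasurable.mul (AEStronglyMeasurable.mul ?_ ?_) ?_
      · exact (aemeasurable_surface_of_differentiableOn hρ hg).aestronglyMeasurable.comp_fst
      · exact (measurable_szego.comp
          ((hZ.comp measurable_snd).prodMk measurable_fst)).aestronglyMeasurable
      · exact Measurable.aestronglyMeasurable (by fun_prop)
    · have : ∀ᵐ p ∂((surfaceMeasure n).prod ν), ‖p.1‖ = 1 :=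
        Measure.quasiMeasurePreserving_fst.ae ae_norm_surfaceMeasure
      filter_upwards [this] with p hp
      have h2 := hD p.1 hp.le
      have h3 := norm_szego_le (z := Z p.2) (w := p.1) hr1 (by rw [hp, one_mul]; exact hr _)
      have h4 := hB p.2
      rw [Function.uncurry, norm_mul, norm_mul, RCLike.norm_conj]
      have h5 : 0 ≤ D := (norm_nonneg _).trans h2
      have h6 : 0 < 1 - r := by linarith
      gcongr

theorem exists_one_lt_mul_lt_one {r : ℝ} (hr1 : r < 1) : ∃ ρ : ℝ, 1 < ρ ∧ r * ρ < 1 := by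
  rcases le_or_gt r 0 with h | h
  · exact ⟨2, by norm_num, by nlinarith⟩
  · obtain ⟨ρ, h1, h2⟩ := exists_between (one_lt_inv₀ h |>.2 hr1)
    exact ⟨ρ, h1, by rwa [lt_inv_comm₀ (by linarith) h, ← one_div, lt_div_iff₀ (by linarith)] at h2⟩

theorem differentiableOn_comp_real_smul {g : Cn n → ℂ} {ρ ρ' t : ℝ} (ht : 0 ≤ t) (hρ : 0 < ρ)
    (h : t * ρ' ≤ ρ)
    (hg : DifferentiableOn ℂ g (Metric.ball 0 ρ)) :
    DifferentiableOn ℂ (fun x : Cn n => g (t • x)) (Metric.ball 0 ρ') := by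
  refine hg.comp (f := fun x : Cn n => t • x) ?_ fun x hx => ?_
  · have : (fun x : Cn n => t • x) = fun x => (t : ℂ) • x := rfl
    rw [this]
    fun_prop
  · rw [mem_ball_zero_iff] at hx ⊢
    rw [norm_smul, Real.norm_of_nonneg ht]
    rcases ht.eq_or_lt with rfl | ht'
    · simpa using hρ
    · exact (mul_lt_mul_of_pos_left hx ht').trans_le h

/-- The quadratic form of the Szegő kernel is the squared norm of the Szegő transform. -/
theorem integral_szegoTransform_mul_conj (hn : 1 ≤ n) [IsFiniteMeasure ν] (hZ : Measurable Z)
    {r : ℝ} (hr1 : r < 1) (hr : ∀ ω, ‖Z ω‖ ≤ r) (hψ : Measurable ψ) {B : ℝ}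
    (hB : ∀ ω, ‖ψ ω‖ ≤ B) :
    ∫ ω, szegoTransform ν Z ψ (Z ω) * (starRingEnd ℂ) (ψ ω) ∂ν =
      ((∫ ξ, ‖szegoTransform ν Z ψ ξ‖ ^ 2 ∂(surfaceMeasure n) : ℝ) : ℂ) := by
  obtain ⟨ρ, h1, h2⟩ := exists_one_lt_mul_lt_one hr1
  rw [← integral_mul_conj_szegoTransform hn hZ hr1 hr hψ hB h1
    (differentiableOn_szegoTransform hZ hr hψ hB h2), integral_mul_conj_self]

/-- The Hardy norm of a Szegő transform is attained on the unit sphere. -/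
theorem hardyNormSq_szegoTransform_le (hn : 1 ≤ n) [IsFiniteMeasure ν] (hZ : Measurable Z)
    {r : ℝ} (hr1 : r < 1) (hr : ∀ ω, ‖Z ω‖ ≤ r) (hψ : Measurable ψ) {B : ℝ}
    (hB : ∀ ω, ‖ψ ω‖ ≤ B) :
    hardyNormSq n (szegoTransform ν Z ψ) ≤
      ENNReal.ofReal (∫ ξ, ‖szegoTransform ν Z ψ ξ‖ ^ 2 ∂(surfaceMeasure n)) := by
  have := isProbabilityMeasure_surfaceMeasure hn
  obtain ⟨ρ, h1, h2⟩ := exists_one_lt_mul_lt_one hr1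
  set G := szegoTransform ν Z ψ with hG
  have hGd : DifferentiableOn ℂ G (Metric.ball 0 ρ) :=
    differentiableOn_szegoTransform hZ hr hψ hB h2
  have hGt : ∀ t : ℝ, 0 ≤ t → t ≤ 1 →
      DifferentiableOn ℂ (fun x => G (t • x)) (Metric.ball 0 ρ) := fun t ht0 ht1 =>
    differentiableOn_comp_real_smul ht0 (by linarith) (by nlinarith) hGd
  have hL : ∀ t : ℝ, 0 ≤ t → t ≤ 1 → MemLp (fun x => G (t • x)) 2 (surfaceMeasure n) :=
    fun t ht0 ht1 => memLp_surface_of_differentiableOn hn h1 (hGt t ht0 ht1)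
  set M : ℝ → ℝ := fun t => ∫ ξ, ‖G (t • ξ)‖ ^ 2 ∂(surfaceMeasure n) with hM
  have hM0 : ∀ t, 0 ≤ M t := fun t => integral_nonneg fun ξ => by positivity
  have hM1 : M 1 = ∫ ξ, ‖G ξ‖ ^ 2 ∂(surfaceMeasure n) := by simp [hM]
  -- Monotonicity of the integral means is bypassed. Duality moves both dilations to one side, `M t
  -- = ⟨G(t²·), G⟩`, and Cauchy–Schwarz follows. The supremum `A` of `M` then satisfies `A ≤ √A √(M
  -- 1)`, whence `A ≤ M 1`.
  have key : ∀ t ∈ Icc (0 : ℝ) 1, M t ≤ √(M (t * t)) * √(M 1) := fun t ht => by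
    have e1 : ((M t : ℝ) : ℂ) = ∫ ω, G (t • t • Z ω) * (starRingEnd ℂ) (ψ ω) ∂ν := by
      rw [hM, ← integral_mul_conj_self]
      simp only [hG, szegoTransform_real_smul t]
      have := integral_mul_conj_szegoTransform (ν := ν) (Z := fun ω => t • Z ω) (ψ := ψ) hn
        (hZ.const_smul t) hr1 (fun ω => by
          rw [norm_smul, Real.norm_of_nonneg ht.1]
          nlinarith [hr ω, ht.2, norm_nonneg (Z ω)]) hψ hB h1 (hGt t ht.1 ht.2)
      simp only [hG, szegoTransform_real_smul t] at this
      exact this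
    have e2 : ∫ ω, G (t • t • Z ω) * (starRingEnd ℂ) (ψ ω) ∂ν =
        ∫ ξ, G ((t * t) • ξ) * (starRingEnd ℂ) (G ((1 : ℝ) • ξ)) ∂(surfaceMeasure n) := by
      have := integral_mul_conj_szegoTransform (ν := ν) hn hZ hr1 hr hψ hB h1
        (hGt (t * t) (mul_self_nonneg t) (by nlinarith [ht.1, ht.2]))
      simp only [one_smul, ← hG] at this ⊢
      rw [this]
      simp only [smul_smul]
    have e3 := norm_integral_mul_conj_le
      (hL (t * t) (mul_self_nonneg t) (by nlinarith [ht.1, ht.2])) (hL 1 zero_le_one le_rfl)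
    rw [← e2, ← e1, Complex.norm_real, Real.norm_of_nonneg (hM0 t)] at e3
    exact e3
  obtain ⟨D, hD⟩ := exists_bound_of_differentiableOn h1 hGd
  have hbdd : BddAbove (M '' Icc 0 1) := by
    refine ⟨D ^ 2, ?_⟩
    rintro _ ⟨t, ht, rfl⟩
    refine (integral_mono_of_nonneg (ae_of_all _ fun ξ => by positivity)
      (integrable_const (D ^ 2)) ?_).trans_eq (by simp)
    filter_upwards [ae_norm_surfaceMeasure] with ξ hξ
    have := hD (t • ξ) (by rw [norm_smul, hξ, mul_one, Real.norm_of_nonneg ht.1]; exact ht.2)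
    gcongr
  set A := sSup (M '' Icc 0 1) with hA
  have hMA : ∀ t ∈ Icc (0 : ℝ) 1, M t ≤ A := fun t ht => le_csSup hbdd ⟨t, ht, rfl⟩
  have hA1 : A ≤ √A * √(M 1) := by
    refine csSup_le ⟨M 1, 1, by simp, rfl⟩ ?_
    rintro _ ⟨t, ht, rfl⟩
    refine (key t ht).trans ?_
    gcongr
    exact hMA _ ⟨mul_self_nonneg t, by nlinarith [ht.1, ht.2]⟩
  have hA0 : 0 ≤ A := (hM0 1).trans (hMA 1 (by simp))
  have hA2 : A ≤ M 1 := by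
    rcases hA0.eq_or_lt with h | h
    · rw [← h]; exact hM0 1
    · have h3 : √A * √A = A := Real.mul_self_sqrt hA0
      have h4 : 0 < √A := Real.sqrt_pos.2 h
      have h5 : √A ≤ √(M 1) := by
        refine le_of_mul_le_mul_left ?_ h4
        rwa [h3]
      exact (Real.sqrt_le_sqrt_iff (hM0 1)).1 h5
  refine iSup₂_le fun t ht => ?_
  rw [lintegral_sphereMeasure (fun ξ => ‖G (t • ξ)‖ₑ ^ 2),
    ← ofReal_integral_norm_sq (hL t ht.1.le ht.2.le), ← hM1]
  exact ENNReal.ofReal_le_ofReal ((hMA t ⟨ht.1.le, ht.2.le⟩).trans hA2)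

/-- A Carleson estimate for the Hardy space bounds the quadratic form of the Szegő kernel. -/
theorem integral_norm_sq_szegoTransform_le (hn : 1 ≤ n) [IsFiniteMeasure ν] (hZ : Measurable Z)
    {r : ℝ} (hr1 : r < 1) (hr : ∀ ω, ‖Z ω‖ ≤ r) (hψ : Measurable ψ) {B : ℝ}
    (hB : ∀ ω, ‖ψ ω‖ ≤ B) {C : ℝ} (hC : 0 ≤ C)
    (hcar : ∀ f ∈ holSpace (hardyNormSq n),
      ∫⁻ ω, ‖f (Z ω)‖ₑ ^ 2 ∂ν ≤ ENNReal.ofReal C * hardyNormSq n f) :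
    ∫ ξ, ‖szegoTransform ν Z ψ ξ‖ ^ 2 ∂(surfaceMeasure n) ≤ C * ∫ ω, ‖ψ ω‖ ^ 2 ∂ν := by
  obtain ⟨ρ, h1, h2⟩ := exists_one_lt_mul_lt_one hr1
  set G := szegoTransform ν Z ψ with hG
  have hGd : DifferentiableOn ℂ G (Metric.ball 0 ρ) :=
    differentiableOn_szegoTransform hZ hr hψ hB h2
  have hle := hardyNormSq_szegoTransform_le (ν := ν) hn hZ hr1 hr hψ hB
  rw [← hG] at hle
  set A := ∫ ξ, ‖G ξ‖ ^ 2 ∂(surfaceMeasure n) with hA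
  have hA0 : 0 ≤ A := integral_nonneg fun ξ => by positivity
  have hGZ : MemLp (fun ω => G (Z ω)) 2 ν := by
    obtain ⟨D, hD⟩ := exists_bound_of_differentiableOn h1 hGd
    have hm : Measurable fun ω => G (Z ω) := by
      have := (measurable_indicator_of_differentiableOn hGd).comp hZ
      convert this using 1
      ext ω
      rw [Function.comp_apply, indicator_of_mem]
      rw [mem_ball_zero_iff]
      linarith [hr ω]
    exact MemLp.of_bound hm.aestronglyMeasurable D
      (ae_of_all _ fun ω => hD _ (by linarith [hr ω]))
  have hψ2 : MemLp ψ 2 ν := MemLp.of_bound hψ.aestronglyMeasurable B (ae_of_all _ hB)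
  have h3 := hcar G ⟨hGd.mono (Metric.ball_subset_ball h1.le), hle.trans_lt ENNReal.ofReal_lt_top⟩
  have h4 : ∫ ω, ‖G (Z ω)‖ ^ 2 ∂ν ≤ C * A := by
    rw [← ofReal_integral_norm_sq hGZ] at h3
    have := h3.trans (mul_le_mul_right hle (ENNReal.ofReal C))
    rw [← ENNReal.ofReal_mul hC] at this
    exact (ENNReal.ofReal_le_ofReal_iff (by positivity)).1 this
  -- `A` is the pairing of `G ∘ Z` with `ψ`. The Carleson estimate for `G` itself bounds the first
  -- factor by `√(C A)`, and one power of `A` cancels.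
  have h5 : A ≤ √(C * A) * √(∫ ω, ‖ψ ω‖ ^ 2 ∂ν) := by
    have e := integral_szegoTransform_mul_conj (ν := ν) hn hZ hr1 hr hψ hB
    have e2 := norm_integral_mul_conj_le hGZ hψ2
    rw [← hG] at e
    rw [e, Complex.norm_real, Real.norm_of_nonneg hA0] at e2
    refine e2.trans ?_
    gcongr
  set P := ∫ ω, ‖ψ ω‖ ^ 2 ∂ν with hP
  have hP0 : 0 ≤ P := integral_nonneg fun ξ => by positivity
  rw [← Real.sqrt_mul (by positivity)] at h5
  have h6 : A ^ 2 ≤ C * A * P := by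
    have := Real.sq_sqrt (show 0 ≤ C * A * P by positivity)
    rw [← this]
    gcongr
  rcases hA0.eq_or_lt with h | h
  · rw [← h]; positivity
  · nlinarith

end

section

variable {n : ℕ} {Ω : Type*} [MeasurableSpace Ω] {ν : Measure Ω} {Z : Ω → Cn n} {ψ : Ω → ℂ}

/-! ### Positive definite kernels and Schur multipliers -/

/-- The quadratic form of a kernel `L` at `ψ`. -/
def quadForm (ν : Measure Ω) (L : Ω → Ω → ℂ) (ψ : Ω → ℂ) : ℂ :=
  ∫ p, L p.1 p.2 * ψ p.2 * (starRingEnd ℂ) (ψ p.1) ∂(ν.prod ν)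

/-- The real part of the quadratic form of `L` is at most `C` times the squared `L²` norm. -/
def KernelBound (ν : Measure Ω) (L : Ω → Ω → ℂ) (C : ℝ) : Prop :=
  ∀ ψ : Ω → ℂ, Measurable ψ → (∃ B, ∀ ω, ‖ψ ω‖ ≤ B) →
    (quadForm ν L ψ).re ≤ C * ∫ ω, ‖ψ ω‖ ^ 2 ∂ν

theorem integrable_quadForm [IsFiniteMeasure ν] {L : Ω → Ω → ℂ}
    (hL : Measurable fun p : Ω × Ω => L p.1 p.2) {D : ℝ} (hD : ∀ a b, ‖L a b‖ ≤ D)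
    (hψ : Measurable ψ) {B : ℝ} (hB : ∀ ω, ‖ψ ω‖ ≤ B) :
    Integrable (fun p : Ω × Ω => L p.1 p.2 * ψ p.2 * (starRingEnd ℂ) (ψ p.1)) (ν.prod ν) := by
  refine Integrable.of_bound (C := D * B * B) (Measurable.aestronglyMeasurable ?_)
    (ae_of_all _ fun p => ?_)
  · exact (hL.mul (hψ.comp measurable_snd)).mul
      (Complex.continuous_conj.measurable.comp (hψ.comp measurable_fst))
  · rw [norm_mul, norm_mul, RCLike.norm_conj]
    have h1 := hD p.1 p.2
    have h2 := hB p.1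
    have h3 := hB p.2
    have h4 : 0 ≤ D := (norm_nonneg _).trans h1
    have h5 : 0 ≤ B := (norm_nonneg _).trans h2
    gcongr

theorem quadForm_szego [IsFiniteMeasure ν] (hn : 1 ≤ n) (hZ : Measurable Z) {r : ℝ} (hr1 : r < 1)
    (hr : ∀ ω, ‖Z ω‖ ≤ r) (hψ : Measurable ψ) {B : ℝ} (hB : ∀ ω, ‖ψ ω‖ ≤ B) :
    quadForm ν (fun a b => szego (Z a) (Z b)) ψ =
      ((∫ ξ, ‖szegoTransform ν Z ψ ξ‖ ^ 2 ∂(surfaceMeasure n) : ℝ) : ℂ) := by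
  rw [← integral_szegoTransform_mul_conj hn hZ hr1 hr hψ hB, quadForm, integral_prod]
  · refine integral_congr_ae (ae_of_all _ fun a => ?_)
    simp only [szegoTransform]
    rw [integral_mul_const]
  · refine integrable_quadForm (L := fun a b => szego (Z a) (Z b)) (D := ((1 - r * r) ^ n)⁻¹)
      (measurable_szego_comp (hZ.comp measurable_fst) (hZ.comp measurable_snd))
      (fun a b => ?_) hψ hB
    have h0 : 0 ≤ r := (norm_nonneg _).trans (hr a)
    refine norm_szego_le (by nlinarith) ?_
    have h1 := hr a
    have h2 := hr b
    gcongr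

/-- The monomial `∏ j, z (a j)`. -/
def monomial {k : ℕ} (a : Fin k → Fin n) (z : Cn n) : ℂ := ∏ j, z (a j)

/-- Summing over all words of length `k`, with repetitions, avoids multinomial coefficients. -/
theorem inner_pow_eq_sum (z w : Cn n) (k : ℕ) :
    inner ℂ w z ^ k = ∑ a : Fin k → Fin n, monomial a z * (starRingEnd ℂ) (monomial a w) := by
  rw [PiLp.inner_apply, Fintype.sum_pow]
  refine Finset.sum_congr rfl fun a _ => ?_
  simp only [monomial, map_prod, ← Finset.prod_mul_distrib]
  refine Finset.prod_congr rfl fun j _ => ?_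
  simp

theorem sum_norm_monomial_sq (z : Cn n) (k : ℕ) :
    ∑ a : Fin k → Fin n, ‖monomial a z‖ ^ 2 = ‖z‖ ^ (2 * k) := by
  rw [pow_mul, EuclideanSpace.norm_sq_eq, Fintype.sum_pow]
  refine Finset.sum_congr rfl fun a _ => ?_
  simp only [monomial, norm_prod, Finset.prod_pow]

theorem continuous_monomial {k : ℕ} (a : Fin k → Fin n) : Continuous (monomial a) := by
  unfold monomial
  fun_prop

theorem norm_monomial_le {k : ℕ} (a : Fin k → Fin n) (z : Cn n) : ‖monomial a z‖ ≤ ‖z‖ ^ k := by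
  rw [monomial, norm_prod]
  refine (Finset.prod_le_prod (fun j _ => norm_nonneg _)
    (fun j _ => PiLp.norm_apply_le z (a j))).trans_eq (by simp)

theorem differentiable_monomial {k : ℕ} (a : Fin k → Fin n) : Differentiable ℂ (monomial a) := by
  unfold monomial
  fun_prop

/-- Schur product argument: since `⟨z,w⟩^k` is a sum of rank one kernels, the form at `ψ` is the sum
of the forms of `L` at `conj (monomial a) * ψ`. The squared norms of these functions sum to the
integral of `|Z|^{2k} |ψ|²`. -/
theorem quadForm_mul_inner_pow_re_le [IsFiniteMeasure ν] (hZ : Measurable Z) {r : ℝ}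
    (hr : ∀ ω, ‖Z ω‖ ≤ r) {L : Ω → Ω → ℂ} (hL : Measurable fun p : Ω × Ω => L p.1 p.2) {D : ℝ}
    (hD : ∀ a b, ‖L a b‖ ≤ D) {C : ℝ} (hC : 0 ≤ C) (hLC : KernelBound ν L C)
    (hψ : Measurable ψ) {B : ℝ} (hB : ∀ ω, ‖ψ ω‖ ≤ B) (k : ℕ) :
    (quadForm ν (fun a b => L a b * inner ℂ (Z b) (Z a) ^ k) ψ).re ≤
      C * (r ^ (2 * k) * ∫ ω, ‖ψ ω‖ ^ 2 ∂ν) := by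
  set φ : (Fin k → Fin n) → Ω → ℂ := fun a ω => (starRingEnd ℂ) (monomial a (Z ω)) * ψ ω with hφ
  have hφm : ∀ a, Measurable (φ a) := fun a =>
    (Complex.continuous_conj.measurable.comp ((continuous_monomial a).measurable.comp hZ)).mul hψ
  have hφn : ∀ a ω, ‖φ a ω‖ = ‖monomial a (Z ω)‖ * ‖ψ ω‖ := fun a ω => by
    rw [hφ, norm_mul, RCLike.norm_conj]
  have hφB : ∀ a ω, ‖φ a ω‖ ≤ r ^ k * B := fun a ω => by
    rw [hφn]
    have h1 := (norm_monomial_le a (Z ω)).trans (pow_le_pow_left₀ (norm_nonneg _) (hr ω) k)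
    have h2 := hB ω
    have h3 := (norm_nonneg _).trans h1
    gcongr
  have h1 : quadForm ν (fun a b => L a b * inner ℂ (Z b) (Z a) ^ k) ψ =
      ∑ a, quadForm ν L (φ a) := by
    simp only [quadForm]
    rw [← integral_finsetSum _ fun a _ => integrable_quadForm hL hD (hφm a) (hφB a)]
    refine integral_congr_ae (ae_of_all _ fun p => ?_)
    simp only [inner_pow_eq_sum, Finset.mul_sum, Finset.sum_mul, hφ, map_mul, Complex.conj_conj]
    exact Finset.sum_congr rfl fun a _ => by ring
  rw [h1, Complex.re_sum]
  refine (Finset.sum_le_sum fun a _ => hLC (φ a) (hφm a) ⟨_, hφB a⟩).trans ?_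
  rw [← Finset.mul_sum]
  refine mul_le_mul_of_nonneg_left ?_ hC
  have hψ2 : MemLp ψ 2 ν := MemLp.of_bound hψ.aestronglyMeasurable B (ae_of_all _ hB)
  have hφ2 : ∀ a, MemLp (φ a) 2 ν := fun a =>
    MemLp.of_bound (hφm a).aestronglyMeasurable _ (ae_of_all _ (hφB a))
  rw [← integral_finsetSum _ fun a _ => (hφ2 a).integrable_norm_pow two_ne_zero,
    ← integral_const_mul]
  refine integral_mono (integrable_finsetSum _ fun a _ => (hφ2 a).integrable_norm_pow two_ne_zero)
    ((hψ2.integrable_norm_pow two_ne_zero).const_mul _) fun ω => ?_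
  simp only [hφn, mul_pow]
  rw [← Finset.sum_mul, sum_norm_monomial_sq]
  have := hr ω
  gcongr

/-- Multiplication by the positive definite kernel `(1 - u) / (1 - s u)`, with `u = ⟨z, w⟩` and
`1 ≤ s`, preserves kernel bounds up to the supremum of its diagonal. -/
theorem KernelBound.mul_ratio [IsFiniteMeasure ν] (hZ : Measurable Z) {r : ℝ} (hr0 : 0 ≤ r)
    (hr : ∀ ω, ‖Z ω‖ ≤ r) {L : Ω → Ω → ℂ} (hL : Measurable fun p : Ω × Ω => L p.1 p.2) {D : ℝ}
    (hD : ∀ a b, ‖L a b‖ ≤ D) {C : ℝ} (hC : 0 ≤ C) (hLC : KernelBound ν L C) {s : ℝ} (hs : 1 ≤ s)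
    (hsr : s * r ^ 2 < 1) :
    KernelBound ν (fun a b => L a b * ((1 - inner ℂ (Z b) (Z a)) / (1 - s * inner ℂ (Z b) (Z a))))
      (C * ((1 - r ^ 2) / (1 - s * r ^ 2))) := by
  rintro ψ hψ ⟨B, hB⟩
  set u : Ω × Ω → ℂ := fun p => inner ℂ (Z p.2) (Z p.1) with hu
  have hun : ∀ p, ‖u p‖ ≤ r ^ 2 := fun p => by
    refine (norm_inner_le_norm _ _).trans ?_
    rw [sq]
    have h1 := hr p.1
    have h2 := hr p.2
    gcongr
  have hum : Measurable u := by
    exact (hZ.comp measurable_snd).inner (hZ.comp measurable_fst)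
  set q := s * r ^ 2 with hq
  have hq0 : 0 ≤ q := by positivity
  have hsu : ∀ p, ‖(s : ℂ) * u p‖ ≤ q := fun p => by
    rw [norm_mul, Complex.norm_real, Real.norm_of_nonneg (by linarith)]
    exact mul_le_mul_of_nonneg_left (hun p) (by linarith)
  have hne : ∀ p, 1 - (s : ℂ) * u p ≠ 0 := fun p h => by
    have h1 := hsu p
    rw [← sub_eq_zero.1 h, norm_one] at h1
    linarith
  have hs0 : (s : ℂ) ≠ 0 := by
    exact_mod_cast (by linarith : s ≠ 0)
  set J : Ω × Ω → ℂ := fun p => L p.1 p.2 * ψ p.2 * (starRingEnd ℂ) (ψ p.1) with hJ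
  have hJi : Integrable J (ν.prod ν) := integrable_quadForm hL hD hψ hB
  have hJk : ∀ k : ℕ, Integrable (fun p => J p * ((s : ℂ) * u p) ^ k) (ν.prod ν) := fun k => by
    refine hJi.mul_bdd (c := q ^ k) (by fun_prop) (ae_of_all _ fun p => ?_)
    rw [norm_pow]
    exact pow_le_pow_left₀ (norm_nonneg _) (hsu p) k
  -- The geometric series of `(1 - s u)⁻¹` may be integrated termwise because `|s u| ≤ q < 1`.
  have hsum := hasSum_integral_of_summable_integral_norm hJk (by
    refine Summable.of_nonneg_of_le (fun k => integral_nonneg fun p => norm_nonneg _) (fun k => ?_)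
      ((summable_geometric_of_lt_one hq0 hsr).mul_left (∫ p, ‖J p‖ ∂(ν.prod ν)))
    rw [← integral_mul_const]
    refine integral_mono (hJk k).norm (hJi.norm.mul_const _) fun p => ?_
    rw [norm_mul, norm_pow]
    exact mul_le_mul_of_nonneg_left (pow_le_pow_left₀ (norm_nonneg _) (hsu p) k) (norm_nonneg _))
  have htsum : ∀ p, ∑' k : ℕ, J p * ((s : ℂ) * u p) ^ k = J p * (1 - (s : ℂ) * u p)⁻¹ := fun p => by
    rw [tsum_mul_left, tsum_geometric_of_norm_lt_one ((hsu p).trans_lt hsr)]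
  simp only [htsum] at hsum
  have hterm : ∀ k : ℕ, ∫ p, J p * ((s : ℂ) * u p) ^ k ∂(ν.prod ν) =
      ((s ^ k : ℝ) : ℂ) * quadForm ν (fun a b => L a b * inner ℂ (Z b) (Z a) ^ k) ψ := fun k => by
    rw [quadForm, ← integral_const_mul]
    refine integral_congr_ae (ae_of_all _ fun p => ?_)
    simp only [hJ, hu, mul_pow]
    push_cast
    ring
  simp only [hterm] at hsum
  have hre := Complex.hasSum_re hsum
  set P := ∫ ω, ‖ψ ω‖ ^ 2 ∂ν with hP
  have hle : (∫ p, J p * (1 - (s : ℂ) * u p)⁻¹ ∂(ν.prod ν)).re ≤ C * P * (1 - q)⁻¹ := by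
    refine hasSum_le (fun k => ?_) hre ((hasSum_geometric_of_lt_one hq0 hsr).mul_left (C * P))
    rw [Complex.re_ofReal_mul]
    refine (mul_le_mul_of_nonneg_left
      (quadForm_mul_inner_pow_re_le hZ hr hL hD hC hLC hψ hB k) (by positivity)).trans_eq ?_
    rw [hq, mul_pow, ← pow_mul]
    ring
  have hi2 : Integrable (fun p => J p * (1 - (s : ℂ) * u p)⁻¹) (ν.prod ν) := by
    refine hJi.mul_bdd (c := (1 - q)⁻¹) (by fun_prop) (ae_of_all _ fun p => ?_)
    rw [norm_inv]
    have h1 := norm_sub_norm_le (1 : ℂ) ((s : ℂ) * u p)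
    rw [norm_one] at h1
    have h2 := hsu p
    have h3 : 0 < 1 - q := by linarith
    gcongr
    linarith
  -- This is `(1-u)/(1-su) = s⁻¹ + (1-s⁻¹)/(1-su)`. Both coefficients are nonnegative because `s ≥
  -- 1`, and the same identity at `u = r²` evaluates the final constant.
  have hquad : quadForm ν (fun a b => L a b *
      ((1 - inner ℂ (Z b) (Z a)) / (1 - s * inner ℂ (Z b) (Z a)))) ψ =
      ((s⁻¹ : ℝ) : ℂ) * quadForm ν L ψ +
        ((1 - s⁻¹ : ℝ) : ℂ) * ∫ p, J p * (1 - (s : ℂ) * u p)⁻¹ ∂(ν.prod ν) := by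
    rw [quadForm, quadForm, ← integral_const_mul, ← integral_const_mul,
      ← integral_add (hJi.const_mul _) (hi2.const_mul _)]
    refine integral_congr_ae (ae_of_all _ fun p => ?_)
    have := hne p
    simp only [hJ]
    change _ * ((1 - u p) / (1 - s * u p)) * _ * _ = _
    have h1 := mul_inv_cancel₀ this
    have h2 := inv_mul_cancel₀ hs0
    push_cast
    rw [div_eq_mul_inv]
    linear_combination (L p.1 p.2 * ψ p.2 * (starRingEnd ℂ) (ψ p.1)) * (s : ℂ)⁻¹ * h1 +
      (L p.1 p.2 * ψ p.2 * (starRingEnd ℂ) (ψ p.1)) * u p * (1 - (s : ℂ) * u p)⁻¹ * h2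
  rw [hquad, Complex.add_re, Complex.re_ofReal_mul, Complex.re_ofReal_mul]
  have h1 := hLC ψ hψ ⟨B, hB⟩
  have h2 : 0 ≤ s⁻¹ := by positivity
  have h3 : 0 ≤ 1 - s⁻¹ := by
    have := inv_le_one_of_one_le₀ hs
    linarith
  have h4 : 1 - q ≠ 0 := by linarith
  calc s⁻¹ * (quadForm ν L ψ).re +
        (1 - s⁻¹) * (∫ p, J p * (1 - (s : ℂ) * u p)⁻¹ ∂(ν.prod ν)).re
      ≤ s⁻¹ * (C * P) + (1 - s⁻¹) * (C * P * (1 - q)⁻¹) := by gcongr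
    _ = C * ((1 - r ^ 2) / (1 - q)) * P := by
      have h5 : s ≠ 0 := by linarith
      rw [div_eq_mul_inv]
      have h6 : (1 - q) * (1 - q)⁻¹ = 1 := mul_inv_cancel₀ h4
      have h7 : s⁻¹ * q = r ^ 2 := by rw [hq, inv_mul_cancel_left₀ h5]
      linear_combination (-C * P * s⁻¹) * h6 - (C * P * (1 - q)⁻¹) * h7

theorem KernelBound.mul_ratio_pow [IsFiniteMeasure ν] (hZ : Measurable Z) {r : ℝ} (hr0 : 0 ≤ r)
    (hr : ∀ ω, ‖Z ω‖ ≤ r) {L : Ω → Ω → ℂ} (hL : Measurable fun p : Ω × Ω => L p.1 p.2) {D : ℝ}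
    (hD : ∀ a b, ‖L a b‖ ≤ D) {C : ℝ} (hC : 0 ≤ C) (hLC : KernelBound ν L C) {s : ℝ} (hs : 1 ≤ s)
    (hsr : s * r ^ 2 < 1) (m : ℕ) :
    KernelBound ν
      (fun a b => L a b * ((1 - inner ℂ (Z b) (Z a)) / (1 - s * inner ℂ (Z b) (Z a))) ^ m)
      (C * ((1 - r ^ 2) / (1 - s * r ^ 2)) ^ m) := by
  have hM : 0 ≤ (1 - r ^ 2) / (1 - s * r ^ 2) := by
    refine div_nonneg ?_ (by linarith)
    nlinarith [sq_nonneg r]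
  induction m with
  | zero => simpa using hLC
  | succ m ih =>
    have hbd : ∀ a b, ‖(1 - inner ℂ (Z b) (Z a)) / (1 - s * inner ℂ (Z b) (Z a))‖ ≤
        (1 + r ^ 2) / (1 - s * r ^ 2) := fun a b => by
      have hun : ‖inner ℂ (Z b) (Z a)‖ ≤ r ^ 2 := by
        refine (norm_inner_le_norm _ _).trans ?_
        rw [sq]
        have h1 := hr a
        have h2 := hr b
        gcongr
      have hsu : ‖(s : ℂ) * inner ℂ (Z b) (Z a)‖ ≤ s * r ^ 2 := by
        rw [norm_mul, Complex.norm_real, Real.norm_of_nonneg (by linarith)]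
        gcongr
      have h1 := norm_sub_norm_le (1 : ℂ) ((s : ℂ) * inner ℂ (Z b) (Z a))
      have h2 := norm_sub_le (1 : ℂ) (inner ℂ (Z b) (Z a))
      rw [norm_one] at h1 h2
      rw [norm_div]
      gcongr
      · linarith
      · linarith
    have hum : Measurable fun p : Ω × Ω => inner ℂ (Z p.2) (Z p.1) :=
      (hZ.comp measurable_snd).inner (hZ.comp measurable_fst)
    have := KernelBound.mul_ratio hZ hr0 hr
      (L := fun a b => L a b * ((1 - inner ℂ (Z b) (Z a)) / (1 - s * inner ℂ (Z b) (Z a))) ^ m)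
      (hL.mul (((measurable_const.sub hum).div (measurable_const.sub (hum.const_mul _))).pow_const m))
      (D := D * ((1 + r ^ 2) / (1 - s * r ^ 2)) ^ m) (fun a b => by
        rw [norm_mul, norm_pow]
        have h1 := hD a b
        have h2 := hbd a b
        have h3 := (norm_nonneg _).trans h1
        gcongr) (by positivity) ih hs hsr
    simpa only [mul_assoc, ← pow_succ] using this

/-- With `s = R⁻²`, the multiplier turns the kernel of the unit ball into that of the ball of radius
`R`; the power `n` is the exponent of the kernel. -/
theorem szego_mul_ratio_pow {z w : Cn n} {R : ℝ} (h1 : inner ℂ w z ≠ (1 : ℂ)) :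
    szego z w * ((1 - inner ℂ w z) / (1 - ((R⁻¹ ^ 2 : ℝ) : ℂ) * inner ℂ w z)) ^ n =
      szego (R⁻¹ • z) (R⁻¹ • w) := by
  have e1 : R⁻¹ • z = ((R⁻¹ : ℝ) : ℂ) • z := rfl
  have e2 : R⁻¹ • w = ((R⁻¹ : ℝ) : ℂ) • w := rfl
  rw [szego, szego, e1, e2, inner_smul_left, inner_smul_right, Complex.conj_ofReal, ← mul_assoc,
    ← sq, ← Complex.ofReal_pow, div_pow, div_eq_mul_inv, inv_mul_cancel_left₀]
  exact pow_ne_zero _ (sub_ne_zero.2 h1.symm)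

/-- A measure supported in a ball of radius `r` satisfying a Carleson estimate for the Hardy space
of the unit ball also satisfies one for the Hardy space of the smaller ball of radius `R > r`. -/
theorem integral_norm_sq_le_of_carleson (hn : 1 ≤ n) [IsFiniteMeasure ν] (hZ : Measurable Z)
    {r R : ℝ} (hr0 : 0 ≤ r) (hrR : r < R) (hR1 : R < 1) (hr : ∀ ω, ‖Z ω‖ ≤ r) {C : ℝ} (hC : 0 ≤ C)
    (hcar : ∀ f ∈ holSpace (hardyNormSq n),
      ∫⁻ ω, ‖f (Z ω)‖ₑ ^ 2 ∂ν ≤ ENNReal.ofReal C * hardyNormSq n f)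
    {f : Cn n → ℂ} (hf : DifferentiableOn ℂ f (unitBall n)) :
    ∫ ω, ‖f (Z ω)‖ ^ 2 ∂ν ≤ C * ((1 - r ^ 2) / (1 - R⁻¹ ^ 2 * r ^ 2)) ^ n *
      ∫ ξ, ‖f (R • ξ)‖ ^ 2 ∂(surfaceMeasure n) := by
  have hR0 : 0 < R := by linarith
  have hr1 : r < 1 := by linarith
  have hs : 1 ≤ R⁻¹ ^ 2 := one_le_pow₀ (one_le_inv₀ hR0 |>.2 hR1.le)
  have hsr : R⁻¹ ^ 2 * r ^ 2 < 1 := by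
    rw [← mul_pow, ← div_eq_inv_mul]
    refine pow_lt_one₀ (by positivity) ?_ two_ne_zero
    rwa [div_lt_one hR0]
  set ψ : Ω → ℂ := fun ω => f (Z ω) with hψdef
  have hψ : Measurable ψ := by
    have := (measurable_indicator_of_differentiableOn hf).comp hZ
    convert this using 1
    ext ω
    rw [Function.comp_apply, indicator_of_mem]
    rw [mem_ball_zero_iff]
    linarith [hr ω]
  obtain ⟨B, hB⟩ : ∃ B, ∀ ω, ‖ψ ω‖ ≤ B := by
    obtain ⟨B, hB⟩ := (isCompact_closedBall (0 : Cn n) r).exists_bound_of_continuousOn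
      (hf.continuousOn.mono (Metric.closedBall_subset_ball hr1))
    exact ⟨B, fun ω => hB _ (by simpa using hr ω)⟩
  have hK1 : KernelBound ν (fun a b => szego (Z a) (Z b)) C := by
    rintro φ hφ ⟨B, hB⟩
    rw [quadForm_szego hn hZ hr1 hr hφ hB, Complex.ofReal_re]
    exact integral_norm_sq_szegoTransform_le hn hZ hr1 hr hφ hB hC hcar
  have hrr : ∀ a b, ‖Z b‖ * ‖Z a‖ ≤ r * r := fun a b => by
    have h1 := hr a
    have h2 := hr b
    gcongr
  have hK2 := hK1.mul_ratio_pow hZ hr0 hr (D := ((1 - r * r) ^ n)⁻¹)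
    (measurable_szego_comp (hZ.comp measurable_fst) (hZ.comp measurable_snd))
    (fun a b => norm_szego_le (by nlinarith) (hrr a b)) hC hs hsr n
  have hne : ∀ a b, inner ℂ (Z b) (Z a) ≠ (1 : ℂ) := fun a b h => by
    have h2 : ‖inner ℂ (Z b) (Z a)‖ ≤ r * r := (norm_inner_le_norm _ _).trans (hrr a b)
    rw [h, norm_one] at h2
    nlinarith
  simp only [szego_mul_ratio_pow (hne _ _)] at hK2
  set Z' : Ω → Cn n := fun ω => R⁻¹ • Z ω with hZ'
  have hZ'm : Measurable Z' := (measurable_const_smul R⁻¹).comp hZ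
  have hr' : ∀ ω, ‖Z' ω‖ ≤ r / R := fun ω => by
    rw [hZ', norm_smul, norm_inv, Real.norm_of_nonneg hR0.le, ← div_eq_inv_mul]
    have := hr ω
    gcongr
  have hr1' : r / R < 1 := (div_lt_one hR0).2 hrR
  have h3 := hK2 ψ hψ ⟨B, hB⟩
  rw [quadForm_szego hn hZ'm hr1' hr' hψ hB, Complex.ofReal_re] at h3
  have hRinv : 1 < R⁻¹ := (one_lt_inv₀ hR0).2 hR1
  have hg : DifferentiableOn ℂ (fun x : Cn n => f (R • x)) (Metric.ball 0 R⁻¹) :=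
    differentiableOn_comp_real_smul hR0.le one_pos (mul_inv_cancel₀ hR0.ne').le hf
  -- With `ψ = f ∘ Z`, duality writes `P = ∫ |f ∘ Z|²` as the pairing of `f(R ·)` with the transform
  -- of `ψ`, whose squared norm is at most `E P`. Cauchy–Schwarz gives `P² ≤ Q E P`.
  have h4 := integral_mul_conj_szegoTransform (ν := ν) hn hZ'm hr1' hr' hψ hB hRinv hg
  have h5 : ∀ ω, f (R • Z' ω) = ψ ω := fun ω => by
    rw [hZ', smul_smul, mul_inv_cancel₀ hR0.ne', one_smul]
  simp only [h5] at h4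
  rw [integral_mul_conj_self] at h4
  obtain ⟨ρ, hρ1, hρ2⟩ := exists_one_lt_mul_lt_one hr1'
  have h6 := norm_integral_mul_conj_le (memLp_surface_of_differentiableOn hn hRinv hg)
    (memLp_surface_of_differentiableOn hn hρ1
      (differentiableOn_szegoTransform (ν := ν) hZ'm hr' hψ hB hρ2))
  set P := ∫ ω, ‖ψ ω‖ ^ 2 ∂ν with hP
  have hP0 : 0 ≤ P := integral_nonneg fun ω => by positivity
  rw [h4, Complex.norm_real, Real.norm_of_nonneg hP0] at h6
  set Q := ∫ ξ, ‖f (R • ξ)‖ ^ 2 ∂(surfaceMeasure n) with hQ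
  have hQ0 : 0 ≤ Q := integral_nonneg fun ω => by positivity
  set E := C * ((1 - r ^ 2) / (1 - R⁻¹ ^ 2 * r ^ 2)) ^ n with hE
  have hM : 0 ≤ (1 - r ^ 2) / (1 - R⁻¹ ^ 2 * r ^ 2) :=
    div_nonneg (by nlinarith) (by linarith)
  have hE0 : 0 ≤ E := by positivity
  have h7 : P ≤ √(Q * (E * P)) := by
    rw [Real.sqrt_mul hQ0]
    exact h6.trans (by gcongr)
  have h8 : P ^ 2 ≤ Q * (E * P) := by
    have := Real.sq_sqrt (show 0 ≤ Q * (E * P) by positivity)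
    rw [← this]
    gcongr
  rcases hP0.eq_or_lt with h | h
  · rw [← h]; positivity
  · nlinarith

/-- Point evaluations are bounded by the integral means over larger spheres. -/
theorem norm_sq_le_integral_surface (hn : 1 ≤ n) {r R : ℝ} (hrR : r < R) (hR0 : 0 < R) (hR1 : R < 1)
    {f : Cn n → ℂ} (hf : DifferentiableOn ℂ f (unitBall n)) {z : Cn n} (hz : ‖z‖ ≤ r) :
    ‖f z‖ ^ 2 ≤ (((1 - r / R) ^ n)⁻¹) ^ 2 * ∫ ξ, ‖f (R • ξ)‖ ^ 2 ∂(surfaceMeasure n) := by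
  have := isProbabilityMeasure_surfaceMeasure hn
  have hRinv : 1 < R⁻¹ := (one_lt_inv₀ hR0).2 hR1
  have hg : DifferentiableOn ℂ (fun x : Cn n => f (R • x)) (Metric.ball 0 R⁻¹) :=
    differentiableOn_comp_real_smul hR0.le one_pos (mul_inv_cancel₀ hR0.ne').le hf
  have hz' : ‖R⁻¹ • z‖ ≤ r / R := by
    rw [norm_smul, norm_inv, Real.norm_of_nonneg hR0.le, ← div_eq_inv_mul]
    gcongr
  have hr1' : r / R < 1 := (div_lt_one hR0).2 hrR
  have h1 := integral_surface_mul_szego hn hRinv hg (hz'.trans_lt hr1')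
  rw [smul_smul, mul_inv_cancel₀ hR0.ne', one_smul] at h1
  have hbd : ∀ᵐ ξ ∂(surfaceMeasure n), ‖szego ξ (R⁻¹ • z)‖ ≤ ((1 - r / R) ^ n)⁻¹ := by
    filter_upwards [ae_norm_surfaceMeasure] with ξ hξ
    exact norm_szego_le hr1' (by rwa [hξ, mul_one])
  have hm : Measurable fun ξ : Cn n => szego ξ (R⁻¹ • z) :=
    measurable_szego_comp measurable_id measurable_const
  have hL : MemLp (fun ξ => szego ξ (R⁻¹ • z)) 2 (surfaceMeasure n) :=
    MemLp.of_bound hm.aestronglyMeasurable _ hbd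
  have h2 := norm_integral_mul_conj_le (memLp_surface_of_differentiableOn hn hRinv hg) hL
  simp only [szego_conj] at h2
  rw [h1] at h2
  set Q := ∫ ξ, ‖f (R • ξ)‖ ^ 2 ∂(surfaceMeasure n) with hQ
  have hQ0 : 0 ≤ Q := integral_nonneg fun ω => by positivity
  have h3 : ∫ ξ, ‖szego ξ (R⁻¹ • z)‖ ^ 2 ∂(surfaceMeasure n) ≤ (((1 - r / R) ^ n)⁻¹) ^ 2 := by
    refine (integral_mono_of_nonneg (ae_of_all _ fun ξ => by positivity)
      (integrable_const ((((1 - r / R) ^ n)⁻¹) ^ 2)) ?_).trans_eq (by simp)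
    filter_upwards [hbd] with ξ hξ
    gcongr
  calc ‖f z‖ ^ 2 ≤ (√Q * √(∫ ξ, ‖szego ξ (R⁻¹ • z)‖ ^ 2 ∂(surfaceMeasure n))) ^ 2 := by gcongr
    _ = Q * ∫ ξ, ‖szego ξ (R⁻¹ • z)‖ ^ 2 ∂(surfaceMeasure n) := by
      rw [mul_pow, Real.sq_sqrt hQ0, Real.sq_sqrt (integral_nonneg fun ξ => by positivity)]
    _ ≤ Q * (((1 - r / R) ^ n)⁻¹) ^ 2 := by gcongr
    _ = _ := mul_comm _ _

end

/-! ### Norms in polar coordinates and moments of class `S` weights. -/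

section

variable {n : ℕ}

/-! ### Integral means and the norms -/

/-- The integral mean of `‖f‖²` over the sphere of radius `x`. -/
def sphereMean (f : Cn n → ℂ) (x : ℝ) : ℝ≥0∞ := ∫⁻ ξ, ‖f (x • ξ)‖ₑ ^ 2 ∂(surfaceMeasure n)

theorem hardyNormSq_eq_iSup (f : Cn n → ℂ) :
    hardyNormSq n f = ⨆ x ∈ Ioo (0 : ℝ) 1, sphereMean f x := by
  unfold hardyNormSq sphereMean
  have h : ∀ x : ℝ, ∫⁻ ξ, ‖f (x • (ξ : Cn n))‖ₑ ^ 2 ∂(sphereMeasure n) =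
      ∫⁻ ξ, ‖f (x • ξ)‖ₑ ^ 2 ∂(surfaceMeasure n) := fun x =>
    lintegral_sphereMeasure (fun ξ => ‖f (x • ξ)‖ₑ ^ 2)
  simp only [h]

theorem sphereMean_le_hardyNormSq (f : Cn n → ℂ) {x : ℝ} (hx : x ∈ Ioo (0 : ℝ) 1) :
    sphereMean f x ≤ hardyNormSq n f := by
  rw [hardyNormSq_eq_iSup]
  exact le_iSup₂ (f := fun x _ => sphereMean f x) x hx

theorem ofReal_integral_surface (hn : 1 ≤ n) {f : Cn n → ℂ}
    (hf : DifferentiableOn ℂ f (unitBall n)) {x : ℝ} (hx : x ∈ Ioo (0 : ℝ) 1) :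
    ENNReal.ofReal (∫ ξ, ‖f (x • ξ)‖ ^ 2 ∂(surfaceMeasure n)) = sphereMean f x := by
  refine ofReal_integral_norm_sq (memLp_surface_of_differentiableOn hn
    ((one_lt_inv₀ hx.1).2 hx.2) (differentiableOn_comp_real_smul hx.1.le one_pos
      (mul_inv_cancel₀ hx.1.ne').le hf))

theorem sphereMass_eq : sphereMass n = (2 * n : ℕ) * volume (unitBall n) := by
  rw [sphereMass, Measure.toSphere_apply_univ, two_mul_pos_finrank]

theorem measurable_indicator_weight {ρ : ℝ → ℝ} (hρ : ContinuousOn ρ (Ico 0 1)) :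
    Measurable ((Ico (0 : ℝ) 1).indicator ρ) := by
  classical
  rw [← piecewise_eq_indicator]
  exact hρ.measurable_piecewise continuousOn_const measurableSet_Ico

theorem bergmanNormSq_eq (hn : 1 ≤ n) {ρ : ℝ → ℝ} (hρ : ContinuousOn ρ (Ico 0 1)) {f : Cn n → ℂ}
    (hf : DifferentiableOn ℂ f (unitBall n)) :
    bergmanNormSq n ρ f = (2 * n : ℕ) * ∫⁻ x in Ioo (0 : ℝ) 1,
      ENNReal.ofReal (x ^ (2 * n - 1)) * (ENNReal.ofReal (ρ x) * sphereMean f x) := by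
  -- Nothing is known about `f` and `ρ` outside the ball and `[0, 1)`; the indicators provide the
  -- measurability that polar coordinates need.
  set F : Cn n → ℝ≥0∞ := fun z => ‖(unitBall n).indicator f z‖ₑ ^ 2 *
    ENNReal.ofReal ((Ico (0 : ℝ) 1).indicator ρ ‖z‖) with hF
  have hFm : Measurable F := by
    have h1 := (measurable_indicator_of_differentiableOn hf).enorm.pow_const 2
    have h2 := ((measurable_indicator_weight hρ).comp
      (measurable_norm (α := Cn n))).ennreal_ofReal
    exact h1.mul h2
  have h1 : ∫⁻ z in unitBall n, ‖f z‖ₑ ^ 2 * ENNReal.ofReal (ρ ‖z‖) = ∫⁻ z, F z := by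
    rw [← lintegral_indicator Metric.isOpen_ball.measurableSet]
    refine lintegral_congr fun z => ?_
    by_cases hz : z ∈ unitBall n
    · have hz' : ‖z‖ ∈ Ico (0 : ℝ) 1 := ⟨norm_nonneg _, by simpa using hz⟩
      simp only [hF, indicator_of_mem hz, indicator_of_mem hz']
    · simp [hF, indicator_of_notMem hz]
  have hv0 : volume (unitBall n) ≠ 0 := (Metric.measure_ball_pos _ _ one_pos).ne'
  have hvt : volume (unitBall n) ≠ ∞ := measure_ball_lt_top.ne
  rw [bergmanNormSq, ballVolume, lintegral_smul_measure, h1, lintegral_polar hn hFm,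
    sphereMass_eq, smul_eq_mul, ← mul_assoc, mul_comm _ (volume _), ← mul_assoc,
    ENNReal.inv_mul_cancel hv0 hvt, one_mul]
  congr 1
  have hsplit : Ioi (0 : ℝ) = Ioo 0 1 ∪ Ici 1 := by
    rw [Ioo_union_Ici_eq_Ioi zero_lt_one]
  rw [hsplit, lintegral_union measurableSet_Ici (by
    rw [Set.disjoint_left]
    intro x hx hx'
    exact absurd hx.2 (not_lt.2 hx'))]
  have h2 : ∫⁻ x in Ici (1 : ℝ), ENNReal.ofReal (x ^ (2 * n - 1)) *
      ∫⁻ ξ, F (x • ξ) ∂(surfaceMeasure n) = 0 := by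
    rw [setLIntegral_congr_fun (g := fun _ => 0) measurableSet_Ici, lintegral_zero]
    intro x hx
    have : ∫⁻ ξ, F (x • ξ) ∂(surfaceMeasure n) = 0 := by
      rw [lintegral_congr_ae (g := fun _ => 0), lintegral_zero]
      filter_upwards [ae_norm_surfaceMeasure] with ξ hξ
      have hx0 : 0 ≤ x := zero_le_one.trans hx
      have : x • ξ ∉ unitBall n := by
        rw [mem_ball_zero_iff, norm_smul, hξ, mul_one, Real.norm_of_nonneg hx0, not_lt]
        exact hx
      simp only [hF, indicator_of_notMem this]
      simp
    simp only [this, mul_zero]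
  rw [h2, add_zero]
  refine setLIntegral_congr_fun measurableSet_Ioo fun x hx => ?_
  congr 1
  rw [sphereMean, ← lintegral_const_mul' _ _ ENNReal.ofReal_ne_top]
  refine lintegral_congr_ae ?_
  filter_upwards [ae_norm_surfaceMeasure] with ξ hξ
  have h3 : ‖x • ξ‖ = x := by rw [norm_smul, hξ, mul_one, Real.norm_of_nonneg hx.1.le]
  have h4 : x • ξ ∈ unitBall n := by rw [mem_ball_zero_iff, h3]; exact hx.2
  simp only [hF, indicator_of_mem h4, h3, indicator_of_mem (Ioo_subset_Ico_self hx)]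
  rw [mul_comm]

/-! ### Weights and dyadic radii -/

/-- The mass of the weight near `1`. -/
def tailMass (ρ : ℝ → ℝ) (a : ℝ) : ℝ≥0∞ := ∫⁻ x in Ico a 1, ENNReal.ofReal (ρ x)

variable {ρ : ℝ → ℝ} {r : ℕ → ℝ}

theorem IsWeight.lintegral_pos (hρ : IsWeight n ρ) {a b : ℝ} (ha : 0 ≤ a) (hab : a < b)
    (hb : b ≤ 1) : 0 < ∫⁻ x in Ico a b, ENNReal.ofReal (ρ x) := by
  have hm : AEMeasurable (fun x => ENNReal.ofReal (ρ x)) (volume.restrict (Ico a b)) :=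
    ((hρ.continuousOn.mono (Ico_subset_Ico ha hb)).aemeasurable measurableSet_Ico).ennreal_ofReal
  rw [pos_iff_ne_zero, Ne, lintegral_eq_zero_iff' hm]
  intro h
  have h1 : ∀ᵐ x ∂(volume.restrict (Ico a b)), False := by
    filter_upwards [h, ae_restrict_mem measurableSet_Ico] with x hx hx'
    have := hρ.pos x ⟨ha.trans hx'.1, hx'.2.trans_le hb⟩
    simp only [Pi.zero_apply, ENNReal.ofReal_eq_zero] at hx
    linarith
  rw [ae_iff] at h1
  simp only [not_false_eq_true, ofPred_true, Measure.restrict_apply_univ, Real.volume_Ico,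
    ENNReal.ofReal_eq_zero] at h1
  linarith

theorem tailMass_eq_add {a b : ℝ} (hab : a ≤ b) (hb : b ≤ 1) :
    tailMass ρ a = (∫⁻ x in Ico a b, ENNReal.ofReal (ρ x)) + tailMass ρ b := by
  rw [tailMass, tailMass, ← Ico_union_Ico_eq_Ico hab hb, lintegral_union measurableSet_Ico]
  rw [Set.disjoint_left]
  intro x hx hx'
  exact absurd hx.2 (not_lt.2 hx'.1)

theorem IsWeight.ofReal_setIntegral (hρ : IsWeight n ρ) {a : ℝ} (ha : 0 ≤ a) :
    ENNReal.ofReal (∫ x in Ico a 1, ρ x) = tailMass ρ a := by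
  refine ofReal_integral_eq_lintegral_ofReal (hρ.integrableOn.mono_set (Ico_subset_Ico_left ha)) ?_
  filter_upwards [ae_restrict_mem measurableSet_Ico] with x hx
  exact (hρ.pos x ⟨ha.trans hx.1, hx.2⟩).le

theorem IsWeight.tailMass_ne_top (hρ : IsWeight n ρ) {a : ℝ} (ha : 0 ≤ a) : tailMass ρ a ≠ ∞ := by
  rw [← hρ.ofReal_setIntegral ha]
  exact ENNReal.ofReal_ne_top

theorem IsWeight.tailMass_lt (hρ : IsWeight n ρ) {a b : ℝ} (ha : 0 ≤ a) (hab : a < b)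
    (hb : b ≤ 1) : tailMass ρ b < tailMass ρ a := by
  rw [tailMass_eq_add hab.le hb, add_comm]
  exact ENNReal.lt_add_right (hρ.tailMass_ne_top (ha.trans hab.le)) (hρ.lintegral_pos ha hab hb).ne'

theorem IsDyadicSeq.tailMass_eq (hr : IsDyadicSeq ρ r) (hρ : IsWeight n ρ) (k : ℕ) :
    tailMass ρ (r k) = ENNReal.ofReal (2⁻¹ ^ k) := by
  rw [← hρ.ofReal_setIntegral (hr k).1.1, (hr k).2]

theorem IsDyadicSeq.lt_succ (hr : IsDyadicSeq ρ r) (hρ : IsWeight n ρ) (k : ℕ) :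
    r k < r (k + 1) := by
  by_contra! h
  have h1 : tailMass ρ (r k) ≤ tailMass ρ (r (k + 1)) := by
    rw [tailMass_eq_add h (hr k).1.2.le]
    exact le_add_self
  rw [hr.tailMass_eq hρ, hr.tailMass_eq hρ, ENNReal.ofReal_le_ofReal_iff (by positivity),
    pow_succ] at h1
  have : (0 : ℝ) < 2⁻¹ ^ k := by positivity
  linarith

theorem IsDyadicSeq.strictMono (hr : IsDyadicSeq ρ r) (hρ : IsWeight n ρ) : StrictMono r :=
  strictMono_nat_of_lt_succ (hr.lt_succ hρ)

theorem IsDyadicSeq.lintegral_Ico (hr : IsDyadicSeq ρ r) (hρ : IsWeight n ρ) (k : ℕ) :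
    ∫⁻ x in Ico (r k) (r (k + 1)), ENNReal.ofReal (ρ x) = ENNReal.ofReal (2⁻¹ ^ (k + 1)) := by
  have h1 := tailMass_eq_add (ρ := ρ) (hr.lt_succ hρ k).le (hr (k + 1)).1.2.le
  rw [hr.tailMass_eq hρ, hr.tailMass_eq hρ] at h1
  have h2 : (2⁻¹ : ℝ) ^ k = 2⁻¹ ^ (k + 1) + 2⁻¹ ^ (k + 1) := by rw [pow_succ]; ring
  rw [h2, ENNReal.ofReal_add (by positivity) (by positivity)] at h1
  exact ((ENNReal.add_left_inj ENNReal.ofReal_ne_top).1 h1).symm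

/-- Positivity of the weight gives positive mass beyond `a`, and `2^{-k}` eventually falls below it.
-/
theorem IsDyadicSeq.exists_lt (hr : IsDyadicSeq ρ r) (hρ : IsWeight n ρ) {a : ℝ} (ha : a < 1) :
    ∃ k, a < r k := by
  rcases lt_or_ge a 0 with h | h
  · exact ⟨0, h.trans_le (hr 0).1.1⟩
  have h1 : 0 < tailMass ρ a := hρ.lintegral_pos h ha le_rfl
  obtain ⟨k, hk⟩ := exists_pow_lt_of_lt_one (ENNReal.toReal_pos h1.ne' (hρ.tailMass_ne_top h))
    (show (2⁻¹ : ℝ) < 1 by norm_num)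
  refine ⟨k, ?_⟩
  by_contra! h2
  have h3 : tailMass ρ a ≤ tailMass ρ (r k) := by
    rw [tailMass_eq_add h2 ha.le]
    exact le_add_self
  rw [hr.tailMass_eq hρ] at h3
  have h4 := ENNReal.toReal_mono ENNReal.ofReal_ne_top h3
  rw [ENNReal.toReal_ofReal (by positivity)] at h4
  linarith

theorem IsDyadicSeq.tendsto (hr : IsDyadicSeq ρ r) (hρ : IsWeight n ρ) :
    Tendsto r atTop (𝓝 1) := by
  refine tendsto_order.2 ⟨fun a ha => ?_, fun a ha =>
    Eventually.of_forall fun k => (hr k).1.2.trans ha⟩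
  obtain ⟨K, hK⟩ := hr.exists_lt hρ ha
  filter_upwards [eventually_ge_atTop K] with k hk
  exact hK.trans_le ((hr.strictMono hρ).monotone hk)

/-- The tail mass is strictly decreasing. This transfers the ratio condition from the sequence
hidden in `ClassS` to any given one. -/
theorem IsDyadicSeq.unique (hρ : IsWeight n ρ) {r r' : ℕ → ℝ} (hr : IsDyadicSeq ρ r)
    (hr' : IsDyadicSeq ρ r') : r = r' := by
  ext k
  have h : tailMass ρ (r k) = tailMass ρ (r' k) := by rw [hr.tailMass_eq hρ, hr'.tailMass_eq hρ]
  rcases lt_trichotomy (r k) (r' k) with h1 | h1 | h1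
  · exact absurd h (hρ.tailMass_lt (hr k).1.1 h1 (hr' k).1.2.le).ne'
  · exact h1
  · exact absurd h (hρ.tailMass_lt (hr' k).1.1 h1 (hr k).1.2.le).ne

theorem ClassS.exists_ratio (hρ : ClassS n ρ) (hr : IsDyadicSeq ρ r) :
    ∃ c : ℝ, 1 < c ∧ ∀ k, c * (1 - r (k + 1)) ≤ 1 - r k := by
  obtain ⟨hw, r', hr', hc⟩ := hρ
  obtain rfl := IsDyadicSeq.unique hw hr hr'
  refine ⟨_, hc, fun k => ?_⟩
  have hpos : ∀ k, 0 < 1 - r k := fun k => sub_pos.2 (hr k).1.2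
  rw [← le_div_iff₀ (hpos _)]
  exact ciInf_le ⟨0, by rintro _ ⟨j, rfl⟩; exact (div_pos (hpos _) (hpos _)).le⟩ k

/-- The majorant of high powers of `x` used to estimate moments of the weight. -/
def powMajorant (r : ℕ → ℝ) (p k : ℕ) (x : ℝ) : ℝ :=
  if x < r k then ((1 - r k) / (1 - x)) ^ p else 1

/-- Below `r k`, passing to `k + 1` costs a factor at most `c^{-p} ≤ 1/4`; beyond `r k` the majorant
is at most `1`, which the indicator pays for. -/
theorem powMajorant_succ_le (hr1 : ∀ k, r k < 1) (hmono : StrictMono r) {c : ℝ} (hc : 1 < c)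
    (hratio : ∀ k, c * (1 - r (k + 1)) ≤ 1 - r k) {p : ℕ} (hp : 4 ≤ c ^ p) (k : ℕ) {x : ℝ} :
    powMajorant r p (k + 1) x ≤ (Ici (r k)).indicator 1 x + 1 / 4 * powMajorant r p k x := by
  have hpos : ∀ k, 0 < 1 - r k := fun k => sub_pos.2 (hr1 k)
  by_cases hx : x < r k
  · have hx' : x < r (k + 1) := hx.trans (hmono (Nat.lt_succ_self k))
    have h1x : 0 < 1 - x := by linarith [hr1 k]
    rw [powMajorant, powMajorant, if_pos hx, if_pos hx', indicator_of_notMem (by simpa using hx),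
      zero_add]
    have h1 : c ^ p * ((1 - r (k + 1)) / (1 - x)) ^ p ≤ ((1 - r k) / (1 - x)) ^ p := by
      rw [← mul_pow, mul_div_assoc']
      have := (hpos (k + 1)).le
      have h2 := hratio k
      gcongr
    have h2 : 0 ≤ ((1 - r (k + 1)) / (1 - x)) ^ p := pow_nonneg (div_nonneg (hpos _).le h1x.le) p
    nlinarith
  · have h0 : powMajorant r p k x = 1 := if_neg hx
    rw [indicator_of_mem (by simpa using hx), h0, powMajorant, Pi.one_apply]
    split_ifs with h
    · have : ((1 - r (k + 1)) / (1 - x)) ^ p ≤ 1 := by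
        refine pow_le_one₀ (div_nonneg (hpos _).le (by linarith [hr1 (k + 1)])) ?_
        rw [div_le_one (by linarith [hr1 (k + 1)])]
        linarith
      linarith
    · norm_num

/-- The integrals satisfy `I_{k+1} ≤ 2^{-k} + I_k / 4`. The decay `1/4` beats the target `1/2`, so a
bound `A 2^{-k}` with `A ≥ 4` propagates; the total mass of `ρ` enters `A` for the base case. -/
theorem IsDyadicSeq.exists_lintegral_powMajorant_le (hr : IsDyadicSeq ρ r) (hρ : IsWeight n ρ)
    {c : ℝ} (hc : 1 < c) (hratio : ∀ k, c * (1 - r (k + 1)) ≤ 1 - r k) {p : ℕ} (hp : 4 ≤ c ^ p) :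
    ∃ A : ℝ, 0 < A ∧ ∀ k, ∫⁻ x in Ico (0 : ℝ) 1, ENNReal.ofReal (powMajorant r p k x) *
      ENNReal.ofReal (ρ x) ≤ ENNReal.ofReal (A * 2⁻¹ ^ k) := by
  have hm : AEMeasurable (fun x => ENNReal.ofReal (ρ x)) (volume.restrict (Ico 0 1)) :=
    (hρ.continuousOn.aemeasurable measurableSet_Ico).ennreal_ofReal
  have ht := hρ.tailMass_ne_top (a := 0) le_rfl
  refine ⟨max 4 (tailMass ρ 0).toReal, by positivity, fun k => ?_⟩
  set A := max 4 (tailMass ρ 0).toReal with hA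
  have hA4 : 4 ≤ A := le_max_left _ _
  induction k with
  | zero =>
    rw [pow_zero, mul_one]
    calc ∫⁻ x in Ico (0 : ℝ) 1, ENNReal.ofReal (powMajorant r p 0 x) * ENNReal.ofReal (ρ x)
        ≤ ∫⁻ x in Ico (0 : ℝ) 1, ENNReal.ofReal (ρ x) := by
          refine lintegral_mono fun x => ?_
          refine mul_le_of_le_one_left zero_le ?_
          rw [ENNReal.ofReal_le_one, powMajorant]
          split_ifs with h
          · have h1 := (hr 0).1.2
            refine pow_le_one₀ (div_nonneg (by linarith) (by linarith)) ?_
            rw [div_le_one (by linarith)]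
            linarith
          · exact le_rfl
      _ = ENNReal.ofReal (tailMass ρ 0).toReal := (ENNReal.ofReal_toReal ht).symm
      _ ≤ ENNReal.ofReal A := ENNReal.ofReal_le_ofReal (le_max_right _ _)
  | succ k ih =>
    calc ∫⁻ x in Ico (0 : ℝ) 1, ENNReal.ofReal (powMajorant r p (k + 1) x) * ENNReal.ofReal (ρ x)
        ≤ ∫⁻ x in Ico (0 : ℝ) 1, ((Ici (r k)).indicator (fun x => ENNReal.ofReal (ρ x)) x +
            ENNReal.ofReal (1 / 4) *
              (ENNReal.ofReal (powMajorant r p k x) * ENNReal.ofReal (ρ x))) := by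
          refine lintegral_mono fun x => ?_
          have h1 := powMajorant_succ_le (fun k => (hr k).1.2) (hr.strictMono hρ) hc hratio hp k
            (x := x)
          refine (mul_le_mul_left (ENNReal.ofReal_le_ofReal h1) _).trans ?_
          refine (mul_le_mul_left ENNReal.ofReal_add_le _).trans ?_
          rw [add_mul, ENNReal.ofReal_mul (by norm_num), mul_assoc]
          gcongr
          by_cases hx : x ∈ Ici (r k)
          · simp [indicator_of_mem hx]
          · simp [indicator_of_notMem hx]
      _ = tailMass ρ (r k) + ENNReal.ofReal (1 / 4) * ∫⁻ x in Ico (0 : ℝ) 1,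
            ENNReal.ofReal (powMajorant r p k x) * ENNReal.ofReal (ρ x) := by
          rw [lintegral_add_left' (hm.indicator measurableSet_Ici),
            lintegral_const_mul' _ _ ENNReal.ofReal_ne_top,
            lintegral_indicator measurableSet_Ici, Measure.restrict_restrict measurableSet_Ici,
            tailMass]
          congr 3
          ext x
          simp only [mem_inter_iff, mem_Ici, mem_Ico]
          have := (hr k).1.1
          constructor
          · rintro ⟨h1, h2, h3⟩
            exact ⟨h1, h3⟩
          · rintro ⟨h1, h3⟩
            exact ⟨h1, this.trans h1, h3⟩
      _ ≤ ENNReal.ofReal (2⁻¹ ^ k) + ENNReal.ofReal (1 / 4) * ENNReal.ofReal (A * 2⁻¹ ^ k) := by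
          rw [hr.tailMass_eq hρ]
          gcongr
      _ = ENNReal.ofReal (2⁻¹ ^ k + 1 / 4 * (A * 2⁻¹ ^ k)) := by
          rw [← ENNReal.ofReal_mul (by norm_num), ENNReal.ofReal_add (by positivity) (by positivity)]
      _ ≤ ENNReal.ofReal (A * 2⁻¹ ^ (k + 1)) := by
          refine ENNReal.ofReal_le_ofReal ?_
          have : (0 : ℝ) < 2⁻¹ ^ k := by positivity
          rw [pow_succ]
          nlinarith

/-- For `y = (1-x)/(1-r_k)`, the power is at most `e^{-y}`, and `e^y ≥ y^p / p!`. -/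
theorem pow_le_factorial_mul_powMajorant (hr1 : ∀ k, r k < 1) (p k : ℕ) {x : ℝ}
    (hx : x ∈ Ico (0 : ℝ) 1) :
    x ^ (⌊(1 - r k)⁻¹⌋₊ + 1) ≤ p.factorial * powMajorant r p k x := by
  have hf : (1 : ℝ) ≤ p.factorial := by exact_mod_cast p.factorial_pos
  have hδ : 0 < 1 - r k := sub_pos.2 (hr1 k)
  rw [powMajorant]
  split_ifs with h
  · set N := ⌊(1 - r k)⁻¹⌋₊
    have h1x : 0 < 1 - x := by linarith [hx.2]
    have hN : (1 - r k)⁻¹ ≤ N + 1 := (Nat.lt_floor_add_one _).le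
    set y := (1 - x) / (1 - r k) with hy
    have hy0 : 0 < y := by positivity
    have h1 : x ^ (N + 1) ≤ Real.exp (-y) := by
      have h2 : x ≤ Real.exp (-(1 - x)) := by
        have := Real.add_one_le_exp (-(1 - x))
        linarith
      calc x ^ (N + 1) ≤ Real.exp (-(1 - x)) ^ (N + 1) := pow_le_pow_left₀ hx.1 h2 _
        _ = Real.exp (((N + 1 : ℕ) : ℝ) * (-(1 - x))) := by rw [← Real.exp_nat_mul]
        _ ≤ Real.exp (-y) := by
          rw [Real.exp_le_exp, hy, div_eq_mul_inv]
          push_cast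
          nlinarith
    have h3 : y ^ p / p.factorial ≤ Real.exp y := Real.pow_div_factorial_le_exp y hy0.le p
    have h4 : Real.exp (-y) ≤ p.factorial * (y ^ p)⁻¹ := by
      rw [Real.exp_neg]
      have h5 : 0 < y ^ p / p.factorial := by positivity
      have := inv_anti₀ h5 h3
      rwa [inv_div, div_eq_mul_inv] at this
    rw [← inv_pow, hy, inv_div] at h4
    exact h1.trans h4
  · rw [mul_one]
    exact (pow_le_one₀ hx.1 hx.2.le).trans hf

/-- Moments of the weight: on the `k`-th annulus a power `x ^ (2 * N)` is bounded below while the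
corresponding moment of the weight is at most a multiple of `2⁻ᵏ`. -/
theorem ClassS.exists_moment_bound (hn : 1 ≤ n) (hρ : ClassS n ρ) (hr : IsDyadicSeq ρ r) :
    ∃ A : ℝ, 0 < A ∧ ∀ k, ∃ N : ℕ, (∀ x, r k ≤ x → 1 ≤ A * x ^ (2 * N)) ∧
      ∫⁻ x in Ioo (0 : ℝ) 1, ENNReal.ofReal (x ^ (2 * n - 1)) *
        (ENNReal.ofReal (ρ x) * ENNReal.ofReal (x ^ (2 * N))) ≤ ENNReal.ofReal (A * 2⁻¹ ^ k) := by
  obtain ⟨c, hc, hratio⟩ := hρ.exists_ratio hr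
  have hw := hρ.1
  obtain ⟨p, hp⟩ := pow_unbounded_of_one_lt 4 hc
  obtain ⟨A, hA0, hA⟩ := hr.exists_lintegral_powMajorant_le hw hc hratio hp.le
  have hmono := hr.strictMono hw
  have hr1 : 0 < r 1 := (hr 0).1.1.trans_lt (hmono zero_lt_one)
  have hfp : (0 : ℝ) < p.factorial := by exact_mod_cast p.factorial_pos
  have hn1 : ∫⁻ x in Ioo (0 : ℝ) 1, ENNReal.ofReal (x ^ (2 * n - 1)) * ENNReal.ofReal (ρ x) ≤ 1 := by
    have h1 : ENNReal.ofReal (∫ x in Ico (0 : ℝ) 1, x ^ (2 * n - 1) * ρ x) =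
        ∫⁻ x in Ico (0 : ℝ) 1, ENNReal.ofReal (x ^ (2 * n - 1) * ρ x) := by
      refine ofReal_integral_eq_lintegral_ofReal ?_ ?_
      -- A non-integrable function would have Bochner integral `0` by convention, against the
      -- normalization to `1`.
      · by_contra h
        have := hw.normalized
        rw [integral_undef h] at this
        exact zero_ne_one this
      · filter_upwards [ae_restrict_mem measurableSet_Ico] with x hx
        exact mul_nonneg (pow_nonneg hx.1 _) (hw.pos x hx).le
    rw [hw.normalized, ENNReal.ofReal_one] at h1
    rw [h1]
    refine (lintegral_mono_set Ioo_subset_Ico_self).trans (setLIntegral_mono' measurableSet_Ico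
      fun x hx => ?_)
    rw [ENNReal.ofReal_mul (pow_nonneg hx.1 _)]
  refine ⟨max 1 (max (Real.exp (2 / r 1)) (p.factorial * A)), by positivity, fun k => ?_⟩
  set E := max 1 (max (Real.exp (2 / r 1)) (p.factorial * A)) with hE
  have hE1 : 1 ≤ E := le_max_left _ _
  have hE2 : Real.exp (2 / r 1) ≤ E := (le_max_left _ _).trans (le_max_right _ _)
  have hE3 : p.factorial * A ≤ E := (le_max_right _ _).trans (le_max_right _ _)
  -- Since `r 0` may be `0`, no positive power is bounded below on the first annulus; there `N = 0`
  -- and the normalization suffices.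
  rcases Nat.eq_zero_or_pos k with rfl | hk
  · refine ⟨0, fun x _ => by simpa using hE1, ?_⟩
    simp only [mul_zero, pow_zero, ENNReal.ofReal_one, mul_one]
    refine hn1.trans ?_
    rw [← ENNReal.ofReal_one]
    exact ENNReal.ofReal_le_ofReal hE1
  · have hδ : 0 < 1 - r k := sub_pos.2 (hr k).1.2
    have hrk : r 1 ≤ r k := hmono.monotone hk
    have hrk0 : 0 < r k := hr1.trans_le hrk
    set N := ⌊(1 - r k)⁻¹⌋₊ with hN
    have hNle : N * (1 - r k) ≤ 1 := by
      have : (N : ℝ) ≤ (1 - r k)⁻¹ := Nat.floor_le (by positivity)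
      rwa [← le_div_iff₀ hδ, one_div]
    refine ⟨N, fun x hx => ?_, ?_⟩
    · have hx0 : 0 < x := hrk0.trans_le hx
      -- Together with `N (1 - r_k) ≤ 1` this bounds `r_k^{-2N}` by `exp (2 / r_1)`, uniformly in `k
      -- ≥ 1`.
      have h1 : (r k)⁻¹ ≤ Real.exp ((1 - r k) / r k) := by
        have h2 := Real.add_one_le_exp ((1 - r k) / r k)
        have h3 : (1 - r k) / r k + 1 = (r k)⁻¹ := by
          field_simp
          ring
        rwa [h3] at h2
      have h2 : ((r k)⁻¹) ^ (2 * N) ≤ Real.exp (2 / r 1) := by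
        calc ((r k)⁻¹) ^ (2 * N) ≤ Real.exp ((1 - r k) / r k) ^ (2 * N) :=
              pow_le_pow_left₀ (by positivity) h1 _
          _ = Real.exp (((2 * N : ℕ) : ℝ) * ((1 - r k) / r k)) := by rw [← Real.exp_nat_mul]
          _ ≤ Real.exp (2 / r 1) := by
            rw [Real.exp_le_exp]
            push_cast
            calc 2 * (N : ℝ) * ((1 - r k) / r k) = 2 * (N * (1 - r k)) / r k := by ring
              _ ≤ 2 * 1 / r 1 := by gcongr
              _ = 2 / r 1 := by ring
      have h3 : (r k) ^ (2 * N) ≤ x ^ (2 * N) := pow_le_pow_left₀ hrk0.le hx _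
      have h4 : (r k)⁻¹ ^ (2 * N) * r k ^ (2 * N) = 1 := by
        rw [← mul_pow, inv_mul_cancel₀ hrk0.ne', one_pow]
      calc 1 = (r k)⁻¹ ^ (2 * N) * r k ^ (2 * N) := h4.symm
        _ ≤ E * x ^ (2 * N) := by
          gcongr
          exact h2.trans hE2
    · calc ∫⁻ x in Ioo (0 : ℝ) 1, ENNReal.ofReal (x ^ (2 * n - 1)) *
            (ENNReal.ofReal (ρ x) * ENNReal.ofReal (x ^ (2 * N)))
          ≤ ∫⁻ x in Ioo (0 : ℝ) 1, ENNReal.ofReal p.factorial *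
            (ENNReal.ofReal (powMajorant r p k x) * ENNReal.ofReal (ρ x)) := by
            refine setLIntegral_mono' measurableSet_Ioo fun x hx => ?_
            have h1 : x ^ (2 * n - 1) * x ^ (2 * N) ≤ p.factorial * powMajorant r p k x := by
              refine le_trans ?_ (pow_le_factorial_mul_powMajorant (fun k => (hr k).1.2) p k
                (Ioo_subset_Ico_self hx))
              rw [← pow_add]
              exact pow_le_pow_of_le_one hx.1.le hx.2.le (by omega)
            have h2 := ENNReal.ofReal_le_ofReal h1
            rw [ENNReal.ofReal_mul (pow_nonneg hx.1.le _), ENNReal.ofReal_mul hfp.le] at h2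
            calc _ = ENNReal.ofReal (x ^ (2 * n - 1)) * ENNReal.ofReal (x ^ (2 * N)) *
                  ENNReal.ofReal (ρ x) := by ring
              _ ≤ _ := by
                rw [← mul_assoc]
                gcongr
        _ = ENNReal.ofReal p.factorial * ∫⁻ x in Ioo (0 : ℝ) 1,
            ENNReal.ofReal (powMajorant r p k x) * ENNReal.ofReal (ρ x) :=
            lintegral_const_mul' _ _ ENNReal.ofReal_ne_top
        _ ≤ ENNReal.ofReal p.factorial * ENNReal.ofReal (A * 2⁻¹ ^ k) := by
            gcongr
            exact (lintegral_mono_set Ioo_subset_Ico_self).trans (hA k)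
        _ ≤ ENNReal.ofReal (E * 2⁻¹ ^ k) := by
            rw [← ENNReal.ofReal_mul hfp.le, ← mul_assoc]
            refine ENNReal.ofReal_le_ofReal ?_
            gcongr

end

/-! ### Carleson estimates on annuli, passed between the two spaces. -/

section

variable {n : ℕ} {ρ : ℝ → ℝ} {r : ℕ → ℝ}

/-! ### Carleson constants -/

/-- The infimum is attained, as one sees after dividing by `N f`. The case `N f = 0` has to come
from a finite admissible constant. -/
theorem lintegral_le_carlesonConst_mul {N : (Cn n → ℂ) → ℝ≥0∞} {μ : Measure (unitBall n)}
    (h : IsCarleson N μ) {f : Cn n → ℂ} (hf : f ∈ holSpace N) :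
    ∫⁻ z, ‖f (z : Cn n)‖ₑ ^ 2 ∂μ ≤ carlesonConst N μ * N f := by
  by_cases h0 : N f = 0
  · obtain ⟨C, -, hC⟩ := h
    have := hC f hf
    rw [h0, mul_zero] at this ⊢
    exact this
  · rw [← ENNReal.div_le_iff h0 hf.2.ne]
    refine le_sInf fun C hC => ?_
    rw [ENNReal.div_le_iff h0 hf.2.ne]
    exact hC f hf

theorem carlesonConst_le {N : (Cn n → ℂ) → ℝ≥0∞} {μ : Measure (unitBall n)} {C : ℝ≥0∞}
    (h : ∀ f ∈ holSpace N, ∫⁻ z, ‖f (z : Cn n)‖ₑ ^ 2 ∂μ ≤ C * N f) : carlesonConst N μ ≤ C :=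
  sInf_le h

theorem continuous_coe_unitBall {f : Cn n → ℂ} (hf : DifferentiableOn ℂ f (unitBall n)) :
    Continuous fun z : unitBall n => f (z : Cn n) :=
  hf.continuousOn.domRestrict

theorem measurableSet_annulus (r : ℕ → ℝ) (k : ℕ) : MeasurableSet (annulus n r k) := by
  have h : Measurable fun z : unitBall n => ‖(z : Cn n)‖ := by fun_prop
  exact (measurableSet_le measurable_const h).inter (measurableSet_lt h measurable_const)

/-- The part of the unit ball at distance at least `a` from the origin. -/
def outerPart (n : ℕ) (a : ℝ) : Set (unitBall n) := {z | a ≤ ‖(z : Cn n)‖}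

theorem measurableSet_outerPart (a : ℝ) : MeasurableSet (outerPart n a) := by
  have h : Measurable fun z : unitBall n => ‖(z : Cn n)‖ := by fun_prop
  exact measurableSet_le measurable_const h

theorem annulus_subset_outerPart (r : ℕ → ℝ) (k : ℕ) : annulus n r k ⊆ outerPart n (r k) :=
  fun _ hz => hz.1

theorem outerPart_subset_iUnion_annulus (hr : Tendsto r atTop (𝓝 1)) (K : ℕ) :
    outerPart n (r K) ⊆ ⋃ j, annulus n r (K + j) := by
  intro z hz
  have hz1 : ‖(z : Cn n)‖ < 1 := mem_ball_zero_iff.1 z.2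
  have hex : ∃ j, ‖(z : Cn n)‖ < r (K + (j + 1)) := by
    obtain ⟨m, hm⟩ := ((tendsto_order.1 hr).1 _ hz1).exists_forall_of_atTop
    exact ⟨m, hm _ (by omega)⟩
  classical
  refine mem_iUnion.2 ⟨Nat.find hex, ?_, Nat.find_spec hex⟩
  rcases h : Nat.find hex with _ | j
  · exact hz
  · by_contra! h2
    have := Nat.find_min' hex h2
    omega

/-! ### Averaging over dyadic shells -/

/-- The contribution of the `k`-th shell to the Bergman norm. -/
def shellNormSq (n : ℕ) (ρ : ℝ → ℝ) (r : ℕ → ℝ) (k : ℕ) (f : Cn n → ℂ) : ℝ≥0∞ :=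
  ∫⁻ x in Ico (r k) (r (k + 1)), ENNReal.ofReal (x ^ (2 * n - 1)) *
    (ENNReal.ofReal (ρ x) * sphereMean f x)

/-- The shells are disjoint. Indices start at `K + 1 ≥ 1` so that they avoid the radius `0`, which
`r 0` may equal. -/
theorem tsum_shellNormSq_le (hn : 1 ≤ n) (hρ : IsWeight n ρ) (hr : IsDyadicSeq ρ r) {f : Cn n → ℂ}
    (hf : DifferentiableOn ℂ f (unitBall n)) (K : ℕ) :
    ∑' j, shellNormSq n ρ r (K + 1 + j) f ≤ bergmanNormSq n ρ f := by
  have hmono := hr.strictMono hρ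
  have hdis : Pairwise (Function.onFun Disjoint fun j => Ico (r (K + 1 + j)) (r (K + 1 + j + 1))) := by
    have := (hmono.monotone).pairwise_disjoint_on_Ico_succ
    intro i j hij
    exact this (show K + 1 + i ≠ K + 1 + j by omega)
  unfold shellNormSq
  rw [← lintegral_iUnion (fun _ => measurableSet_Ico) hdis, bergmanNormSq_eq hn hρ.continuousOn hf]
  have hsub : (⋃ j, Ico (r (K + 1 + j)) (r (K + 1 + j + 1))) ⊆ Ioo 0 1 := by
    refine iUnion_subset fun j x hx => ⟨?_, hx.2.trans (hr _).1.2⟩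
    have h1 := (hr 0).1.1
    have h2 : r 0 < r (K + 1 + j) := hmono (by omega)
    linarith [hx.1]
  refine (lintegral_mono_set hsub).trans (le_mul_of_one_le_left zero_le ?_)
  exact_mod_cast (by omega : 1 ≤ 2 * n)

theorem shellNormSq_le (hn : 1 ≤ n) (hρ : IsWeight n ρ) (hr : IsDyadicSeq ρ r) {f : Cn n → ℂ}
    (hf : DifferentiableOn ℂ f (unitBall n)) {k : ℕ} (hk : 1 ≤ k) :
    shellNormSq n ρ r k f ≤ bergmanNormSq n ρ f := by
  obtain ⟨j, rfl⟩ := Nat.exists_eq_add_of_le hk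
  refine le_trans ?_ (tsum_shellNormSq_le hn hρ hr hf 0)
  rw [zero_add]
  exact ENNReal.le_tsum (f := fun j => shellNormSq n ρ r (1 + j) f) j

/-- A quantity dominated by the integral means over all spheres of a shell is dominated by the
contribution of the shell to the Bergman norm. -/
theorem le_mul_shellNormSq (hρ : IsWeight n ρ) (hr : IsDyadicSeq ρ r) {k : ℕ} {b : ℝ} (hb : 0 < b)
    (hbk : b ≤ r k) {f : Cn n → ℂ} {T : ℝ≥0∞} {E : ℝ}
    (h : ∀ x ∈ Ico (r k) (r (k + 1)), T ≤ ENNReal.ofReal E * sphereMean f x) :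
    T ≤ ENNReal.ofReal (E * 2 ^ (k + 1) / b ^ (2 * n - 1)) * shellNormSq n ρ r k f := by
  set w := b ^ (2 * n - 1) with hw
  have hw0 : 0 < w := by positivity
  have hm : AEMeasurable (fun x => ENNReal.ofReal (ρ x))
      (volume.restrict (Ico (r k) (r (k + 1)))) :=
    ((hρ.continuousOn.mono (Ico_subset_Ico (hr k).1.1 (hr (k + 1)).1.2.le)).aemeasurable
      measurableSet_Ico).ennreal_ofReal
  -- The hypothesis is integrated against `x^{2n-1} ρ(x)` over the shell, where `ρ` has mass
  -- `2^{-(k+1)}` and `x^{2n-1} ≥ b^{2n-1}`.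
  have h1 : ENNReal.ofReal (w * 2⁻¹ ^ (k + 1)) * T ≤
      ENNReal.ofReal E * shellNormSq n ρ r k f := by
    rw [ENNReal.ofReal_mul hw0.le, ← hr.lintegral_Ico hρ k, mul_assoc,
      ← lintegral_mul_const'' _ hm, shellNormSq,
      ← lintegral_const_mul' _ _ ENNReal.ofReal_ne_top, ← lintegral_const_mul' _ _ ENNReal.ofReal_ne_top]
    refine setLIntegral_mono' measurableSet_Ico fun x hx => ?_
    calc ENNReal.ofReal w * (ENNReal.ofReal (ρ x) * T)
        ≤ ENNReal.ofReal (x ^ (2 * n - 1)) *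
          (ENNReal.ofReal (ρ x) * (ENNReal.ofReal E * sphereMean f x)) := by
          gcongr
          · exact pow_le_pow_left₀ hb.le (hbk.trans hx.1) _
          · exact h x hx
      _ = _ := by ring
  have hpos : 0 < w * 2⁻¹ ^ (k + 1) := by positivity
  have h2 : E * 2 ^ (k + 1) / w = (w * 2⁻¹ ^ (k + 1))⁻¹ * E := by
    rw [mul_inv, inv_pow, inv_inv]
    field_simp
  rw [h2, ENNReal.ofReal_mul (by positivity), mul_assoc, ENNReal.ofReal_inv_of_pos hpos,
    ← ENNReal.div_eq_inv_mul, ENNReal.le_div_iff_mul_le (Or.inl (by simpa using hpos))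
      (Or.inl ENNReal.ofReal_ne_top), mul_comm]
  exact h1

theorem enorm_sq_le_sphereMean (hn : 1 ≤ n) {a R : ℝ} (haR : a < R) (hR : R ∈ Ioo (0 : ℝ) 1)
    {f : Cn n → ℂ} (hf : DifferentiableOn ℂ f (unitBall n)) {z : Cn n} (hz : ‖z‖ ≤ a) :
    ‖f z‖ₑ ^ 2 ≤ ENNReal.ofReal ((((1 - a / R) ^ n)⁻¹) ^ 2) * sphereMean f R := by
  rw [← ofReal_integral_surface hn hf hR, ← ENNReal.ofReal_mul (by positivity), ← ofReal_norm,
    ← ENNReal.ofReal_pow (norm_nonneg _)]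
  exact ENNReal.ofReal_le_ofReal (norm_sq_le_integral_surface hn haR hR.1 hR.2 hf hz)

/-- Point evaluations are locally uniformly bounded on the Bergman space. -/
theorem exists_enorm_sq_le_bergmanNormSq (hn : 1 ≤ n) (hρ : IsWeight n ρ) (hr : IsDyadicSeq ρ r)
    {a : ℝ} (ha0 : 0 ≤ a) (ha : a < 1) :
    ∃ D : ℝ, 0 < D ∧ ∀ f : Cn n → ℂ, DifferentiableOn ℂ f (unitBall n) → ∀ z : Cn n, ‖z‖ ≤ a →
      ‖f z‖ₑ ^ 2 ≤ ENNReal.ofReal D * bergmanNormSq n ρ f := by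
  obtain ⟨k, hk⟩ := hr.exists_lt hρ ha
  have hk' : a < r (k + 1) := hk.trans (hr.lt_succ hρ k)
  have hb : 0 < r (k + 1) := ha0.trans_lt hk'
  have h1 : 0 < 1 - a / r (k + 1) := sub_pos.2 ((div_lt_one hb).2 hk')
  refine ⟨(((1 - a / r (k + 1)) ^ n)⁻¹) ^ 2 * 2 ^ (k + 1 + 1) / r (k + 1) ^ (2 * n - 1),
    by positivity, fun f hf z hz => ?_⟩
  refine (le_mul_shellNormSq hρ hr hb le_rfl (f := f) (T := ‖f z‖ₑ ^ 2)
    (E := (((1 - a / r (k + 1)) ^ n)⁻¹) ^ 2) fun x hx => ?_).trans ?_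
  · have hx0 : 0 < x := hb.trans_le hx.1
    refine (enorm_sq_le_sphereMean hn (hk'.trans_le hx.1) ⟨hx0, hx.2.trans (hr _).1.2⟩ hf hz).trans ?_
    have h2 : 1 - a / r (k + 1) ≤ 1 - a / x :=
      sub_le_sub_left (div_le_div_of_nonneg_left ha0 hb hx.1) 1
    have h3 : 0 < 1 - a / x := h1.trans_le h2
    gcongr
  · gcongr
    exact shellNormSq_le hn hρ hr hf (by omega)

/-- Finite measures supported in a smaller ball are Carleson measures for the Hardy space. -/
theorem isCarleson_hardy_of_support (hn : 1 ≤ n) {μ : Measure (unitBall n)} [IsFiniteMeasure μ]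
    {a : ℝ} (ha0 : 0 ≤ a) (ha : a < 1) (hμ : ∀ᵐ z : unitBall n ∂μ, ‖(z : Cn n)‖ ≤ a) :
    IsCarleson (hardyNormSq n) μ := by
  have hR : (1 + a) / 2 ∈ Ioo (0 : ℝ) 1 := ⟨by linarith, by linarith⟩
  have haR : a < (1 + a) / 2 := by linarith
  have h1 : 0 < 1 - a / ((1 + a) / 2) := sub_pos.2 ((div_lt_one hR.1).2 haR)
  set E := (((1 - a / ((1 + a) / 2)) ^ n)⁻¹) ^ 2 with hE
  have hE0 : 0 < E := by positivity
  refine ⟨E * (μ.real univ + 1), by positivity, fun f hf => ?_⟩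
  calc ∫⁻ z, ‖f (z : Cn n)‖ₑ ^ 2 ∂μ ≤ ∫⁻ _, ENNReal.ofReal E * hardyNormSq n f ∂μ := by
        refine lintegral_mono_ae ?_
        filter_upwards [hμ] with z hz
        refine (enorm_sq_le_sphereMean hn haR hR hf.1 hz).trans ?_
        gcongr
        exact sphereMean_le_hardyNormSq f hR
    _ = ENNReal.ofReal E * hardyNormSq n f * μ univ := lintegral_const _
    _ ≤ ENNReal.ofReal E * hardyNormSq n f * ENNReal.ofReal (μ.real univ + 1) := by
        gcongr
        rw [← ofReal_measureReal]
        exact ENNReal.ofReal_le_ofReal (by linarith)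
    _ = ENNReal.ofReal (E * (μ.real univ + 1)) * hardyNormSq n f := by
        rw [ENNReal.ofReal_mul hE0.le]
        ring

theorem isCarleson_hardy_restrict_annulus (hn : 1 ≤ n) (hr : IsDyadicSeq ρ r)
    (μ : Measure (unitBall n)) [IsFiniteMeasure μ] (k : ℕ) :
    IsCarleson (hardyNormSq n) (μ.restrict (annulus n r k)) := by
  refine isCarleson_hardy_of_support hn (hr (k + 1)).1.1 (hr (k + 1)).1.2 ?_
  filter_upwards [ae_restrict_mem (measurableSet_annulus r k)] with z hz using hz.2.le

/-! ### From the Hardy space to the Bergman space -/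

/-- The class `S` gap gives `x - a ≥ (1 - c⁻¹)(1 - a)`. The denominator is at least `x - a`, and the
numerator is at most `2 (1 - a)`. -/
theorem ratio_le {a x c : ℝ} (ha : 0 ≤ a) (hx1 : x < 1) (hc : 1 < c) (h : c * (1 - x) ≤ 1 - a) :
    (1 - a ^ 2) / (1 - x⁻¹ ^ 2 * a ^ 2) ≤ 2 / (1 - c⁻¹) := by
  have hc0 : 0 < 1 - c⁻¹ := sub_pos.2 (inv_lt_one_of_one_lt₀ hc)
  have hax : a < x := by nlinarith
  have hx0 : 0 < x := ha.trans_lt hax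
  have h1 : (1 - c⁻¹) * (1 - a) ≤ x - a := by
    have h2 : 1 - x ≤ c⁻¹ * (1 - a) := by
      rw [← div_eq_inv_mul, le_div_iff₀ (by linarith)]
      linarith
    linarith
  have h3 : 0 < 1 - x⁻¹ ^ 2 * a ^ 2 := by
    rw [← mul_pow, ← div_eq_inv_mul, sub_pos]
    exact pow_lt_one₀ (by positivity) ((div_lt_one hx0).2 hax) two_ne_zero
  rw [div_le_div_iff₀ h3 hc0]
  have h4 : x ^ 2 * (1 - x⁻¹ ^ 2 * a ^ 2) = (x - a) * (x + a) := by
    field_simp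
    ring
  have h5 : x * (x - a) ≤ 1 - x⁻¹ ^ 2 * a ^ 2 := by
    have hx2 : 0 < x ^ 2 := by positivity
    refine le_of_mul_le_mul_left ?_ hx2
    rw [h4]
    have : x ^ 2 * x ≤ x := by nlinarith [mul_pos hx0 hx0, mul_pos hx0 (mul_pos hx0 hx0)]
    nlinarith
  have h6 : x - a ≤ 1 - x⁻¹ ^ 2 * a ^ 2 := by
    have hx2 : 0 < x ^ 2 := by positivity
    refine le_of_mul_le_mul_left ?_ hx2
    rw [h4]
    have : x ^ 2 ≤ x + a := by nlinarith
    nlinarith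
  nlinarith

/-- The Carleson estimate on an annulus transfers to the integral means over larger spheres. -/
theorem lintegral_annulus_le_sphereMean (hn : 1 ≤ n) (hρ : IsWeight n ρ) (hr : IsDyadicSeq ρ r)
    {c : ℝ} (hc : 1 < c) (hratio : ∀ k, c * (1 - r (k + 1)) ≤ 1 - r k) {μ : Measure (unitBall n)}
    [IsFiniteMeasure μ] {k : ℕ} {E : ℝ} (hE : 0 ≤ E)
    (hcar : ∀ f ∈ holSpace (hardyNormSq n), ∫⁻ z, ‖f (z : Cn n)‖ₑ ^ 2 ∂(μ.restrict (annulus n r k)) ≤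
      ENNReal.ofReal E * hardyNormSq n f) {f : Cn n → ℂ} (hf : DifferentiableOn ℂ f (unitBall n))
    {x : ℝ} (hx : x ∈ Ico (r (k + 2)) 1) :
    ∫⁻ z, ‖f (z : Cn n)‖ₑ ^ 2 ∂(μ.restrict (annulus n r k)) ≤
      ENNReal.ofReal (E * (2 / (1 - c⁻¹)) ^ n) * sphereMean f x := by
  classical
  set ν := μ.restrict (annulus n r k) with hν
  set a := r (k + 1) with ha
  have ha0 : 0 ≤ a := (hr (k + 1)).1.1
  have hmono := hr.strictMono hρ
  have hax : a < x := (hmono (by omega : k + 1 < k + 2)).trans_le hx.1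
  have hx0 : 0 < x := ha0.trans_lt hax
  have hratio' : c * (1 - x) ≤ 1 - a := by
    have h1 := hratio (k + 1)
    have h2 := hx.1
    nlinarith
  -- The dilation estimate asks for `‖Z‖ ≤ a` everywhere, whereas the restricted measure gives it
  -- only almost everywhere.
  set Z : unitBall n → Cn n := fun z => if ‖(z : Cn n)‖ ≤ a then (z : Cn n) else 0 with hZdef
  have hZm : Measurable Z := by
    refine Measurable.ite (measurableSet_le ?_ measurable_const) measurable_subtype_coe
      measurable_const
    fun_prop
  have hZa : ∀ z, ‖Z z‖ ≤ a := fun z => by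
    simp only [hZdef]
    split_ifs with h
    · exact h
    · simpa using ha0
  have hZe : ∀ᵐ z ∂ν, Z z = z := by
    filter_upwards [ae_restrict_mem (measurableSet_annulus r k)] with z hz
    exact if_pos hz.2.le
  have hcongr : ∀ g : Cn n → ℂ, ∫⁻ z, ‖g (Z z)‖ₑ ^ 2 ∂ν = ∫⁻ z, ‖g (z : Cn n)‖ₑ ^ 2 ∂ν := fun g => by
    refine lintegral_congr_ae ?_
    filter_upwards [hZe] with z hz
    rw [hz]
  have key := integral_norm_sq_le_of_carleson (ν := ν) hn hZm ha0 hax hx.2 hZa hE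
    (fun g hg => by rw [hcongr]; exact hcar g hg) hf
  have hfZ : MemLp (fun z => f (Z z)) 2 ν := by
    obtain ⟨B, hB⟩ := (isCompact_closedBall (0 : Cn n) a).exists_bound_of_continuousOn
      (hf.continuousOn.mono (Metric.closedBall_subset_ball (hax.trans hx.2)))
    refine MemLp.of_bound ?_ B (ae_of_all _ fun z => hB _ (by simpa using hZa z))
    refine (continuous_coe_unitBall hf).aestronglyMeasurable.congr ?_
    filter_upwards [hZe] with z hz
    rw [hz]
  rw [← hcongr, ← ofReal_integral_norm_sq hfZ, ← ofReal_integral_surface hn hf ⟨hx0, hx.2⟩,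
    ← ENNReal.ofReal_mul (by
      have := inv_lt_one_of_one_lt₀ hc
      have : 0 < 1 - c⁻¹ := by linarith
      positivity)]
  refine ENNReal.ofReal_le_ofReal (key.trans ?_)
  have h3 := ratio_le ha0 hx.2 hc hratio'
  have h4 : 0 ≤ (1 - a ^ 2) / (1 - x⁻¹ ^ 2 * a ^ 2) := by
    refine div_nonneg (by nlinarith [hx.2]) ?_
    rw [← mul_pow, ← div_eq_inv_mul, sub_nonneg]
    exact pow_le_one₀ (by positivity) ((div_le_one hx0).2 hax.le)
  gcongr

/-- Carleson estimates for the Hardy space on the outer annuli sum up to an estimate for the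
Bergman space near the boundary. -/
theorem ClassS.exists_outer_estimate (hn : 1 ≤ n) (hρ : ClassS n ρ) (hr : IsDyadicSeq ρ r)
    (μ : Measure (unitBall n)) [IsFiniteMeasure μ] :
    ∃ D : ℝ, 0 < D ∧ ∀ (K : ℕ) (ε : ℝ), 0 ≤ ε →
      (∀ k, K ≤ k → carlesonConst (hardyNormSq n) (μ.restrict (annulus n r k)) ≤
        ENNReal.ofReal (ε * 2⁻¹ ^ k)) →
      ∀ f : Cn n → ℂ, DifferentiableOn ℂ f (unitBall n) →
        ∫⁻ z in outerPart n (r K), ‖f (z : Cn n)‖ₑ ^ 2 ∂μ ≤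
          ENNReal.ofReal (D * ε) * bergmanNormSq n ρ f := by
  obtain ⟨c, hc, hratio⟩ := hρ.exists_ratio hr
  have hw := hρ.1
  have hmono := hr.strictMono hw
  have hb : 0 < r 1 := (hr 0).1.1.trans_lt (hmono zero_lt_one)
  have hc0 : 0 < 1 - c⁻¹ := sub_pos.2 (inv_lt_one_of_one_lt₀ hc)
  set M := (2 / (1 - c⁻¹)) ^ n with hM
  refine ⟨8 * M / r 1 ^ (2 * n - 1), by positivity, fun K ε hε hcar f hf => ?_⟩
  -- Annulus `k` is paired with shell `k + 2`, leaving the gap from `r_{k+1}` to `r_{k+2}` for the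
  -- dilation. The factor `2^{k+3}` from the shell against `2^{-k}` leaves `8`.
  have h1 : ∀ k, K ≤ k → ∫⁻ z in annulus n r k, ‖f (z : Cn n)‖ₑ ^ 2 ∂μ ≤
      ENNReal.ofReal (8 * M / r 1 ^ (2 * n - 1) * ε) * shellNormSq n ρ r (k + 2) f := by
    intro k hk
    have h2 := le_mul_shellNormSq hw hr (k := k + 2) hb (hmono.monotone (by omega)) (f := f)
      (T := ∫⁻ z in annulus n r k, ‖f (z : Cn n)‖ₑ ^ 2 ∂μ) (E := ε * 2⁻¹ ^ k * M)
      fun x hx => lintegral_annulus_le_sphereMean hn hw hr hc hratio (by positivity)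
        (fun g hg => (lintegral_le_carlesonConst_mul
          (isCarleson_hardy_restrict_annulus hn hr μ k) hg).trans (by
            gcongr
            exact hcar k hk)) hf ⟨hx.1, hx.2.trans (hr _).1.2⟩
    convert h2 using 3
    have h3 : (2⁻¹ : ℝ) ^ k * 2 ^ k = 1 := by rw [← mul_pow]; norm_num
    have h4 : (2 : ℝ) ^ (k + 2 + 1) = 8 * 2 ^ k := by ring
    rw [h4]
    linear_combination (-(8 * M * ε / r 1 ^ (2 * n - 1))) * h3
  calc ∫⁻ z in outerPart n (r K), ‖f (z : Cn n)‖ₑ ^ 2 ∂μ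
      ≤ ∫⁻ z in ⋃ j, annulus n r (K + j), ‖f (z : Cn n)‖ₑ ^ 2 ∂μ :=
        lintegral_mono_set (outerPart_subset_iUnion_annulus (hr.tendsto hw) K)
    _ ≤ ∑' j, ∫⁻ z in annulus n r (K + j), ‖f (z : Cn n)‖ₑ ^ 2 ∂μ := lintegral_iUnion_le _ _
    _ ≤ ∑' j, ENNReal.ofReal (8 * M / r 1 ^ (2 * n - 1) * ε) *
          shellNormSq n ρ r (K + 1 + 1 + j) f := by
        refine ENNReal.tsum_le_tsum fun j => (h1 (K + j) (by omega)).trans_eq ?_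
        rw [show K + j + 2 = K + 1 + 1 + j by omega]
    _ ≤ ENNReal.ofReal (8 * M / r 1 ^ (2 * n - 1) * ε) * bergmanNormSq n ρ f := by
        rw [ENNReal.tsum_mul_left]
        gcongr
        exact tsum_shellNormSq_le hn hw hr hf (K + 1)

/-- Inside radius `r K`, bounded point evaluations and finiteness of `μ` suffice, so only the outer
annuli matter. -/
theorem ClassS.isCarleson_of_eventually (hn : 1 ≤ n) (hρ : ClassS n ρ) (hr : IsDyadicSeq ρ r)
    (μ : Measure (unitBall n)) [IsFiniteMeasure μ] {K : ℕ} {ε : ℝ} (hε : 0 ≤ ε)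
    (h : ∀ k, K ≤ k → carlesonConst (hardyNormSq n) (μ.restrict (annulus n r k)) ≤
        ENNReal.ofReal (ε * 2⁻¹ ^ k)) : IsCarleson (bergmanNormSq n ρ) μ := by
  obtain ⟨D, hD0, hD⟩ := hρ.exists_outer_estimate hn hr μ
  obtain ⟨E, hE0, hE⟩ := exists_enorm_sq_le_bergmanNormSq hn hρ.1 hr (hr K).1.1 (hr K).1.2
  refine ⟨D * ε + E * (μ.real univ + 1), by positivity, fun f hf => ?_⟩
  have h1 := hD K ε hε h f hf.1
  have h2 : ∫⁻ z in (outerPart n (r K))ᶜ, ‖f (z : Cn n)‖ₑ ^ 2 ∂μ ≤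
      ENNReal.ofReal (E * (μ.real univ + 1)) * bergmanNormSq n ρ f := by
    calc ∫⁻ z in (outerPart n (r K))ᶜ, ‖f (z : Cn n)‖ₑ ^ 2 ∂μ
        ≤ ∫⁻ _ in (outerPart n (r K))ᶜ, ENNReal.ofReal E * bergmanNormSq n ρ f ∂μ := by
          refine setLIntegral_mono' (measurableSet_outerPart _).compl fun z hz => ?_
          exact hE f hf.1 _ (not_le.1 (show ¬ r K ≤ ‖(z : Cn n)‖ from hz)).le
      _ ≤ ∫⁻ _, ENNReal.ofReal E * bergmanNormSq n ρ f ∂μ := setLIntegral_le_lintegral _ _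
      _ = ENNReal.ofReal E * bergmanNormSq n ρ f * μ univ := lintegral_const _
      _ ≤ ENNReal.ofReal E * bergmanNormSq n ρ f * ENNReal.ofReal (μ.real univ + 1) := by
          gcongr
          rw [← ofReal_measureReal]
          exact ENNReal.ofReal_le_ofReal (by linarith)
      _ = _ := by
          rw [ENNReal.ofReal_mul hE0.le]
          ring
  rw [← lintegral_add_compl _ (measurableSet_outerPart (r K)),
    ENNReal.ofReal_add (by positivity) (by positivity), add_mul]
  exact add_le_add h1 h2

/-! ### From the Bergman space to the Hardy space -/

/-- Superadditivity of the lower integral holds without measurability, so that of the spherical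
means as functions of the radius need not be checked. -/
theorem sum_lintegral_le {α ι : Type*} [MeasurableSpace α] {μ : Measure α} (s : Finset ι)
    (f : ι → α → ℝ≥0∞) : ∑ i ∈ s, ∫⁻ x, f i x ∂μ ≤ ∫⁻ x, ∑ i ∈ s, f i x ∂μ := by
  classical
  induction s using Finset.induction_on with
  | empty => simp
  | insert i s hi ih =>
    simp only [Finset.sum_insert hi]
    exact (add_le_add le_rfl ih).trans (le_lintegral_add _ _)

theorem sum_enorm_monomial_sq (z : Cn n) (k : ℕ) :
    ∑ a : Fin k → Fin n, ‖monomial a z‖ₑ ^ 2 = ENNReal.ofReal (‖z‖ ^ (2 * k)) := by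
  rw [← sum_norm_monomial_sq, ENNReal.ofReal_sum_of_nonneg fun a _ => by positivity]
  refine Finset.sum_congr rfl fun a _ => ?_
  rw [ENNReal.ofReal_pow (norm_nonneg _), ofReal_norm]

theorem sum_sphereMean_monomial_mul {f : Cn n → ℂ} (hn : 1 ≤ n)
    (hf : DifferentiableOn ℂ f (unitBall n)) (N : ℕ) {x : ℝ} (hx : x ∈ Ioo (0 : ℝ) 1) :
    ∑ a : Fin N → Fin n, sphereMean (fun z => monomial a z * f z) x =
      ENNReal.ofReal (x ^ (2 * N)) * sphereMean f x := by
  have hm : AEMeasurable (fun ξ => f (x • ξ)) (surfaceMeasure n) :=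
    (memLp_surface_of_differentiableOn hn ((one_lt_inv₀ hx.1).2 hx.2)
      (differentiableOn_comp_real_smul hx.1.le one_pos
      (mul_inv_cancel₀ hx.1.ne').le hf)).aestronglyMeasurable.aemeasurable
  have hx' : ∀ ξ : Cn n, x • ξ = (x : ℂ) • ξ := fun ξ => rfl
  unfold sphereMean
  rw [← lintegral_finsetSum' _ fun a _ => ?_, ← lintegral_const_mul' _ _ ENNReal.ofReal_ne_top]
  · refine lintegral_congr_ae ?_
    filter_upwards [ae_norm_surfaceMeasure] with ξ hξ
    simp only [enorm_mul, mul_pow]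
    rw [← Finset.sum_mul, sum_enorm_monomial_sq, norm_smul, hξ, mul_one,
      Real.norm_of_nonneg hx.1.le]
  · refine AEMeasurable.pow_const (AEMeasurable.enorm (AEMeasurable.mul ?_ hm)) _
    simp only [hx']
    exact ((continuous_monomial a).comp (continuous_const_smul (x : ℂ))).aemeasurable

/-- Multiplication by monomials transfers an estimate for the Bergman space on an annulus to one
for the Hardy space. -/
theorem ClassS.exists_annulus_estimate (hn : 1 ≤ n) (hρ : ClassS n ρ) (hr : IsDyadicSeq ρ r)
    (μ : Measure (unitBall n)) :
    ∃ A : ℝ, 0 < A ∧ ∀ (k : ℕ) (τ : ℝ), 0 ≤ τ →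
      (∀ h ∈ holSpace (bergmanNormSq n ρ), ∫⁻ z in annulus n r k, ‖h (z : Cn n)‖ₑ ^ 2 ∂μ ≤
        ENNReal.ofReal τ * bergmanNormSq n ρ h) →
      ∀ f ∈ holSpace (hardyNormSq n), ∫⁻ z in annulus n r k, ‖f (z : Cn n)‖ₑ ^ 2 ∂μ ≤
        ENNReal.ofReal (A * τ * 2⁻¹ ^ k) * hardyNormSq n f := by
  obtain ⟨A, hA0, hA⟩ := hρ.exists_moment_bound hn hr
  refine ⟨A * ((2 * n : ℕ) * A), by positivity, fun k τ hτ hcar f hf => ?_⟩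
  obtain ⟨N, hN1, hN2⟩ := hA k
  have hd : ∀ a : Fin N → Fin n, DifferentiableOn ℂ (fun z => monomial a z * f z) (unitBall n) :=
    fun a => (differentiable_monomial a).differentiableOn.mul hf.1
  -- Summed over the words `a`, the spherical means equal `x^{2N}` times that of `f`, hence at most
  -- `x^{2N}` times the Hardy norm. What remains is the moment of the weight.
  have hsum : ∑ a : Fin N → Fin n, bergmanNormSq n ρ (fun z => monomial a z * f z) ≤
      ENNReal.ofReal ((2 * n : ℕ) * (A * 2⁻¹ ^ k)) * hardyNormSq n f := by
    have hN : ((2 * n : ℕ) : ℝ≥0∞) = ENNReal.ofReal ((2 * n : ℕ) : ℝ) :=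
      (ENNReal.ofReal_natCast _).symm
    calc ∑ a : Fin N → Fin n, bergmanNormSq n ρ (fun z => monomial a z * f z)
        = (2 * n : ℕ) * ∑ a : Fin N → Fin n, ∫⁻ x in Ioo (0 : ℝ) 1,
            ENNReal.ofReal (x ^ (2 * n - 1)) *
              (ENNReal.ofReal (ρ x) * sphereMean (fun z => monomial a z * f z) x) := by
          rw [Finset.mul_sum]
          exact Finset.sum_congr rfl fun a _ => bergmanNormSq_eq hn hρ.1.continuousOn (hd a)
      _ ≤ (2 * n : ℕ) * ∫⁻ x in Ioo (0 : ℝ) 1, ∑ a : Fin N → Fin n,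
            ENNReal.ofReal (x ^ (2 * n - 1)) *
              (ENNReal.ofReal (ρ x) * sphereMean (fun z => monomial a z * f z) x) := by
          gcongr
          exact sum_lintegral_le _ _
      _ ≤ (2 * n : ℕ) * ∫⁻ x in Ioo (0 : ℝ) 1, ENNReal.ofReal (x ^ (2 * n - 1)) *
            (ENNReal.ofReal (ρ x) * ENNReal.ofReal (x ^ (2 * N))) * hardyNormSq n f := by
          refine mul_le_mul_right (setLIntegral_mono' measurableSet_Ioo fun x hx => ?_) _
          rw [← Finset.mul_sum, ← Finset.mul_sum, sum_sphereMean_monomial_mul hn hf.1 N hx,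
            mul_assoc, mul_assoc]
          gcongr
          exact sphereMean_le_hardyNormSq f hx
      _ ≤ (2 * n : ℕ) * (ENNReal.ofReal (A * 2⁻¹ ^ k) * hardyNormSq n f) := by
          rw [lintegral_mul_const' _ _ hf.2.ne]
          gcongr
      _ = _ := by
          rw [ENNReal.ofReal_mul (p := ((2 * n : ℕ) : ℝ)) (by positivity), ← hN, mul_assoc]
  have hmem : ∀ a : Fin N → Fin n, (fun z => monomial a z * f z) ∈ holSpace (bergmanNormSq n ρ) :=
    fun a => ⟨hd a, ((Finset.single_le_sum (f := fun a => bergmanNormSq n ρ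
      (fun z => monomial a z * f z)) (fun _ _ => zero_le) (Finset.mem_univ a)).trans
        hsum).trans_lt (ENNReal.mul_lt_top ENNReal.ofReal_lt_top hf.2)⟩
  calc ∫⁻ z in annulus n r k, ‖f (z : Cn n)‖ₑ ^ 2 ∂μ
      ≤ ∫⁻ z in annulus n r k, ENNReal.ofReal A *
          ∑ a : Fin N → Fin n, ‖monomial a (z : Cn n) * f (z : Cn n)‖ₑ ^ 2 ∂μ := by
        refine setLIntegral_mono' (measurableSet_annulus r k) fun z hz => ?_
        have h1 : ∑ a : Fin N → Fin n, ‖monomial a (z : Cn n) * f (z : Cn n)‖ₑ ^ 2 =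
            ENNReal.ofReal (‖(z : Cn n)‖ ^ (2 * N)) * ‖f (z : Cn n)‖ₑ ^ 2 := by
          simp only [enorm_mul, mul_pow]
          rw [← Finset.sum_mul, sum_enorm_monomial_sq]
        rw [h1, ← mul_assoc, ← ENNReal.ofReal_mul hA0.le]
        refine le_mul_of_one_le_left zero_le ?_
        rw [ENNReal.one_le_ofReal]
        exact hN1 _ hz.1
    _ = ENNReal.ofReal A * ∑ a : Fin N → Fin n,
          ∫⁻ z in annulus n r k, ‖monomial a (z : Cn n) * f (z : Cn n)‖ₑ ^ 2 ∂μ := by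
        rw [lintegral_const_mul' _ _ ENNReal.ofReal_ne_top, lintegral_finsetSum]
        exact fun a _ => ((continuous_coe_unitBall (hd a)).measurable.enorm).pow_const 2
    _ ≤ ENNReal.ofReal A * ∑ a : Fin N → Fin n,
          ENNReal.ofReal τ * bergmanNormSq n ρ (fun z => monomial a z * f z) := by
        gcongr with a
        exact hcar _ (hmem a)
    _ ≤ ENNReal.ofReal A * (ENNReal.ofReal τ *
          (ENNReal.ofReal ((2 * n : ℕ) * (A * 2⁻¹ ^ k)) * hardyNormSq n f)) := by
        rw [← Finset.mul_sum]
        gcongr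
    _ = _ := by
        rw [← mul_assoc, ← mul_assoc, ← ENNReal.ofReal_mul hA0.le,
          ← ENNReal.ofReal_mul (by positivity)]
        congr 2
        ring

end

/-! ### Compactness of the embedding and smallness near the boundary. -/

section

variable {n : ℕ} {ρ : ℝ → ℝ} {r : ℕ → ℝ}

/-! ### Square integrals and finite nets -/

theorem enorm_add_sq_le (a b : ℂ) : ‖a + b‖ₑ ^ 2 ≤ 2 * ‖a‖ₑ ^ 2 + 2 * ‖b‖ₑ ^ 2 := by
  simp only [← ofReal_norm, ← ENNReal.ofReal_pow (norm_nonneg _)]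
  rw [← ENNReal.ofReal_ofNat, ← ENNReal.ofReal_mul zero_le_two, ← ENNReal.ofReal_mul zero_le_two,
    ← ENNReal.ofReal_add (by positivity) (by positivity)]
  refine ENNReal.ofReal_le_ofReal ?_
  have h := norm_add_le a b
  nlinarith [norm_nonneg (a + b), sq_nonneg (‖a‖ - ‖b‖)]

theorem edist_Lp_two_sq {α : Type*} [MeasurableSpace α] {μ : Measure α} (f g : Lp ℂ 2 μ) :
    edist f g ^ 2 = ∫⁻ z, ‖f z - g z‖ₑ ^ 2 ∂μ := by
  rw [Lp.edist_def, eLpNorm_eq_lintegral_rpow_enorm_toReal two_ne_zero ENNReal.ofNat_ne_top,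
    ← ENNReal.rpow_natCast, ← ENNReal.rpow_mul]
  simp

/-- A bounded set in a finite-dimensional space is totally bounded; the centres are chosen in the
range of `Φ`, so the net consists of indices. -/
theorem exists_finite_net {ι P : Type*} [Fintype P] (Φ : ι → P → ℂ) {B : ℝ}
    (hB : ∀ i p, ‖Φ i p‖ ≤ B) {δ : ℝ} (hδ : 0 < δ) :
    ∃ T : Set ι, T.Finite ∧ ∀ i, ∃ j ∈ T, ∀ p, ‖Φ i p - Φ j p‖ ≤ δ := by
  have hsub : range Φ ⊆ Metric.closedBall 0 (max B 0) := by
    rintro _ ⟨i, rfl⟩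
    rw [mem_closedBall_zero_iff, pi_norm_le_iff_of_nonneg (le_max_right _ _)]
    exact fun p => (hB i p).trans (le_max_left _ _)
  obtain ⟨t, hts, htf, hcov⟩ := Metric.finite_approx_of_totallyBounded
    ((isCompact_closedBall _ _).totallyBounded.subset hsub) δ hδ
  have := htf.to_subtype
  refine ⟨range fun y : t => (hts y.2).choose, finite_range _, fun i => ?_⟩
  obtain ⟨y, hy, hiy⟩ := mem_iUnion₂.1 (hcov (mem_range_self i))
  refine ⟨_, ⟨⟨y, hy⟩, rfl⟩, fun p => ?_⟩
  rw [(hts hy).choose_spec, ← Pi.sub_apply]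
  refine (norm_le_pi_norm _ p).trans ?_
  rw [← dist_eq_norm]
  exact (Metric.mem_ball.1 hiy).le

/-- Holomorphic functions with a common bound are determined up to a small error on a smaller ball
by their values at finitely many points. -/
theorem exists_finset_approx {a B δ : ℝ} (ha : a < 1) (hB : 0 ≤ B) (hδ : 0 < δ) :
    ∃ P : Finset (Cn n), (∀ p ∈ P, ‖p‖ ≤ a) ∧ ∀ z : Cn n, ‖z‖ ≤ a → ∃ p ∈ P, ∀ f : Cn n → ℂ,
      DifferentiableOn ℂ f (unitBall n) → (∀ w : Cn n, ‖w‖ ≤ (1 + a) / 2 → ‖f w‖ ≤ B) →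
        ‖f z - f p‖ ≤ δ := by
  set R := (1 - a) / 2 with hR
  have hR0 : 0 < R := by rw [hR]; linarith
  -- The Schwarz lemma on a ball of radius `R` around `p` gives the Lipschitz constant `2B/R`; the
  -- `+ 1` covers `B = 0`. The mesh does not depend on `f`.
  have he : 0 < min R (δ * R / (2 * B + 1)) := by positivity
  obtain ⟨t, hts, htf, hcov⟩ := (isCompact_closedBall (0 : Cn n) a).finite_cover_balls he
  refine ⟨htf.toFinset, fun p hp => ?_, fun z hz => ?_⟩
  · simpa using hts (htf.mem_toFinset.1 hp)
  · obtain ⟨p, hp, hzp⟩ := mem_iUnion₂.1 (hcov (mem_closedBall_zero_iff.2 hz))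
    have hpa : ‖p‖ ≤ a := by simpa using hts hp
    have hball : ∀ w ∈ Metric.ball p R, ‖w‖ ≤ (1 + a) / 2 := fun w hw => by
      have h1 := norm_add_le (w - p) p
      rw [sub_add_cancel, ← dist_eq_norm] at h1
      have h2 := Metric.mem_ball.1 hw
      linarith
    refine ⟨p, htf.mem_toFinset.2 hp, fun f hf hfB => ?_⟩
    have hd : DifferentiableOn ℂ f (Metric.ball p R) := hf.mono fun w hw => by
      rw [mem_ball_zero_iff]
      have := hball w hw
      linarith
    have hmaps : MapsTo f (Metric.ball p R) (Metric.closedBall (f p) (2 * B)) := fun w hw => by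
      rw [Metric.mem_closedBall, dist_eq_norm]
      have h1 := hfB w (hball w hw)
      have h2 := hfB p (hball p (Metric.mem_ball_self hR0))
      linarith [norm_sub_le (f w) (f p)]
    rw [Metric.mem_ball, lt_min_iff] at hzp
    rw [← dist_eq_norm]
    refine (Complex.dist_le_div_mul_dist_of_mapsTo_ball hd hmaps
      (Metric.mem_ball.2 hzp.1)).trans ?_
    rw [div_mul_eq_mul_div, div_le_iff₀ hR0]
    have h1 := hzp.2
    rw [lt_div_iff₀ (by positivity)] at h1
    nlinarith [dist_nonneg (x := z) (y := p)]

theorem tendsto_setLIntegral_outerPart {μ : Measure (unitBall n)} [IsFiniteMeasure μ]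
    (hr : Tendsto r atTop (𝓝 1)) (hmono : Monotone r) {F : unitBall n → ℝ≥0∞}
    (hF : ∫⁻ z, F z ∂μ ≠ ∞) :
    Tendsto (fun k => ∫⁻ z in outerPart n (r k), F z ∂μ) atTop (𝓝 0) := by
  refine tendsto_setLIntegral_zero hF ?_
  have h := tendsto_measure_iInter_atTop (μ := μ) (s := fun k => outerPart n (r k))
    (fun k => (measurableSet_outerPart _).nullMeasurableSet)
    (fun i j hij z hz => (hmono hij).trans hz) ⟨0, measure_ne_top _ _⟩
  have h0 : ⋂ k, outerPart n (r k) = ∅ := by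
    refine eq_empty_of_forall_notMem fun z hz => ?_
    exact (mem_ball_zero_iff.1 z.2).not_ge
      (le_of_tendsto hr (Eventually.of_forall fun k => mem_iInter.1 hz k))
  rwa [h0, measure_empty] at h

/-! ### Compactness -/

theorem memLp_of_isCarleson {N : (Cn n → ℂ) → ℝ≥0∞} {μ : Measure (unitBall n)}
    (h : IsCarleson N μ) {f : Cn n → ℂ} (hf : f ∈ holSpace N) :
    MemLp (fun z : unitBall n => f (z : Cn n)) 2 μ := by
  obtain ⟨C, -, hC⟩ := h
  refine ⟨(continuous_coe_unitBall hf.1).aestronglyMeasurable, ?_⟩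
  rw [eLpNorm_lt_top_iff_lintegral_rpow_enorm_lt_top two_ne_zero ENNReal.ofNat_ne_top]
  simpa using (hC f hf).trans_lt (ENNReal.mul_lt_top ENNReal.ofReal_lt_top hf.2)

theorem bergmanNormSq_const_mul (c : ℂ) (f : Cn n → ℂ) :
    bergmanNormSq n ρ (fun z => c * f z) = ‖c‖ₑ ^ 2 * bergmanNormSq n ρ f := by
  unfold bergmanNormSq
  rw [← lintegral_const_mul' _ _ (by finiteness)]
  simp only [enorm_mul, mul_pow, mul_assoc]

/-- For a vanishing Carleson measure the mass near the boundary is uniformly small. -/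
theorem IsVanishingCarleson.eventually_lintegral_le {μ : Measure (unitBall n)} [IsFiniteMeasure μ]
    (h : IsVanishingCarleson (bergmanNormSq n ρ) μ) (hr : Tendsto r atTop (𝓝 1))
    (hmono : Monotone r) {τ : ℝ} (hτ : 0 < τ) :
    ∀ᶠ k in atTop, ∀ f ∈ holSpace (bergmanNormSq n ρ),
      ∫⁻ z in outerPart n (r k), ‖f (z : Cn n)‖ₑ ^ 2 ∂μ ≤
        ENNReal.ofReal τ * bergmanNormSq n ρ f := by
  obtain ⟨hC, hK⟩ := h
  -- The squared distance to the net is at most `τ/4`, and so is the tail of each centre; doubling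
  -- both by `|a+b|² ≤ 2|a|² + 2|b|²` gives `τ`.
  obtain ⟨t, htf, hcov⟩ := Metric.totallyBounded_iff.1 (hK.totallyBounded.subset subset_closure)
    (√(τ / 4)) (by positivity)
  have htail : ∀ᶠ k in atTop, ∀ g ∈ t, ∫⁻ z in outerPart n (r k), ‖g z‖ₑ ^ 2 ∂μ ≤
      ENNReal.ofReal (τ / 4) := by
    rw [eventually_all_finite htf]
    intro g _
    have hg := Lp.memLp g
    have hg' : ∫⁻ z, ‖g z‖ₑ ^ 2 ∂μ ≠ ∞ := by
      rw [← ofReal_integral_norm_sq hg]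
      exact ENNReal.ofReal_ne_top
    exact (tendsto_setLIntegral_outerPart hr hmono hg').eventually_le_const
      (by simpa using hτ)
  filter_upwards [htail] with k hk
  have hunit : ∀ f ∈ holSpace (bergmanNormSq n ρ), bergmanNormSq n ρ f ≤ 1 →
      ∫⁻ z in outerPart n (r k), ‖f (z : Cn n)‖ₑ ^ 2 ∂μ ≤ ENNReal.ofReal τ := by
    intro f hf hf1
    have hL := memLp_of_isCarleson hC hf
    obtain ⟨g, hg, hfg⟩ := mem_iUnion₂.1 (hcov ⟨f, hf, hf1, hL.coeFn_toLp⟩)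
    have h1 : ∫⁻ z, ‖f (z : Cn n) - g z‖ₑ ^ 2 ∂μ ≤ ENNReal.ofReal (τ / 4) := by
      have h2 : ∫⁻ z, ‖f (z : Cn n) - g z‖ₑ ^ 2 ∂μ = edist (hL.toLp _) g ^ 2 := by
        rw [edist_Lp_two_sq]
        refine lintegral_congr_ae ?_
        filter_upwards [hL.coeFn_toLp] with z hz
        rw [hz]
      rw [h2, edist_dist, ← ENNReal.ofReal_pow dist_nonneg]
      refine ENNReal.ofReal_le_ofReal ?_
      rw [← Real.sq_sqrt (show 0 ≤ τ / 4 by positivity)]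
      exact pow_le_pow_left₀ dist_nonneg (Metric.mem_ball.1 hfg).le 2
    calc ∫⁻ z in outerPart n (r k), ‖f (z : Cn n)‖ₑ ^ 2 ∂μ
        ≤ ∫⁻ z in outerPart n (r k), (2 * ‖f (z : Cn n) - g z‖ₑ ^ 2 + 2 * ‖g z‖ₑ ^ 2) ∂μ := by
          refine lintegral_mono fun z => ?_
          simpa using enorm_add_sq_le (f (z : Cn n) - g z) (g z)
      _ = 2 * ∫⁻ z in outerPart n (r k), ‖f (z : Cn n) - g z‖ₑ ^ 2 ∂μ +
            2 * ∫⁻ z in outerPart n (r k), ‖g z‖ₑ ^ 2 ∂μ := by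
          rw [lintegral_add_right, lintegral_const_mul' _ _ ENNReal.ofNat_ne_top,
            lintegral_const_mul' _ _ ENNReal.ofNat_ne_top]
          exact ((Lp.stronglyMeasurable g).measurable.enorm.pow_const 2).const_mul 2
      _ ≤ 2 * ENNReal.ofReal (τ / 4) + 2 * ENNReal.ofReal (τ / 4) := by
          gcongr
          · exact (setLIntegral_le_lintegral _ _).trans h1
          · exact hk g hg
      _ = ENNReal.ofReal τ := by
          rw [← ENNReal.ofReal_ofNat, ← ENNReal.ofReal_mul zero_le_two,
            ← ENNReal.ofReal_add (by positivity) (by positivity)]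
          congr 1
          ring
  intro f hf
  -- Functions of norm zero cannot be normalized; for them the Carleson inequality already gives
  -- integral zero.
  by_cases h0 : bergmanNormSq n ρ f = 0
  · obtain ⟨C, -, hC'⟩ := hC
    have h1 := hC' f hf
    rw [h0, mul_zero] at h1 ⊢
    exact (setLIntegral_le_lintegral _ _).trans h1
  · set s := (bergmanNormSq n ρ f).toReal with hs
    have hs0 : 0 < s := ENNReal.toReal_pos h0 hf.2.ne
    have hsB : bergmanNormSq n ρ f = ENNReal.ofReal s := (ENNReal.ofReal_toReal hf.2.ne).symm
    set c : ℂ := (((√s)⁻¹ : ℝ) : ℂ) with hc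
    have hc2 : ‖c‖ₑ ^ 2 = (ENNReal.ofReal s)⁻¹ := by
      rw [← ofReal_norm, ← ENNReal.ofReal_pow (norm_nonneg _), hc, Complex.norm_real,
        Real.norm_of_nonneg (by positivity), inv_pow, Real.sq_sqrt hs0.le,
        ENNReal.ofReal_inv_of_pos hs0]
    have hs1 : ENNReal.ofReal s ≠ 0 := by simpa using hs0
    have hB : bergmanNormSq n ρ (fun z => c * f z) = 1 := by
      rw [bergmanNormSq_const_mul, hc2, hsB, ENNReal.inv_mul_cancel hs1 ENNReal.ofReal_ne_top]
    have h1 := hunit (fun z => c * f z)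
      ⟨hf.1.const_mul c, by rw [hB]; exact ENNReal.one_lt_top⟩ hB.le
    simp only [enorm_mul, mul_pow] at h1
    rw [lintegral_const_mul' _ _ (by finiteness), hc2, ← ENNReal.div_eq_inv_mul,
      ENNReal.div_le_iff hs1 ENNReal.ofReal_ne_top, ← hsB] at h1
    exact h1

/-- If the contribution of the mass near the boundary is uniformly small, then the embedding of the
Bergman space is compact. -/
theorem isCompact_closure_of_outer_estimate (hn : 1 ≤ n) (hρ : IsWeight n ρ) (hr : IsDyadicSeq ρ r)
    {μ : Measure (unitBall n)} [IsFiniteMeasure μ]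
    (h : ∀ η : ℝ, 0 < η → ∃ K, ∀ f ∈ holSpace (bergmanNormSq n ρ),
      ∫⁻ z in outerPart n (r K), ‖f (z : Cn n)‖ₑ ^ 2 ∂μ ≤
        ENNReal.ofReal η * bergmanNormSq n ρ f) :
    IsCompact (closure {g : Lp ℂ 2 μ | ∃ f ∈ holSpace (bergmanNormSq n ρ),
      bergmanNormSq n ρ f ≤ 1 ∧ ∀ᵐ z ∂μ, g z = f (z : Cn n)}) := by
  set S := {g : Lp ℂ 2 μ | ∃ f ∈ holSpace (bergmanNormSq n ρ),
      bergmanNormSq n ρ f ≤ 1 ∧ ∀ᵐ z ∂μ, g z = f (z : Cn n)} with hS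
  refine TotallyBounded.isCompact_of_isClosed (TotallyBounded.closure ?_) isClosed_closure
  rw [Metric.totallyBounded_iff]
  intro ε hε
  set m := μ.real univ with hm
  have hm0 : 0 ≤ m := measureReal_nonneg
  -- Two tails of size `ε²/16`, each doubled, give `ε²/4`. The choice of `δ` below makes the inner
  -- part `(3δ)² m ≤ ε²/4`, so the squared distance is at most `ε²/2 < ε²`.
  obtain ⟨K, hK⟩ := h (ε ^ 2 / 16) (by positivity)
  set a := r K with ha
  have ha0 : 0 ≤ a := (hr K).1.1
  have ha1 : a < 1 := (hr K).1.2
  obtain ⟨D, hD0, hD⟩ := exists_enorm_sq_le_bergmanNormSq hn hρ hr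
    (show 0 ≤ (1 + a) / 2 by linarith) (show (1 + a) / 2 < 1 by linarith)
  set δ := ε / (6 * (m + 1)) with hδ
  have hδ0 : 0 < δ := by positivity
  obtain ⟨P, hPa, hP⟩ := exists_finset_approx (n := n) (B := √D) ha1 (by positivity) hδ0
  choose F hF hF1 hFg using fun g : S => g.2
  have hFB : ∀ (g : S) (z : Cn n), ‖z‖ ≤ (1 + a) / 2 → ‖F g z‖ ≤ √D := fun g z hz => by
    have h1 := (hD (F g) (hF g).1 z hz).trans (mul_le_mul_right (hF1 g) _)
    rw [mul_one, ← ofReal_norm, ← ENNReal.ofReal_pow (norm_nonneg _),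
      ENNReal.ofReal_le_ofReal_iff hD0.le] at h1
    exact Real.le_sqrt_of_sq_le h1
  obtain ⟨T, hT, hnet⟩ := exists_finite_net (fun (g : S) (p : P) => F g p) (B := √D)
    (fun g p => hFB g p ((hPa p p.2).trans (by linarith))) hδ0
  refine ⟨Subtype.val '' T, hT.image _, fun g hg => ?_⟩
  obtain ⟨g', hg', hgg'⟩ := hnet ⟨g, hg⟩
  refine mem_iUnion₂.2 ⟨g', mem_image_of_mem _ hg', ?_⟩
  set f := F ⟨g, hg⟩ with hf
  set f' := F g' with hf'
  -- One `δ` each for moving `f` and `f'` from `z` to the common point `p`, and one for their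
  -- difference at `p`.
  have hin : ∀ z : Cn n, ‖z‖ ≤ a → ‖f z - f' z‖ ≤ 3 * δ := fun z hz => by
    obtain ⟨p, hp, hzp⟩ := hP z hz
    have h1 := hzp f (hF _).1 (hFB _)
    have h2 := hzp f' (hF _).1 (hFB _)
    have h3 := hgg' ⟨p, hp⟩
    have h4 : f z - f' z = (f z - f p) + (f p - f' p) - (f' z - f' p) := by ring
    rw [h4]
    refine (norm_sub_le _ _).trans ?_
    linarith [norm_add_le (f z - f p) (f p - f' p)]
  have hout : ∫⁻ z in outerPart n a, ‖f (z : Cn n) - f' (z : Cn n)‖ₑ ^ 2 ∂μ ≤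
      ENNReal.ofReal (ε ^ 2 / 4) := by
    have htail : ∀ g : S, ∫⁻ z in outerPart n a, ‖F g (z : Cn n)‖ₑ ^ 2 ∂μ ≤
        ENNReal.ofReal (ε ^ 2 / 16) := fun g =>
      (hK _ (hF g)).trans (mul_le_of_le_one_right zero_le (hF1 g))
    calc ∫⁻ z in outerPart n a, ‖f (z : Cn n) - f' (z : Cn n)‖ₑ ^ 2 ∂μ
        ≤ ∫⁻ z in outerPart n a, (2 * ‖f (z : Cn n)‖ₑ ^ 2 + 2 * ‖f' (z : Cn n)‖ₑ ^ 2) ∂μ := by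
          refine lintegral_mono fun z => ?_
          simpa [sub_eq_add_neg] using enorm_add_sq_le (f (z : Cn n)) (-f' (z : Cn n))
      _ = 2 * ∫⁻ z in outerPart n a, ‖f (z : Cn n)‖ₑ ^ 2 ∂μ +
            2 * ∫⁻ z in outerPart n a, ‖f' (z : Cn n)‖ₑ ^ 2 ∂μ := by
          rw [lintegral_add_right, lintegral_const_mul' _ _ ENNReal.ofNat_ne_top,
            lintegral_const_mul' _ _ ENNReal.ofNat_ne_top]
          exact ((continuous_coe_unitBall (hF g').1).measurable.enorm.pow_const 2).const_mul 2
      _ ≤ 2 * ENNReal.ofReal (ε ^ 2 / 16) + 2 * ENNReal.ofReal (ε ^ 2 / 16) := by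
          gcongr
          · exact htail _
          · exact htail _
      _ = ENNReal.ofReal (ε ^ 2 / 4) := by
          rw [← ENNReal.ofReal_ofNat, ← ENNReal.ofReal_mul zero_le_two,
            ← ENNReal.ofReal_add (by positivity) (by positivity)]
          congr 1
          ring
  have hinn : ∫⁻ z in (outerPart n a)ᶜ, ‖f (z : Cn n) - f' (z : Cn n)‖ₑ ^ 2 ∂μ ≤
      ENNReal.ofReal ((3 * δ) ^ 2 * m) := by
    calc ∫⁻ z in (outerPart n a)ᶜ, ‖f (z : Cn n) - f' (z : Cn n)‖ₑ ^ 2 ∂μ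
        ≤ ∫⁻ _ in (outerPart n a)ᶜ, ENNReal.ofReal ((3 * δ) ^ 2) ∂μ := by
          refine setLIntegral_mono' (measurableSet_outerPart _).compl fun z hz => ?_
          rw [← ofReal_norm, ← ENNReal.ofReal_pow (norm_nonneg _)]
          exact ENNReal.ofReal_le_ofReal (pow_le_pow_left₀ (norm_nonneg _)
            (hin z (not_le.1 (show ¬ a ≤ ‖(z : Cn n)‖ from hz)).le) 2)
      _ ≤ ∫⁻ _, ENNReal.ofReal ((3 * δ) ^ 2) ∂μ := setLIntegral_le_lintegral _ _
      _ = ENNReal.ofReal ((3 * δ) ^ 2 * m) := by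
          rw [lintegral_const, ENNReal.ofReal_mul (by positivity), hm, ofReal_measureReal]
  have hsq : edist g (g' : Lp ℂ 2 μ) ^ 2 ≤ ENNReal.ofReal (ε ^ 2 / 2) := by
    have h1 : edist g (g' : Lp ℂ 2 μ) ^ 2 = ∫⁻ z, ‖f (z : Cn n) - f' (z : Cn n)‖ₑ ^ 2 ∂μ := by
      rw [edist_Lp_two_sq]
      refine lintegral_congr_ae ?_
      filter_upwards [hFg ⟨g, hg⟩, hFg g'] with z h1 h2
      rw [hf, hf', ← h1, ← h2]
    rw [h1, ← lintegral_add_compl _ (measurableSet_outerPart a)]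
    refine (add_le_add hout hinn).trans ?_
    rw [← ENNReal.ofReal_add (by positivity) (by positivity)]
    refine ENNReal.ofReal_le_ofReal ?_
    have h2 : (3 * δ) ^ 2 * m ≤ ε ^ 2 / 4 := by
      have h3 : (3 * δ) ^ 2 * m = ε ^ 2 / 4 * (m / (m + 1) ^ 2) := by
        rw [hδ]
        field_simp
        ring
      rw [h3]
      refine mul_le_of_le_one_right (by positivity) ?_
      rw [div_le_one (by positivity)]
      nlinarith
    linarith
  rw [edist_dist, ← ENNReal.ofReal_pow dist_nonneg, ENNReal.ofReal_le_ofReal_iff (by positivity)]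
    at hsq
  rw [Metric.mem_ball]
  refine lt_of_pow_lt_pow_left₀ 2 hε.le (hsq.trans_lt ?_)
  have : 0 < ε ^ 2 := by positivity
  linarith

theorem two_pow_mul_le_iff {C : ℝ≥0∞} {ε : ℝ} (hε : 0 ≤ ε) (k : ℕ) :
    2 ^ k * C ≤ ENNReal.ofReal ε ↔ C ≤ ENNReal.ofReal (ε * 2⁻¹ ^ k) := by
  rw [ENNReal.ofReal_mul hε, inv_pow, ENNReal.ofReal_inv_of_pos (by positivity),
    ENNReal.ofReal_pow zero_le_two, ENNReal.ofReal_ofNat, ← div_eq_mul_inv,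
    ENNReal.le_div_iff_mul_le (Or.inl (by simp)) (Or.inl (by finiteness)), mul_comm]

theorem tendsto_two_pow_mul_iff {C : ℕ → ℝ≥0∞} :
    Tendsto (fun k => 2 ^ k * C k) atTop (𝓝 0) ↔
      ∀ ε : ℝ, 0 < ε → ∀ᶠ k in atTop, C k ≤ ENNReal.ofReal (ε * 2⁻¹ ^ k) := by
  rw [ENNReal.tendsto_nhds_zero]
  constructor
  · intro h ε hε
    filter_upwards [h (ENNReal.ofReal ε) (by simpa using hε)] with k hk
    exact (two_pow_mul_le_iff hε.le k).1 hk
  · intro h ε hε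
    obtain ⟨δ, -, hδ0, hδ⟩ := ENNReal.lt_iff_exists_real_btwn.1 hε
    rw [ENNReal.ofReal_pos] at hδ0
    filter_upwards [h δ hδ0] with k hk
    exact ((two_pow_mul_le_iff hδ0.le k).2 hk).trans hδ.le

end

end SmallBergman

end

/-! ### Assembly of the two characterizations. -/

theorem theorem1 (n : ℕ) (hn : 1 ≤ n) (ρ : ℝ → ℝ) (hρ : SmallBergman.ClassS n ρ)
    (r : ℕ → ℝ) (hr : SmallBergman.IsDyadicSeq ρ r)
    (μ : Measure (SmallBergman.unitBall n)) [IsFiniteMeasure μ] :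
    (SmallBergman.IsCarleson (SmallBergman.bergmanNormSq n ρ) μ ↔
      ∃ C : ℝ, 0 < C ∧ ∀ k : ℕ,
        SmallBergman.IsCarleson (SmallBergman.hardyNormSq n)
          (μ.restrict (SmallBergman.annulus n r k)) ∧
        SmallBergman.carlesonConst (SmallBergman.hardyNormSq n)
          (μ.restrict (SmallBergman.annulus n r k)) ≤ ENNReal.ofReal (C * (2 : ℝ)⁻¹ ^ k)) ∧
    (SmallBergman.IsVanishingCarleson (SmallBergman.bergmanNormSq n ρ) μ ↔
      Tendsto (fun k : ℕ => (2 : ℝ≥0∞) ^ k *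
        SmallBergman.carlesonConst (SmallBergman.hardyNormSq n)
          (μ.restrict (SmallBergman.annulus n r k))) atTop (𝓝 0)) := by
  have hmono := (hr.strictMono hρ.1).monotone
  have hlim := hr.tendsto hρ.1
  obtain ⟨A, hA0, hA⟩ := hρ.exists_annulus_estimate hn hr μ
  refine ⟨⟨?_, ?_⟩, ?_, ?_⟩
  · rintro ⟨C, hC0, hC⟩
    refine ⟨A * C, by positivity, fun k =>
      ⟨SmallBergman.isCarleson_hardy_restrict_annulus hn hr μ k, SmallBergman.carlesonConst_le ?_⟩⟩
    exact hA k C hC0.le fun h hh => (setLIntegral_le_lintegral _ _).trans (hC h hh)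
  · rintro ⟨C, hC0, hC⟩
    exact hρ.isCarleson_of_eventually hn hr μ (K := 0) hC0.le fun k _ => (hC k).2
  · intro hV
    rw [SmallBergman.tendsto_two_pow_mul_iff]
    intro ε hε
    filter_upwards [hV.eventually_lintegral_le hlim hmono (τ := ε / A) (by positivity)] with k hk
    have h1 := SmallBergman.carlesonConst_le (hA k (ε / A) (by positivity) fun h hh =>
      (lintegral_mono_set (SmallBergman.annulus_subset_outerPart r k)).trans (hk h hh))
    rwa [mul_div_cancel₀ _ hA0.ne'] at h1
  · intro ht
    rw [SmallBergman.tendsto_two_pow_mul_iff] at ht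
    obtain ⟨K, hK⟩ := eventually_atTop.1 (ht 1 one_pos)
    refine ⟨hρ.isCarleson_of_eventually hn hr μ zero_le_one hK,
      SmallBergman.isCompact_closure_of_outer_estimate hn hρ.1 hr fun η hη => ?_⟩
    obtain ⟨D, hD0, hD⟩ := hρ.exists_outer_estimate hn hr μ
    -- The constant `D` of the outer estimate does not depend on the starting annulus or on the size
    -- of the Carleson constants, so it can be divided out in advance.
    obtain ⟨L, hL⟩ := eventually_atTop.1 (ht (η / D) (by positivity))
    refine ⟨L, fun f hf => ?_⟩
    have h1 := hD L (η / D) (by positivity) hL f hf.1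
    rwa [mul_div_cancel₀ _ hD0.ne'] at h1
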